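/- Let $n\ge 1$ and let $\Gamma$ be a Kleinian group, i.e. a discrete group of isometries of the hyperbolic ball $B^{n+1}$ with metric $4|dx|^2/(1-|x|^2)^2$, acting also on $S^n=\partial B^{n+1}$. Let $L(\Gamma)\subset S^n$ be its limit set and $\Omega(\Gamma)=S^n\setminus L(\Gamma)$ its domain of discontinuity. Assume that $\Gamma$ is nonelementary ($L(\Gamma)$ has more than two points) and of the second kind ($L(\Gamma)\ne S^n$). For $\varepsilon>0$ let $U_\varepsilon\subset B^{n+1}$ be the union of the hyperbolic half spaces over all the spherical balls $\gamma B(p,\varepsilon\,\mathrm{dist}(p,L(\Gamma)))$, $p\in\Omega(\Gamma)$, $\gamma\in\Gamma$ (distances on the round sphere), let $G(\Gamma)=\partial U_\varepsilon\cap B^{n+1}$, and $S_\Gamma=G(\Gamma)/\Gamma\subset B^{n+1}/\Gamma$. For small $\varepsilon$, $G(\Gamma)$ is a $\Gamma$-invariant Lipschitz radial graph over $\Omega(\Gamma)$; $d\sigma$ denotes its hyperbolic area element, defined by the usual formula for the area of a radial Lipschitz graph, and $\partial/\partial n$ the derivative along its hyperbolic unit normal (defined almost everywhere) pointing into $U_\varepsilon$,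 that is, towards $\Omega(\Gamma)$. Let $\omega_\Gamma$ be the function on $B^{n+1}/\Gamma$ whose lift to $B^{n+1}$ is the harmonic measure of $\Omega(\Gamma)$, $$u_\Gamma(x)=\frac1{\mathrm{vol}(S^n)}\int_{S^n}\Big(\frac{1-|x|^2}{|x-y|^2}\Big)^n\chi_{\Omega(\Gamma)}(y)\,d\omega(y),$$ with $d\omega$ the standard volume element of $S^n$. Let $G(x,y)$ be the minimal positive Green's function of $B^{n+1}/\Gamma$ (the smallest positive function of $y$, harmonic off $x$, with the singularity of $g$ at $x$, where $$g(x,y)=\int_{|T_xy|}^1\frac{(1-t^2)^{n-1}}{t^n}\,dt$$ is the Green's function of $B^{n+1}$ and $T_x$ is a Möbius transformation of the ball with $T_xx=0$; at the image of a point with nontrivial stabilizer in $\Gamma$ the singularity is $g$ times the order of the stabilizer). Then there is $\varepsilon_1>0$, depending on $\Gamma$, such that for all $0<\varepsilon<\varepsilon_1$ and all $x\in (B^{n+1}\setminus \overline{U_\varepsilon})/\Gamma$ (the points on the convex-core side of $S_\Gamma$) the function $\partial G/\partial n\,(x,\cdot)$ is integrable over $S_\Gamma$ and $$\omega_\Gamma(x)=\frac1{2^{n-1}\,\mathrm{vol}(S^n)}\int_{S_\Gamma}\Big(-\frac{\partial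 G}{\partial n}(x,y)\Big)\,d\sigma(y),$$ the integral over $S_\Gamma$ being the integral over any fundamental region for the action of $\Gamma$ on $G(\Gamma)$ (up to $\sigma$-null sets). -/

import Mathlib

open MeasureTheory

noncomputable section

namespace KleinianGraph

/-- Euclidean space of dimension `n + 1`, which contains the ball `B^{n+1}` and the sphere `S^n`. -/
abbrev E (n : ℕ) : Type := EuclideanSpace ℝ (Fin (n + 1))

/-- The closed unit ball, i.e. `B^{n+1} ∪ S^n`. -/
abbrev CBall (n : ℕ) : Type := Metric.closedBall (0 : E n) 1

variable {n : ℕ}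

/-- The hyperbolic distance of the Poincaré ball (metric `2|dx| / (1 - |x|^2)`), so that
`sinh (d / 2) = |x - y| / sqrt ((1 - |x|^2) (1 - |y|^2))`. Meaningful for `|x|, |y| < 1`. -/
def hypDist (x y : E n) : ℝ :=
  2 * Real.arsinh (‖x - y‖ / Real.sqrt ((1 - ‖x‖ ^ 2) * (1 - ‖y‖ ^ 2)))

/-- A Kleinian group: a discrete group of hyperbolic isometries (Möbius transformations) of
`B^{n+1}`, each extended by continuity to the sphere at infinity. Discreteness is expressed by
proper discontinuity of the action on `B^{n+1}`. -/
structure IsKleinian (Γ : Subgroup (Equiv.Perm (CBall n))) : Prop where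
  continuous : ∀ γ ∈ Γ, Continuous γ
  maps_ball : ∀ γ ∈ Γ, ∀ x : CBall n, ‖(x : E n)‖ < 1 → ‖(γ x : E n)‖ < 1
  isometry : ∀ γ ∈ Γ, ∀ x y : CBall n, ‖(x : E n)‖ < 1 → ‖(y : E n)‖ < 1 →
    hypDist (γ x : E n) (γ y) = hypDist (x : E n) y
  discrete : ∀ K : Set (CBall n), IsCompact K → (∀ x ∈ K, ‖(x : E n)‖ < 1) →
    {γ | γ ∈ Γ ∧ (γ '' K ∩ K).Nonempty}.Finite

/-- The orbit of a point. -/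
def orbitSet (Γ : Subgroup (Equiv.Perm (CBall n))) (x : CBall n) : Set (E n) :=
  {z | ∃ γ ∈ Γ, z = (γ x : E n)}

/-- The limit set `L(Γ)`: the points of the sphere at which orbits of points of the ball
accumulate. -/
def limitSet (Γ : Subgroup (Equiv.Perm (CBall n))) : Set (E n) :=
  {p | ‖p‖ = 1 ∧ ∃ x : CBall n, ‖(x : E n)‖ < 1 ∧ p ∈ closure (orbitSet Γ x)}

/-- The domain of discontinuity `Ω(Γ)`, the complement of the limit set in the sphere. -/
def domainOfDiscontinuity (Γ : Subgroup (Equiv.Perm (CBall n))) : Set (E n) :=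
  Metric.sphere 0 1 \ limitSet Γ

/-- `Γ` is nonelementary: its limit set has more than two points. -/
def IsNonelementary (Γ : Subgroup (Equiv.Perm (CBall n))) : Prop :=
  2 < (limitSet Γ).encard

/-- `Γ` is of the second kind: its limit set is not the whole sphere. -/
def IsSecondKind (Γ : Subgroup (Equiv.Perm (CBall n))) : Prop :=
  limitSet Γ ≠ Metric.sphere 0 1

/-! ### The invariant graph -/

/-- Spherical distance from `p ∈ S^n` to the set `L ⊆ S^n`; the geodesic distance of the round
sphere is the angle. -/
def sphericalInfDist (p : E n) (L : Set (E n)) : ℝ :=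
  sInf ((fun q => InnerProductGeometry.angle p q) '' L)

/-- The hyperbolic half space over the open spherical ball `{q ∈ S^n : angle p q < ρ}`. When
`0 < ρ < π / 2` it is the part in `B^{n+1}` of the Euclidean ball with centre `p / cos ρ` and
radius `tan ρ`, which meets `S^n` perpendicularly along the boundary of the spherical ball. -/
def halfSpace (p : E n) (ρ : ℝ) : Set (E n) :=
  {y | ‖y‖ < 1 ∧ (1 + ‖y‖ ^ 2) * Real.cos ρ < 2 * inner ℝ y p}

/-- The union of the half spaces over all the balls `γ B(p, ε dist(p, L(Γ)))`, with `p ∈ Ω(Γ)` and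
`γ ∈ Γ`. (An isometry takes the half space over a spherical ball to the one over its image.) -/
def domeUnion (Γ : Subgroup (Equiv.Perm (CBall n))) (ε : ℝ) : Set (E n) :=
  {z | ∃ γ ∈ Γ, ∃ p ∈ domainOfDiscontinuity Γ, ∃ y : CBall n,
    (y : E n) ∈ halfSpace p (ε * sphericalInfDist p (limitSet Γ)) ∧ z = (γ y : E n)}

/-- The hypersurface `G(Γ)`: the boundary in `B^{n+1}` of the union of the half spaces. -/
def graphSet (Γ : Subgroup (Equiv.Perm (CBall n))) (ε : ℝ) : Set (E n) :=
  frontier (domeUnion Γ ε) ∩ Metric.ball 0 1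

/-- The distance from `0` to `G(Γ)` in the direction of `z ≠ 0`. On the unit sphere this is the
function `f` of which `G(Γ) = {f(θ) θ : θ ∈ Ω(Γ)}` is the radial graph; it is extended to be
homogeneous of degree `0`. -/
def radialFn (Γ : Subgroup (Equiv.Perm (CBall n))) (ε : ℝ) (z : E n) : ℝ :=
  sInf {t : ℝ | 0 < t ∧ (t / ‖z‖) • z ∈ graphSet Γ ε}

/-- A defining function of `G(Γ)`: it is negative below the graph and positive above it. -/
def defFn (Γ : Subgroup (Equiv.Perm (CBall n))) (ε : ℝ) (z : E n) : ℝ :=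
  ‖z‖ - radialFn Γ ε z

/-- The hyperbolic unit normal of `G(Γ)` at a point `y` of differentiability, pointing towards
`Ω(Γ)`: the Euclidean unit normal, rescaled by the conformal factor. -/
def unitNormal (Γ : Subgroup (Equiv.Perm (CBall n))) (ε : ℝ) (y : E n) : E n :=
  ((1 - ‖y‖ ^ 2) / 2) • (‖gradient (defFn Γ ε) y‖⁻¹ • gradient (defFn Γ ε) y)

/-- The normal derivative `∂h/∂n` at a point of `G(Γ)`. -/
def normalDeriv (Γ : Subgroup (Equiv.Perm (CBall n))) (ε : ℝ) (h : E n → ℝ) (y : E n) : ℝ :=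
  fderiv ℝ h y (unitNormal Γ ε y)

/-- The hyperbolic area measure of `G(Γ)`, as a measure on `ℝ^{n+1}`. The Euclidean area element of
the radial graph `y = f(θ) θ` of the Lipschitz function `f` is
`f^{n-1} sqrt (f^2 + |∇f|^2) dω(θ) = f^n |∇Φ(y)| dω(θ)`, where `Φ` is the defining function above
and `dω` the standard volume element of `S^n`; the hyperbolic one is `(2 / (1 - |y|^2))^n` times
that. -/
def ambientArea (Γ : Subgroup (Equiv.Perm (CBall n))) (ε : ℝ) : Measure (E n) :=
  Measure.map (fun θ : Metric.sphere (0 : E n) 1 => radialFn Γ ε (θ : E n) • (θ : E n))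
    (((volume : Measure (E n)).toSphere.restrict
      {θ | (θ : E n) ∈ domainOfDiscontinuity Γ}).withDensity
      (fun θ => ENNReal.ofReal
        ((2 * radialFn Γ ε (θ : E n) / (1 - radialFn Γ ε (θ : E n) ^ 2)) ^ n *
          ‖gradient (defFn Γ ε) (radialFn Γ ε (θ : E n) • (θ : E n))‖)))

/-- The hyperbolic area measure `dσ` of `G(Γ)`, as a measure on the closed ball, on which `Γ`
acts. -/
def area (Γ : Subgroup (Equiv.Perm (CBall n))) (ε : ℝ) : Measure (CBall n) :=
  (ambientArea Γ ε).comap Subtype.val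

/-! ### Harmonic functions and Green's functions -/

/-- `u` is harmonic for the hyperbolic Laplacian on the open set `V ⊆ B^{n+1}`. The
Laplace-Beltrami operator of `4|dx|^2 / (1 - |x|^2)^2` is
`((1 - |x|^2) / 2)^2 (Δu + 2 (n - 1) / (1 - |x|^2) x · ∇u)`. -/
def HypHarmonicOn (u : E n → ℝ) (V : Set (E n)) : Prop :=
  ContDiffOn ℝ 2 u V ∧ ∀ x ∈ V,
    ((1 - ‖x‖ ^ 2) / 2) ^ 2 *
      (Laplacian.laplacian u x + 2 * ((n : ℝ) - 1) / (1 - ‖x‖ ^ 2) * fderiv ℝ u x x) = 0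

/-- `|T_x y|`, where `T_x` is a Möbius transformation of the ball which takes `x` to `0`. -/
def moebiusNorm (x y : E n) : ℝ :=
  ‖x - y‖ / Real.sqrt (‖x - y‖ ^ 2 + (1 - ‖x‖ ^ 2) * (1 - ‖y‖ ^ 2))

/-- The Green's function `g` of hyperbolic space `B^{n+1}`. -/
def ballGreen (x y : E n) : ℝ :=
  ∫ t in (moebiusNorm x y)..1, (1 - t ^ 2) ^ (n - 1) / t ^ n

/-- `K` is (the lift to `B^{n+1}` of) a positive Green's function of `B^{n+1}/Γ` with pole at the
image of `x`: it is `Γ`-invariant, positive and harmonic off the orbit of `x`, and it has at `x`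
the singularity of the Green's function of the ball. The order of the stabilizer of `x` is `1` when
`B^{n+1}/Γ` is a manifold, and is the usual normalization at a cone point otherwise. -/
structure IsGreenFunction (Γ : Subgroup (Equiv.Perm (CBall n))) (x : CBall n) (K : E n → ℝ) :
    Prop where
  invariant : ∀ γ ∈ Γ, ∀ y : CBall n, ‖(y : E n)‖ < 1 → K (γ y) = K y
  pos : ∀ y ∈ Metric.ball (0 : E n) 1 \ orbitSet Γ x, 0 < K y
  harmonic : HypHarmonicOn K (Metric.ball (0 : E n) 1 \ orbitSet Γ x)
  singularity : ∃ V : Set (E n), IsOpen V ∧ (x : E n) ∈ V ∧ V ⊆ Metric.ball 0 1 ∧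
    ∃ h : E n → ℝ, HypHarmonicOn h V ∧ ∀ y ∈ V, y ≠ x →
      K y = (Nat.card (MulAction.stabilizer Γ x) : ℝ) * ballGreen (x : E n) y + h y

/-- The minimal positive Green's function `G(x, y)` of `B^{n+1}/Γ`, lifted to `B^{n+1}`: the
smallest value at `y` of a positive Green's function with pole `x`. -/
def minimalGreen (Γ : Subgroup (Equiv.Perm (CBall n))) (x : CBall n) (y : E n) : ℝ :=
  sInf {t : ℝ | ∃ K : E n → ℝ, IsGreenFunction Γ x K ∧ K y = t}

/-- The volume of the unit sphere `S^n`. -/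
def sphereVolume (n : ℕ) : ℝ :=
  (volume : Measure (E n)).toSphere.real Set.univ

/-- The harmonic measure of `Ω(Γ)` seen from `x ∈ B^{n+1}`: the hyperbolic Poisson integral of the
characteristic function of `Ω(Γ)`. This is the lift to `B^{n+1}` of `ω_Γ`. -/
def harmonicMeasure (Γ : Subgroup (Equiv.Perm (CBall n))) (x : E n) : ℝ :=
  1 / sphereVolume n * ∫ θ : Metric.sphere (0 : E n) 1,
    ((1 - ‖x‖ ^ 2) / ‖x - (θ : E n)‖ ^ 2) ^ n *
      (domainOfDiscontinuity Γ).indicator (fun _ => (1 : ℝ)) (θ : E n)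
    ∂(volume : Measure (E n)).toSphere

end KleinianGraph

end

/-! The heart of the matter is a flux computation in Euclidean terms. The gradient of the Green's
function of the ball with pole `x` is `((1 - |y|^2) / 2)^(n - 1)` times a field `greenField x` which
is divergence free in the Euclidean sense off `x`, extends smoothly across the unit sphere, and
there has normal component `-2^(n - 1)` times the Poisson kernel. On the graph, the conformal
weights of the area element and of the unit normal cancel the power of `1 - |y|^2`, so `∂g/∂n dσ` is
the Euclidean flux of `greenField x`. If `x` lies below the graph, the field has no divergence
between graph and sphere. Hence the total flux of `-∂g/∂n` through `G(Γ)` is `2^(n - 1)` times the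
Poisson integral over `Ω(Γ)` (`integral_flux_greenField`, `integral_normalDeriv_ballGreen`).

The quotient enters by unfolding. The minimal Green's function lifts to the sum of the ball's
Green's functions over the orbit of `x` (`minimalGreen_eq`): this sum is a Green's function, and the
minimum principle bounds its partial sums by any other one. The area is `Γ`-invariant and the normal
equivariant, so integrating the differentiated sum over a fundamental domain gives the integral of
one term over all of `G(Γ)`. The same unfolding, applied to `(1 - |z|^2)^n`, whose integral over the
graph is finite, yields the convergence of the Poincaré series at exponent `n` on which the sum
depends (`summable_orbit`).

All geometry of the graph is packed into a gauge `N` (`IsGraphGauge`): a Lipschitz function,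
homogeneous of degree 1, with `N ≥ |·|`, such that inside the ball `U_ε` is `{N > 1}` and the graph
is `{N = 1}`, while on the sphere `N = 1` exactly at the limit set. It exists because every half
space of the family is cut out by a Euclidean ball orthogonal to the sphere, so `U_ε = {1 + |y|^2 <
2 M(y)}` with `M` the support function of the centres, and `N = M + sqrt (M^2 - |y|^2)`. The
Lipschitz bound for the root rests on one fact: the radius of each ball is controlled by its
distance to the limit set, uniformly in `γ`, since the inequality behind it is Möbius invariant
(`center_estimate`, `exists_center`).

Given `N`, the divergence theorem follows by integrating by parts against functions of `N`
(`integral_fluxDensity_eq`). Invariance of the area is a change of variables on the solid cone over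
the graph (`jacobian_coneMap`). No information on the measure of the limit set is needed: there `N -
|·|` attains its minimum, so the fluxes for `N` and for the norm agree pointwise almost everywhere.
-/

noncomputable section

namespace KleinianGraph

variable {n : ℕ}

/-! ### Hyperbolic isometries of the closed ball -/

/-- A homeomorphism of the closed ball which restricts to a hyperbolic isometry of the ball. -/
structure IsBallIsometry (γ : Equiv.Perm (CBall n)) : Prop where
  cont : Continuous γ
  cont_inv : Continuous (γ⁻¹ : Equiv.Perm (CBall n))
  maps : ∀ x : CBall n, ‖(x : E n)‖ < 1 → ‖(γ x : E n)‖ < 1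
  maps_inv : ∀ x : CBall n, ‖(x : E n)‖ < 1 → ‖((γ⁻¹ : Equiv.Perm (CBall n)) x : E n)‖ < 1
  iso : ∀ x y : CBall n, ‖(x : E n)‖ < 1 → ‖(y : E n)‖ < 1 →
    hypDist (γ x : E n) (γ y) = hypDist (x : E n) y

lemma IsKleinian.isBallIsometry {Γ : Subgroup (Equiv.Perm (CBall n))} (hΓ : IsKleinian Γ)
    {γ : Equiv.Perm (CBall n)} (hγ : γ ∈ Γ) : IsBallIsometry γ :=
  ⟨hΓ.continuous γ hγ, hΓ.continuous _ (Γ.inv_mem hγ), hΓ.maps_ball γ hγ,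
    hΓ.maps_ball _ (Γ.inv_mem hγ), hΓ.isometry γ hγ⟩

/-- The centre of the closed ball. -/
def cOrigin : CBall n := ⟨0, by simp⟩

@[simp] lemma coe_cOrigin : ((cOrigin : CBall n) : E n) = 0 := rfl

lemma cball_norm_le (z : CBall n) : ‖(z : E n)‖ ≤ 1 := by
  exact mem_closedBall_zero_iff.mp z.2

/-- The Lorentz product of the lifts of two points to the light cone coordinates. -/
def lorentzForm (x y : E n) : ℝ := (1 + ‖x‖ ^ 2) * (1 + ‖y‖ ^ 2) - 4 * inner ℝ x y

/-- The numerator of a Lorentz linear functional in ball coordinates. -/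
def lorentzFun (v : E n) (s : ℝ) (y : E n) : ℝ := 2 * inner ℝ y v - (1 + ‖y‖ ^ 2) * s

/-- After division by `(1 - |x|^2) (1 - |y|^2)` the form is an affine function of `sinh^2 (d / 2)`,
hence invariant under isometries. -/
lemma lorentzForm_eq (x y : E n) :
    lorentzForm x y = (1 - ‖x‖ ^ 2) * (1 - ‖y‖ ^ 2) + 2 * ‖x - y‖ ^ 2 := by
  rw [lorentzForm, norm_sub_sq_real]; ring

lemma lorentzForm_eq_lorentzFun (x y : E n) :
    lorentzForm x y = lorentzFun (-(2 : ℝ) • x) (-(1 + ‖x‖ ^ 2)) y := by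
  rw [lorentzForm, lorentzFun, inner_smul_right, real_inner_comm]; ring

lemma one_sub_sq_pos {x : E n} (hx : ‖x‖ < 1) : 0 < 1 - ‖x‖ ^ 2 := by
  nlinarith [norm_nonneg x]

lemma sq_dist_of_hypDist_eq {x y x' y' : E n} (hx : ‖x‖ < 1) (hy : ‖y‖ < 1) (hx' : ‖x'‖ < 1)
    (hy' : ‖y'‖ < 1) (h : hypDist x' y' = hypDist x y) :
    ‖x' - y'‖ ^ 2 / ((1 - ‖x'‖ ^ 2) * (1 - ‖y'‖ ^ 2)) =
      ‖x - y‖ ^ 2 / ((1 - ‖x‖ ^ 2) * (1 - ‖y‖ ^ 2)) := by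
  have h1 : ‖x' - y'‖ / Real.sqrt ((1 - ‖x'‖ ^ 2) * (1 - ‖y'‖ ^ 2)) =
      ‖x - y‖ / Real.sqrt ((1 - ‖x‖ ^ 2) * (1 - ‖y‖ ^ 2)) := by
    apply Real.arsinh_injective
    unfold hypDist at h
    linarith
  have h2 := congrArg (· ^ 2) h1
  simp only [div_pow] at h2
  rwa [Real.sq_sqrt (mul_pos (one_sub_sq_pos hx') (one_sub_sq_pos hy')).le,
    Real.sq_sqrt (mul_pos (one_sub_sq_pos hx) (one_sub_sq_pos hy)).le] at h2

/-- The isometry property is only given inside the ball; density carries the resulting identities to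
the sphere by continuity. -/
lemma dense_openBall : Dense {z : CBall n | ‖(z : E n)‖ < 1} := by
  rw [dense_iff_closure_eq, Topology.IsInducing.subtypeVal.closure_eq_preimage_closure_image]
  have : (Subtype.val '' {z : CBall n | ‖(z : E n)‖ < 1}) = Metric.ball (0 : E n) 1 := by
    ext y
    constructor
    · rintro ⟨z, hz, rfl⟩
      simpa using hz
    · intro hy
      exact ⟨⟨y, Metric.ball_subset_closedBall hy⟩, by simpa using hy, rfl⟩
  rw [this, closure_ball _ one_ne_zero]
  ext z
  simp only [Set.mem_preimage, Set.mem_univ, iff_true]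
  exact z.2

/-- The conformal factor of a hyperbolic isometry. -/
def confFactor (γ : Equiv.Perm (CBall n)) (z : E n) : ℝ :=
  2 / (lorentzForm ((γ⁻¹ : Equiv.Perm (CBall n)) cOrigin : E n) z /
    (1 - ‖((γ⁻¹ : Equiv.Perm (CBall n)) cOrigin : E n)‖ ^ 2) + (1 - ‖z‖ ^ 2))

/-- A map of the closed ball, extended by `0`. -/
def ballExt (γ : Equiv.Perm (CBall n)) (z : E n) : E n :=
  if h : ‖z‖ ≤ 1 then (γ ⟨z, by simpa using h⟩ : E n) else 0

@[simp] lemma ballExt_coe (γ : Equiv.Perm (CBall n)) (z : CBall n) :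
    ballExt γ (z : E n) = γ z := by
  rw [ballExt, dif_pos (cball_norm_le z)]

namespace IsBallIsometry

variable {γ : Equiv.Perm (CBall n)}

lemma inv (h : IsBallIsometry γ) : IsBallIsometry γ⁻¹ where
  cont := h.cont_inv
  cont_inv := by simpa using h.cont
  maps := h.maps_inv
  maps_inv := by simpa using h.maps
  iso x y hx hy := by
    have := h.iso (γ⁻¹ x) (γ⁻¹ y) (h.maps_inv x hx) (h.maps_inv y hy)
    simpa using this.symm

lemma sq_dist (h : IsBallIsometry γ) {x y : CBall n} (hx : ‖(x : E n)‖ < 1)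
    (hy : ‖(y : E n)‖ < 1) :
    ‖(γ x : E n) - γ y‖ ^ 2 / ((1 - ‖(γ x : E n)‖ ^ 2) * (1 - ‖(γ y : E n)‖ ^ 2)) =
      ‖(x : E n) - y‖ ^ 2 / ((1 - ‖(x : E n)‖ ^ 2) * (1 - ‖(y : E n)‖ ^ 2)) :=
  sq_dist_of_hypDist_eq hx hy (h.maps x hx) (h.maps y hy) (h.iso x y hx hy)

lemma lorentzForm_div (h : IsBallIsometry γ) {x y : CBall n} (hx : ‖(x : E n)‖ < 1)
    (hy : ‖(y : E n)‖ < 1) :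
    lorentzForm (γ x : E n) (γ y) / ((1 - ‖(γ x : E n)‖ ^ 2) * (1 - ‖(γ y : E n)‖ ^ 2)) =
      lorentzForm (x : E n) y / ((1 - ‖(x : E n)‖ ^ 2) * (1 - ‖(y : E n)‖ ^ 2)) := by
  have h1 := h.sq_dist hx hy
  have a1 := one_sub_sq_pos hx
  have a2 := one_sub_sq_pos hy
  have a3 := one_sub_sq_pos (h.maps x hx)
  have a4 := one_sub_sq_pos (h.maps y hy)
  rw [lorentzForm_eq, lorentzForm_eq, add_div, add_div, mul_div_assoc 2, mul_div_assoc 2, h1,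
    div_self (by positivity), div_self (by positivity)]

lemma confFactor_denom_pos (h : IsBallIsometry γ) {z : E n} (hz : ‖z‖ ≤ 1) :
    0 < lorentzForm ((γ⁻¹ : Equiv.Perm (CBall n)) cOrigin : E n) z /
    (1 - ‖((γ⁻¹ : Equiv.Perm (CBall n)) cOrigin : E n)‖ ^ 2) + (1 - ‖z‖ ^ 2) := by
  have ha : ‖((γ⁻¹ : Equiv.Perm (CBall n)) cOrigin : E n)‖ < 1 :=
    h.maps_inv _ (by simp)
  set a : E n := ((γ⁻¹ : Equiv.Perm (CBall n)) cOrigin : E n)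
  have h1 := one_sub_sq_pos ha
  rw [lorentzForm_eq]
  rcases hz.lt_or_eq with hz | hz
  · have h2 := one_sub_sq_pos hz
    positivity
  · have h3 : 0 < ‖a - z‖ := by
      rw [norm_pos_iff, sub_ne_zero]
      rintro rfl
      linarith
    rw [hz]
    have : 0 < 2 * ‖a - z‖ ^ 2 / (1 - ‖a‖ ^ 2) := by positivity
    simpa using this

lemma confFactor_pos (h : IsBallIsometry γ) {z : E n} (hz : ‖z‖ ≤ 1) : 0 < confFactor γ z :=
  div_pos two_pos (h.confFactor_denom_pos hz)

lemma continuousOn_lorentz (a : E n) : Continuous (fun z : E n => lorentzForm a z) := by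
  unfold lorentzForm; fun_prop

lemma continuous_lorentzFun (v : E n) (s : ℝ) : Continuous (lorentzFun v s) := by
  unfold lorentzFun; fun_prop

lemma continuous_confFactor (h : IsBallIsometry γ) :
    Continuous (fun z : CBall n => confFactor γ (z : E n)) := by
  unfold confFactor
  refine continuous_const.div ?_ fun z => (h.confFactor_denom_pos (cball_norm_le z)).ne'
  have := (continuousOn_lorentz ((γ⁻¹ : Equiv.Perm (CBall n)) cOrigin : E n)).comp
    (continuous_subtype_val (p := (· ∈ Metric.closedBall (0 : E n) 1)))
  simp only [Function.comp_def] at this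
  fun_prop

/-- Explains the formula for `confFactor`. Invariance of the Lorentz ratio for the pair `γ⁻¹ 0`, `z`
determines `(1 + |γ z|^2) / (1 - |γ z|^2)`; adding 1 gives `2 / (1 - |γ z|^2)`. -/
lemma one_sub_sq_map_of_lt (h : IsBallIsometry γ) {z : CBall n} (hz : ‖(z : E n)‖ < 1) :
    1 - ‖(γ z : E n)‖ ^ 2 = confFactor γ z * (1 - ‖(z : E n)‖ ^ 2) := by
  have ha : ‖((γ⁻¹ : Equiv.Perm (CBall n)) cOrigin : E n)‖ < 1 := h.maps_inv _ (by simp)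
  have h1 := h.lorentzForm_div ha hz
  have h0 : γ (γ⁻¹ cOrigin) = cOrigin := by simp
  rw [h0] at h1
  have a1 := one_sub_sq_pos ha
  have a2 := one_sub_sq_pos hz
  have a4 := one_sub_sq_pos (h.maps z hz)
  have hd := h.confFactor_denom_pos hz.le
  have h3 : lorentzForm ((cOrigin : CBall n) : E n) (γ z) = 1 + ‖(γ z : E n)‖ ^ 2 := by
    simp [lorentzForm]
  rw [h3] at h1
  simp only [coe_cOrigin, norm_zero] at h1
  rw [confFactor, eq_comm, div_mul_eq_mul_div, div_eq_iff hd.ne']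
  have h4 : lorentzForm ((γ⁻¹ : Equiv.Perm (CBall n)) cOrigin : E n) (z : E n) /
    (1 - ‖((γ⁻¹ : Equiv.Perm (CBall n)) cOrigin : E n)‖ ^ 2) =
      (1 + ‖(γ z : E n)‖ ^ 2) / (1 - ‖(γ z : E n)‖ ^ 2) * (1 - ‖(z : E n)‖ ^ 2) := by
    have : ((1:ℝ) - 0 ^ 2) * (1 - ‖(γ z : E n)‖ ^ 2) = (1 - ‖(γ z : E n)‖ ^ 2) := by ring
    rw [this, ← div_div, eq_div_iff a2.ne'] at h1
    exact h1.symm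
  rw [h4]
  field_simp
  ring

lemma one_sub_sq_map (h : IsBallIsometry γ) (z : CBall n) :
    1 - ‖(γ z : E n)‖ ^ 2 = confFactor γ z * (1 - ‖(z : E n)‖ ^ 2) := by
  have hc := h.continuous_confFactor
  have hγ := h.cont
  have := Continuous.ext_on (f := fun z : CBall n => 1 - ‖(γ z : E n)‖ ^ 2)
    (g := fun z : CBall n => confFactor γ z * (1 - ‖(z : E n)‖ ^ 2)) dense_openBall
    (by fun_prop) (by fun_prop) fun z hz => h.one_sub_sq_map_of_lt hz
  exact congrFun this z

lemma norm_sub_sq (h : IsBallIsometry γ) (x y : CBall n) :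
    ‖(γ x : E n) - γ y‖ ^ 2 = confFactor γ x * confFactor γ y * ‖(x : E n) - y‖ ^ 2 := by
  have hc := h.continuous_confFactor
  have hγ := h.cont
  have key : ∀ x y : CBall n, ‖(x : E n)‖ < 1 → ‖(y : E n)‖ < 1 →
      ‖(γ x : E n) - γ y‖ ^ 2 = confFactor γ x * confFactor γ y * ‖(x : E n) - y‖ ^ 2 := by
    intro x y hx hy
    have h1 := h.sq_dist hx hy
    have a1 := one_sub_sq_pos hx
    have a2 := one_sub_sq_pos hy
    have b1 := h.confFactor_pos hx.le
    have b2 := h.confFactor_pos hy.le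
    rw [h.one_sub_sq_map x, h.one_sub_sq_map y, div_eq_div_iff (by positivity) (by positivity)] at h1
    have h2 : 0 < (1 - ‖(x : E n)‖ ^ 2) * (1 - ‖(y : E n)‖ ^ 2) := by positivity
    apply mul_right_cancel₀ h2.ne'
    linarith
  have h1 : ∀ y : CBall n, ‖(y : E n)‖ < 1 → ∀ x : CBall n,
      ‖(γ x : E n) - γ y‖ ^ 2 = confFactor γ x * confFactor γ y * ‖(x : E n) - y‖ ^ 2 := by
    intro y hy x
    exact congrFun (Continuous.ext_on (f := fun x : CBall n => ‖(γ x : E n) - γ y‖ ^ 2)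
      (g := fun x : CBall n => confFactor γ x * confFactor γ y * ‖(x : E n) - y‖ ^ 2)
      dense_openBall (by fun_prop) (by fun_prop) fun x hx => key x y hx hy) x
  exact congrFun (Continuous.ext_on (f := fun y : CBall n => ‖(γ x : E n) - γ y‖ ^ 2)
      (g := fun y : CBall n => confFactor γ x * confFactor γ y * ‖(x : E n) - y‖ ^ 2)
      dense_openBall (by fun_prop) (by fun_prop) fun y hy => h1 y hy x) y

/-- An isometry acts linearly on Lorentz functionals and preserves their quadratic form. Rather than
building the Lorentz transformation, the functional is written as a combination of the pairings with
two points of the ball, `0` and `τ v`. Each pairing is carried to the pairing with the image point,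
and the quadratic form depends only on the coefficients and on the mutual pairing of the two points.
-/
lemma exists_lorentzFun_map (h : IsBallIsometry γ) (v : E n) (s : ℝ) :
    ∃ (v' : E n) (s' : ℝ), ‖v'‖ ^ 2 - s' ^ 2 = ‖v‖ ^ 2 - s ^ 2 ∧
      ∀ z : CBall n, lorentzFun v s z * confFactor γ z = lorentzFun v' s' (γ z) := by
  obtain ⟨τ, hτ, hτv⟩ : ∃ τ : ℝ, 0 < τ ∧ ‖τ • v‖ < 1 := by
    refine ⟨1 / (1 + ‖v‖), by positivity, ?_⟩
    rw [norm_smul, Real.norm_of_nonneg (by positivity), div_mul_eq_mul_div, one_mul,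
      div_lt_one (by positivity)]
    linarith
  let x : CBall n := ⟨τ • v, by simpa using hτv.le⟩
  have hxc : (x : E n) = τ • v := rfl
  have hx : ‖(x : E n)‖ < 1 := hτv
  have hxn : ‖(x : E n)‖ ^ 2 = τ ^ 2 * ‖v‖ ^ 2 := by
    rw [hxc, norm_smul, mul_pow, Real.norm_of_nonneg hτ.le]
  set p : E n := (γ cOrigin : E n) with hp
  set q : E n := (γ x : E n) with hq
  have hp1 : ‖p‖ < 1 := h.maps _ (by simp)
  have hq1 : ‖q‖ < 1 := h.maps _ hx
  have dp := one_sub_sq_pos hp1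
  have dq := one_sub_sq_pos hq1
  have dx := one_sub_sq_pos hx
  -- `α` and `β` are the coefficients of the pairings with `0` and with `x = τ v`; `a` and `b`
  -- rescale them by the ratios of `1 - |·|^2` at the points and at their images.
  set α : ℝ := (1 + ‖(x : E n)‖ ^ 2) / (2 * τ) - s with hα
  set β : ℝ := -1 / (2 * τ) with hβ
  set a : ℝ := α / (1 - ‖p‖ ^ 2) with ha
  set b : ℝ := β * (1 - ‖(x : E n)‖ ^ 2) / (1 - ‖q‖ ^ 2) with hb
  have hAz : ∀ z : E n, lorentzFun v s z = α * (1 + ‖z‖ ^ 2) + β * lorentzForm (x : E n) z := by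
    intro z
    rw [lorentzFun, lorentzForm, hα, hβ, hxc, inner_smul_left, real_inner_comm z v]
    simp only [conj_trivial]
    field_simp
    ring
  refine ⟨a • (-(2 : ℝ) • p) + b • (-(2 : ℝ) • q),
    a * (-(1 + ‖p‖ ^ 2)) + b * (-(1 + ‖q‖ ^ 2)), ?_, ?_⟩
  · have h1 := h.lorentzForm_div (x := cOrigin) (y := x) (by simp) hx
    have h2 : lorentzForm p q = (1 + ‖(x : E n)‖ ^ 2) * ((1 - ‖p‖ ^ 2) * (1 - ‖q‖ ^ 2)) /
        (1 - ‖(x : E n)‖ ^ 2) := by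
      rw [← hp, ← hq, div_eq_iff (by positivity)] at h1
      rw [h1]
      simp [lorentzForm]
      field_simp
    have h3 : ‖a • (-(2 : ℝ) • p) + b • (-(2 : ℝ) • q)‖ ^ 2 =
        4 * (a ^ 2 * ‖p‖ ^ 2 + b ^ 2 * ‖q‖ ^ 2) + 2 * a * b * (4 * inner ℝ p q) := by
      rw [norm_add_sq_real]
      simp only [norm_smul, inner_smul_left, inner_smul_right, mul_pow, Real.norm_eq_abs, sq_abs]
      simp only [conj_trivial]
      ring
    have h4 : 4 * inner ℝ p q = (1 + ‖p‖ ^ 2) * (1 + ‖q‖ ^ 2) - lorentzForm p q := by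
      rw [lorentzForm]; ring
    rw [h3, h4, h2]
    have h5 : a * (1 - ‖p‖ ^ 2) = α := by rw [ha]; field_simp
    have h6 : b * (1 - ‖q‖ ^ 2) = β * (1 - ‖(x : E n)‖ ^ 2) := by rw [hb]; field_simp
    have h7 : 4 * (a ^ 2 * ‖p‖ ^ 2 + b ^ 2 * ‖q‖ ^ 2) + 2 * a * b *
        ((1 + ‖p‖ ^ 2) * (1 + ‖q‖ ^ 2) - (1 + ‖(x : E n)‖ ^ 2) * ((1 - ‖p‖ ^ 2) * (1 - ‖q‖ ^ 2)) /
        (1 - ‖(x : E n)‖ ^ 2)) -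
        (a * (-(1 + ‖p‖ ^ 2)) + b * (-(1 + ‖q‖ ^ 2))) ^ 2 =
        -(a * (1 - ‖p‖ ^ 2)) ^ 2 - (b * (1 - ‖q‖ ^ 2)) ^ 2 -
        2 * (a * (1 - ‖p‖ ^ 2)) * (b * (1 - ‖q‖ ^ 2)) * (1 + ‖(x : E n)‖ ^ 2) /
        (1 - ‖(x : E n)‖ ^ 2) := by
      ring
    rw [h7, h5, h6]
    have h8 : 2 * α * (β * (1 - ‖(x : E n)‖ ^ 2)) * (1 + ‖(x : E n)‖ ^ 2) /
        (1 - ‖(x : E n)‖ ^ 2) = 2 * α * β * (1 + ‖(x : E n)‖ ^ 2) := by field_simp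
    rw [h8, hα, hβ, hxn]
    field_simp
    ring
  · have hc := h.continuous_confFactor
    have hγ := h.cont
    intro z
    have hl : ∀ v s, Continuous (fun z : CBall n => lorentzFun v s (z : E n)) := fun v s =>
      (continuous_lorentzFun v s).comp continuous_subtype_val
    refine congrFun (Continuous.ext_on (f := fun z : CBall n =>
      lorentzFun v s z * confFactor γ z) (g := fun z : CBall n => lorentzFun _ _ (γ z : E n))
      dense_openBall ((hl v s).mul hc) ((hl _ _).comp hγ) fun z hz => ?_) z
    have e1 := h.lorentzForm_div (x := cOrigin) (y := z) (by simp) hz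
    have e2 := h.lorentzForm_div (x := x) (y := z) hx hz
    have dz := one_sub_sq_pos (x := (z : E n)) hz
    have cz := h.confFactor_pos (z := (z : E n)) (cball_norm_le z)
    rw [h.one_sub_sq_map z, ← hp, div_eq_iff (by positivity)] at e1
    rw [h.one_sub_sq_map z, ← hq, div_eq_iff (by positivity)] at e2
    have e3 : lorentzForm ((cOrigin : CBall n) : E n) z = 1 + ‖(z : E n)‖ ^ 2 := by
      simp [lorentzForm]
    rw [e3] at e1
    simp only [coe_cOrigin, norm_zero] at e1
    have e4 : ∀ y, lorentzFun (a • (-(2 : ℝ) • p) + b • (-(2 : ℝ) • q))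
      (a * (-(1 + ‖p‖ ^ 2)) + b * (-(1 + ‖q‖ ^ 2))) y =
      a * lorentzForm p y + b * lorentzForm q y := by
      intro y
      rw [lorentzForm_eq_lorentzFun, lorentzForm_eq_lorentzFun, lorentzFun, lorentzFun, lorentzFun,
        inner_add_right, inner_smul_right _ _ a, inner_smul_right _ _ b]
      ring
    simp only []
    rw [e4, e1, e2, hAz, ha, hb]
    field_simp
    ring

lemma confFactor_inv (h : IsBallIsometry γ) (z : CBall n) :
    confFactor γ⁻¹ (γ z : E n) * confFactor γ z = 1 := by
  have hc := h.continuous_confFactor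
  have hγ := h.cont
  have hc' : Continuous (fun z : CBall n => confFactor γ⁻¹ (γ z : E n)) :=
    h.inv.continuous_confFactor.comp hγ
  refine congrFun (Continuous.ext_on (f := fun z : CBall n =>
    confFactor γ⁻¹ (γ z : E n) * confFactor γ z) (g := fun z : CBall n => 1)
    dense_openBall (hc'.mul hc) (by fun_prop) fun z hz => ?_) z
  have h1 := h.one_sub_sq_map z
  have h2 := h.inv.one_sub_sq_map (γ z)
  have dz := one_sub_sq_pos (x := (z : E n)) hz
  rw [show γ⁻¹ (γ z) = z from γ.symm_apply_apply z] at h2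
  rw [h1] at h2
  simp only []
  apply mul_right_cancel₀ dz.ne'
  linarith

lemma exists_lorentzFun_comap (h : IsBallIsometry γ) (v : E n) (s : ℝ) :
    ∃ (v' : E n) (s' : ℝ), ‖v'‖ ^ 2 - s' ^ 2 = ‖v‖ ^ 2 - s ^ 2 ∧
      ∀ z : CBall n, lorentzFun v s (γ z) = lorentzFun v' s' z * confFactor γ z := by
  obtain ⟨v', s', h1, h2⟩ := h.inv.exists_lorentzFun_map v s
  refine ⟨v', s', h1, fun z => ?_⟩
  have h3 := h2 (γ z)
  rw [show γ⁻¹ (γ z) = z from γ.symm_apply_apply z] at h3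
  rw [← h3, mul_assoc, h.confFactor_inv, mul_one]

lemma norm_map_eq_one (h : IsBallIsometry γ) {z : CBall n} (hz : ‖(z : E n)‖ = 1) :
    ‖(γ z : E n)‖ = 1 := by
  have := h.one_sub_sq_map z
  rw [hz] at this
  nlinarith [norm_nonneg (γ z : E n)]

lemma differentiableAt_confFactor (h : IsBallIsometry γ) {z : E n} (hz : ‖z‖ < 1) :
    DifferentiableAt ℝ (confFactor γ) z := by
  have hd : ∀ a : E n, DifferentiableAt ℝ (fun y => lorentzForm a y) z := by
    intro a
    unfold lorentzForm
    have : DifferentiableAt ℝ (fun y : E n => ‖y‖ ^ 2) z := differentiableAt_id.norm_sq ℝ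
    have : DifferentiableAt ℝ (fun y : E n => inner ℝ a y) z :=
      (differentiableAt_const a).inner ℝ differentiableAt_id
    fun_prop
  have : DifferentiableAt ℝ (fun y : E n => ‖y‖ ^ 2) z := differentiableAt_id.norm_sq ℝ
  unfold confFactor
  have h1 := hd ((γ⁻¹ : Equiv.Perm (CBall n)) cOrigin : E n)
  have h2 : DifferentiableAt ℝ (fun z : E n =>
      lorentzForm ((γ⁻¹ : Equiv.Perm (CBall n)) cOrigin : E n) z /
      (1 - ‖((γ⁻¹ : Equiv.Perm (CBall n)) cOrigin : E n)‖ ^ 2) + (1 - ‖z‖ ^ 2)) z := by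
    simp only [div_eq_mul_inv]
    fun_prop
  exact (h2.inv (h.confFactor_denom_pos hz.le).ne').const_mul 2

/-- Twice a coordinate of `γ z` is a Lorentz functional of `γ z`, hence a Lorentz functional of `z`
times the conformal factor: `γ` is rational in coordinates. -/
lemma differentiableAt_ballExt (h : IsBallIsometry γ) {z : E n} (hz : ‖z‖ < 1) :
    DifferentiableAt ℝ (ballExt γ) z := by
  rw [differentiableAt_euclidean]
  intro i
  obtain ⟨v, s, -, hvs⟩ := h.exists_lorentzFun_comap (EuclideanSpace.single i (1 : ℝ)) 0
  have h1 : (fun y => ballExt γ y i) =ᶠ[nhds z] fun y =>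
      lorentzFun v s y * confFactor γ y / 2 := by
    filter_upwards [(isOpen_lt continuous_norm continuous_const).mem_nhds hz] with y hy
    have hy1 : ‖y‖ ≤ 1 := le_of_lt hy
    have := hvs ⟨y, by simpa using hy1⟩
    rw [ballExt, dif_pos hy1, ← this, lorentzFun, EuclideanSpace.inner_single_right]
    simp
  refine DifferentiableAt.congr_of_eventuallyEq ?_ h1
  have h2 : DifferentiableAt ℝ (lorentzFun v s) z := by
    unfold lorentzFun
    have : DifferentiableAt ℝ (fun y : E n => ‖y‖ ^ 2) z := differentiableAt_id.norm_sq ℝ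
    have : DifferentiableAt ℝ (fun y : E n => inner ℝ y v) z :=
      differentiableAt_id.inner ℝ (differentiableAt_const v)
    fun_prop
  simp only [div_eq_mul_inv]
  exact (h2.fun_mul (h.differentiableAt_confFactor hz)).mul_const _

/-- By `norm_sub_sq` the difference quotients have exactly the length `sqrt (k(z + t v) k(z)) |v|`,
with `k` the conformal factor; let `t` tend to 0. -/
lemma norm_fderiv_ballExt (h : IsBallIsometry γ) {z : E n} (hz : ‖z‖ < 1) (v : E n) :
    ‖fderiv ℝ (ballExt γ) z v‖ = confFactor γ z * ‖v‖ := by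
  have hd := (h.differentiableAt_ballExt hz).hasFDerivAt.hasLineDerivAt v
  have h1 := hd.tendsto_slope_zero
  have h2 := h1.norm
  have hcont : ContinuousAt (fun t : ℝ => confFactor γ (z + t • v)) 0 := by
    have : ContinuousAt (confFactor γ) (z + (0 : ℝ) • v) := by
      rw [zero_smul, add_zero]
      exact (h.differentiableAt_confFactor hz).continuousAt
    exact ContinuousAt.comp (f := fun t : ℝ => z + t • v) this (by fun_prop)
  have h3 : Filter.Tendsto (fun t : ℝ => Real.sqrt (confFactor γ (z + t • v) * confFactor γ z) *
      ‖v‖) (nhdsWithin 0 {0}ᶜ) (nhds (confFactor γ z * ‖v‖)) := by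
    have h4 := ((hcont.tendsto.mul_const (confFactor γ z)).sqrt).mul_const ‖v‖
    simp only [zero_smul, add_zero] at h4
    rw [Real.sqrt_mul_self (h.confFactor_pos hz.le).le] at h4
    exact h4.mono_left nhdsWithin_le_nhds
  refine tendsto_nhds_unique (h2.congr' ?_) h3
  have hopen : ∀ᶠ t : ℝ in nhds 0, ‖z + t • v‖ < 1 := by
    have : ContinuousAt (fun t : ℝ => ‖z + t • v‖) 0 := by fun_prop
    exact this.eventually_lt continuousAt_const (by simpa using hz)
  filter_upwards [nhdsWithin_le_nhds hopen, self_mem_nhdsWithin] with t ht ht0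
  have ht0 : t ≠ 0 := ht0
  have e := h.norm_sub_sq ⟨z + t • v, by simpa using ht.le⟩ ⟨z, by simpa using hz.le⟩
  rw [← ballExt_coe, ← ballExt_coe] at e
  simp only [add_sub_cancel_left] at e
  have hp1 := h.confFactor_pos ht.le
  have hp2 := h.confFactor_pos hz.le
  rw [norm_smul, norm_inv]
  have e2 : ‖ballExt γ (z + t • v) - ballExt γ z‖ =
      Real.sqrt (confFactor γ (z + t • v) * confFactor γ z) * ‖t • v‖ := by
    rw [← Real.sqrt_sq (norm_nonneg (ballExt γ (z + t • v) - ballExt γ z)), e,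
      Real.sqrt_mul (by positivity), Real.sqrt_sq (norm_nonneg _)]
  rw [e2, norm_smul]
  have : ‖t‖ ≠ 0 := by simpa using ht0
  field_simp

/-- The derivative of a hyperbolic isometry is a similarity. -/
lemma exists_hasFDerivAt (h : IsBallIsometry γ) {z : E n} (hz : ‖z‖ < 1) :
    ∃ A : E n ≃ₗᵢ[ℝ] E n, HasFDerivAt (ballExt γ)
      (confFactor γ z • (A.toContinuousLinearEquiv : E n →L[ℝ] E n)) z := by
  have hp := h.confFactor_pos hz.le
  let f : E n →ₗᵢ[ℝ] E n :=
    { toLinearMap := (confFactor γ z)⁻¹ • (fderiv ℝ (ballExt γ) z : E n →ₗ[ℝ] E n)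
      norm_map' := fun v => by
        simp only [LinearMap.smul_apply, ContinuousLinearMap.coe_coe, norm_smul, norm_inv,
          h.norm_fderiv_ballExt hz, Real.norm_of_nonneg hp.le]
        field_simp }
  refine ⟨f.toLinearIsometryEquiv rfl, ?_⟩
  have hfd := (h.differentiableAt_ballExt hz).hasFDerivAt
  suffices heq : (confFactor γ z • ((f.toLinearIsometryEquiv rfl).toContinuousLinearEquiv :
      E n →L[ℝ] E n)) = fderiv ℝ (ballExt γ) z by rwa [heq]
  ext1 v
  change confFactor γ z • ((confFactor γ z)⁻¹ • (fderiv ℝ (ballExt γ) z v)) = _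
  rw [smul_smul, mul_inv_cancel₀ hp.ne', one_smul]

end IsBallIsometry

/-! ### The limit set -/

section LimitSet

variable {Γ : Subgroup (Equiv.Perm (CBall n))}

/-- The hyperbolic distance of `γ x` and `γ y` does not depend on `γ`, so `|γ x - γ y|^2 ≤ S (1 - |γ
x|^2)`, and this tends to 0 as `γ x` approaches the sphere. -/
lemma closure_orbitSet_of_norm_eq_one (hΓ : IsKleinian Γ) {x y : CBall n}
    (hx : ‖(x : E n)‖ < 1) (hy : ‖(y : E n)‖ < 1) {p : E n} (hp : ‖p‖ = 1)
    (h : p ∈ closure (orbitSet Γ x)) : p ∈ closure (orbitSet Γ y) := by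
  rw [mem_closure_iff_seq_limit] at h ⊢
  obtain ⟨u, hu, hup⟩ := h
  choose g hg hgu using hu
  refine ⟨fun k => (g k y : E n), fun k => ⟨g k, hg k, rfl⟩, ?_⟩
  set S : ℝ := ‖(x : E n) - y‖ ^ 2 / ((1 - ‖(x : E n)‖ ^ 2) * (1 - ‖(y : E n)‖ ^ 2)) with hS
  have dx := one_sub_sq_pos hx
  have dy := one_sub_sq_pos hy
  have hS0 : 0 ≤ S := by positivity
  have hbound : ∀ k, ‖(g k y : E n) - u k‖ ≤ Real.sqrt (S * (1 - ‖u k‖ ^ 2)) := by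
    intro k
    have hI := hΓ.isBallIsometry (hg k)
    have h1 := hI.sq_dist hx hy
    have d1 := one_sub_sq_pos (hI.maps x hx)
    have d2 := one_sub_sq_pos (hI.maps y hy)
    rw [← hS, div_eq_iff (by positivity)] at h1
    apply Real.le_sqrt_of_sq_le
    rw [norm_sub_rev, hgu k, h1]
    have : (1 - ‖(g k x : E n)‖ ^ 2) * (1 - ‖(g k y : E n)‖ ^ 2) ≤ (1 - ‖(g k x : E n)‖ ^ 2) := by
      nlinarith [sq_nonneg ‖(g k y : E n)‖]
    exact mul_le_mul_of_nonneg_left this hS0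
  have hlim : Filter.Tendsto (fun k => Real.sqrt (S * (1 - ‖u k‖ ^ 2))) Filter.atTop (nhds 0) := by
    have h1 : Filter.Tendsto (fun k => ‖u k‖) Filter.atTop (nhds ‖p‖) := hup.norm
    have h2 := (((h1.pow 2).const_sub 1).const_mul S).sqrt
    simpa [hp] using h2
  have h3 := squeeze_zero_norm hbound hlim
  simpa using h3.add hup

lemma mem_limitSet_iff (hΓ : IsKleinian Γ) {p : E n} :
    p ∈ limitSet Γ ↔ ‖p‖ = 1 ∧ p ∈ closure (orbitSet Γ cOrigin) := by
  constructor
  · rintro ⟨hp, x, hx, h⟩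
    exact ⟨hp, closure_orbitSet_of_norm_eq_one hΓ hx (by simp) hp h⟩
  · rintro ⟨hp, h⟩
    exact ⟨hp, cOrigin, by simp, h⟩

lemma isClosed_limitSet (hΓ : IsKleinian Γ) : IsClosed (limitSet Γ) := by
  have : limitSet Γ = {p | ‖p‖ = 1} ∩ closure (orbitSet Γ cOrigin) := by
    ext p
    exact mem_limitSet_iff hΓ
  rw [this]
  exact (isClosed_eq continuous_norm continuous_const).inter isClosed_closure

lemma map_mem_limitSet (hΓ : IsKleinian Γ) {γ : Equiv.Perm (CBall n)} (hγ : γ ∈ Γ) {l : CBall n}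
    (hl : (l : E n) ∈ limitSet Γ) : (γ l : E n) ∈ limitSet Γ := by
  rw [mem_limitSet_iff hΓ] at hl ⊢
  refine ⟨(hΓ.isBallIsometry hγ).norm_map_eq_one hl.1, ?_⟩
  obtain ⟨u, hu, hul⟩ := mem_closure_iff_seq_limit.1 hl.2
  choose g hg hgu using hu
  refine mem_closure_iff_seq_limit.2 ⟨fun k => (γ (g k cOrigin) : E n),
    fun k => ⟨γ * g k, Γ.mul_mem hγ (hg k), rfl⟩, ?_⟩
  have h1 : Filter.Tendsto (fun k => g k cOrigin) Filter.atTop (nhds l) := by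
    rw [tendsto_subtype_rng]
    simpa only [← hgu] using hul
  exact (continuous_subtype_val.tendsto _).comp (((hΓ.continuous γ hγ).tendsto l).comp h1)

lemma norm_of_mem_limitSet {p : E n} (hp : p ∈ limitSet Γ) : ‖p‖ = 1 := hp.1

lemma norm_of_mem_domain {p : E n} (hp : p ∈ domainOfDiscontinuity Γ) : ‖p‖ = 1 := by
  simpa using hp.1

lemma exists_mem_limitSet_map (hΓ : IsKleinian Γ) {γ : Equiv.Perm (CBall n)} (hγ : γ ∈ Γ)
    {m : E n} (hm : m ∈ limitSet Γ) :
    ∃ l : CBall n, (l : E n) ∈ limitSet Γ ∧ (γ l : E n) = m := by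
  let m' : CBall n := ⟨m, by simpa using (norm_of_mem_limitSet hm).le⟩
  refine ⟨γ⁻¹ m', map_mem_limitSet hΓ (Γ.inv_mem hγ) hm, ?_⟩
  rw [show γ (γ⁻¹ m') = m' from γ.apply_symm_apply m']

end LimitSet

/-! ### Spherical caps -/

lemma norm_sub_sq_of_unit {p l : E n} (hp : ‖p‖ = 1) (hl : ‖l‖ = 1) :
    ‖p - l‖ ^ 2 = 2 * (1 - inner ℝ p l) := by
  rw [norm_sub_sq_real, hp, hl]; ring

lemma cos_angle_of_unit {p l : E n} (hp : ‖p‖ = 1) (hl : ‖l‖ = 1) :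
    Real.cos (InnerProductGeometry.angle p l) = inner ℝ p l := by
  rw [InnerProductGeometry.cos_angle, hp, hl]; simp

lemma norm_sub_le_angle {p l : E n} (hp : ‖p‖ = 1) (hl : ‖l‖ = 1) :
    ‖p - l‖ ≤ InnerProductGeometry.angle p l := by
  apply le_of_sq_le_sq _ (InnerProductGeometry.angle_nonneg p l)
  rw [norm_sub_sq_of_unit hp hl, ← cos_angle_of_unit hp hl]
  linarith [Real.one_sub_sq_div_two_le_cos (x := InnerProductGeometry.angle p l)]

/-- The angle and the chord are comparable: `|p - l|^2 = 2 (1 - cos α)`, and `1 - cos α ≥ 2 α^2 /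
π^2 ≥ α^2 / 5`. With `ρ ≤ α / 4` the loss `1 - cos ρ ≤ ρ^2 / 2` is a small part of `1 - cos α`. -/
lemma cap_estimate {p l : E n} (hp : ‖p‖ = 1) (hl : ‖l‖ = 1) {ρ ε : ℝ} (hρ : 0 ≤ ρ)
    (hε : 0 ≤ ε) (hε' : ε ≤ 1 / 4) (h : ρ ≤ ε * InnerProductGeometry.angle p l) :
    ‖p - l‖ ^ 2 / 4 ≤ Real.cos ρ - inner ℝ p l ∧ ρ ^ 2 ≤ 5 / 2 * ε ^ 2 * ‖p - l‖ ^ 2 := by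
  rw [norm_sub_sq_of_unit hp hl, ← cos_angle_of_unit hp hl]
  set α := InnerProductGeometry.angle p l
  have hα0 : 0 ≤ α := InnerProductGeometry.angle_nonneg p l
  have hαπ : α ≤ Real.pi := InnerProductGeometry.angle_le_pi p l
  have h1 := Real.cos_le_one_sub_mul_cos_sq (x := α) (by rwa [abs_of_nonneg hα0])
  have h2 := Real.one_sub_sq_div_two_le_cos (x := ρ)
  have hpi : Real.pi ^ 2 ≤ 10 := by
    nlinarith [Real.pi_lt_d2, Real.pi_pos]
  have h3 : α ^ 2 ≤ 5 * (1 - Real.cos α) := by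
    have h4 : 2 / Real.pi ^ 2 * α ^ 2 ≤ 1 - Real.cos α := by linarith
    have h5 : 2 / 10 ≤ 2 / Real.pi ^ 2 := by
      apply div_le_div_of_nonneg_left <;> first | positivity | assumption
    nlinarith [sq_nonneg α]
  have h6 : ρ ^ 2 ≤ ε ^ 2 * α ^ 2 := by
    rw [← mul_pow]; exact pow_le_pow_left₀ hρ h 2
  have h7 : ε ^ 2 ≤ 1 / 16 := by nlinarith
  constructor
  · nlinarith [sq_nonneg α]
  · nlinarith [sq_nonneg ε]

lemma sphericalInfDist_le {p l : E n} {L : Set (E n)} (hl : l ∈ L) :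
    sphericalInfDist p L ≤ InnerProductGeometry.angle p l :=
  csInf_le ⟨0, by rintro _ ⟨q, -, rfl⟩; exact InnerProductGeometry.angle_nonneg _ _⟩ ⟨l, hl, rfl⟩

lemma sphericalInfDist_pos {Γ : Subgroup (Equiv.Perm (CBall n))} (hΓ : IsKleinian Γ)
    (hL : (limitSet Γ).Nonempty) {p : E n} (hp : p ∈ domainOfDiscontinuity Γ) :
    0 < sphericalInfDist p (limitSet Γ) := by
  have h1 : 0 < Metric.infDist p (limitSet Γ) :=
    ((isClosed_limitSet hΓ).notMem_iff_infDist_pos hL).1 hp.2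
  refine h1.trans_le (le_csInf (hL.image _) ?_)
  rintro _ ⟨q, hq, rfl⟩
  refine (Metric.infDist_le_dist_of_mem hq).trans ?_
  rw [dist_eq_norm]
  exact norm_sub_le_angle (norm_of_mem_domain hp) (norm_of_mem_limitSet hq)

lemma sphericalInfDist_le_pi {L : Set (E n)} (hL : L.Nonempty) (p : E n) :
    sphericalInfDist p L ≤ Real.pi := by
  obtain ⟨l, hl⟩ := hL
  exact (sphericalInfDist_le hl).trans (InnerProductGeometry.angle_le_pi _ _)

/-- The centre of the Euclidean ball which cuts out a hyperbolic half space stays bounded, and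
close to the sphere relative to the distance to `L`, if the corresponding cap is small relative to
its distance to `L`, in Möbius invariant terms. -/
lemma center_estimate {L : Set (E n)} (hL1 : ∀ m ∈ L, ‖m‖ = 1) {m₁ m₂ : E n} (hm₁ : m₁ ∈ L)
    (hm₂ : m₂ ∈ L) {ε S : ℝ} (hε : 0 < ε) (hεδ : 50 * ε ≤ ‖m₁ - m₂‖) (hS : 0 < S) {v : E n}
    {s : ℝ} (hvs : ‖v‖ ^ 2 - s ^ 2 = S) (hpos : ∀ m ∈ L, 0 < s - inner ℝ m v)
    (hmul : ∀ m ∈ L, ∀ m' ∈ L, S * ‖m - m'‖ ^ 2 ≤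
      160 * ε ^ 2 * ((s - inner ℝ m v) * (s - inner ℝ m' v))) :
    0 < s ∧ 1 ≤ ‖s⁻¹ • v‖ ∧ ‖s⁻¹ • v‖ ≤ 2 ∧
      ∀ m ∈ L, ‖s⁻¹ • v‖ ^ 2 - 1 ≤ 1 - inner ℝ m (s⁻¹ • v) := by
  set δ := ‖m₁ - m₂‖ with hδ
  have hδ2 : 2500 * ε ^ 2 ≤ δ ^ 2 := by nlinarith
  have hε2 : 0 < ε ^ 2 := by positivity
  have hδ0 : 0 < δ := by linarith
  have hin : ∀ m ∈ L, ∀ w : E n, |inner ℝ m w| ≤ ‖w‖ := by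
    intro m hm w
    have := abs_real_inner_le_norm m w
    rwa [hL1 m hm, one_mul] at this
  -- If `s ≤ 0`, both factors at `m₁`, `m₂` are at most `|v| + s`, and `(|v| + s)^2 ≤ |v|^2 - s^2 =
  -- S`; then `|m₁ - m₂|^2 ≤ 160 ε^2`, against `|m₁ - m₂| ≥ 50 ε`.
  have hs : 0 < s := by
    by_contra hs
    push Not at hs
    have hk : ∀ m ∈ L, (s - inner ℝ m v) ≤ ‖v‖ + s := by
      intro m hm
      have := (abs_le.1 (hin m hm v)).1
      linarith
    have h1 := hmul m₁ hm₁ m₂ hm₂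
    have k1 := hk m₁ hm₁
    have k2 := hk m₂ hm₂
    have p1 := hpos m₁ hm₁
    have p2 := hpos m₂ hm₂
    have h2 : (s - inner ℝ m₁ v) * (s - inner ℝ m₂ v) ≤ (‖v‖ + s) * (‖v‖ + s) :=
      mul_le_mul k1 k2 p2.le (p1.le.trans k1)
    have h3 : (‖v‖ + s) * (‖v‖ + s) ≤ S := by
      rw [← hvs]
      nlinarith
    have h4 : S * δ ^ 2 ≤ 160 * ε ^ 2 * S :=
      h1.trans (mul_le_mul_of_nonneg_left (h2.trans h3) (by positivity))
    nlinarith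
  set c := s⁻¹ • v with hc
  have hv : v = s • c := by rw [hc, smul_smul, mul_inv_cancel₀ hs.ne', one_smul]
  have hcn : ‖v‖ ^ 2 = s ^ 2 * ‖c‖ ^ 2 := by
    rw [hv, norm_smul, mul_pow, Real.norm_of_nonneg hs.le]
  set T := ‖c‖ ^ 2 - 1 with hT
  have hST : S = s ^ 2 * T := by rw [← hvs, hcn]; ring
  have hT0 : 0 < T := by
    by_contra h
    push Not at h
    nlinarith [sq_pos_of_pos hs]
  have hk : ∀ m, s - inner ℝ m v = s * (1 - inner ℝ m c) := by
    intro m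
    rw [hv, inner_smul_right]; ring
  have hpos' : ∀ m ∈ L, 0 < 1 - inner ℝ m c := by
    intro m hm
    have := hpos m hm
    rw [hk] at this
    exact pos_of_mul_pos_right this hs.le
  have hmul' : ∀ m ∈ L, ∀ m' ∈ L, T * ‖m - m'‖ ^ 2 ≤
      160 * ε ^ 2 * ((1 - inner ℝ m c) * (1 - inner ℝ m' c)) := by
    intro m hm m' hm'
    have h1 := hmul m hm m' hm'
    rw [hk, hk, hST] at h1
    have h2 : 0 < s ^ 2 := by positivity
    apply le_of_mul_le_mul_left _ h2
    linarith
  have hle : ∀ m ∈ L, 1 - inner ℝ m c ≤ 1 + ‖c‖ := by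
    intro m hm
    have := (abs_le.1 (hin m hm c)).1
    linarith
  have hc0 := norm_nonneg c
  have hc2 : ‖c‖ ^ 2 = 1 + T := by rw [hT]; ring
  have hTle : T ≤ 2 := by
    have h1 := hmul' m₁ hm₁ m₂ hm₂
    have h2 : (1 - inner ℝ m₁ c) * (1 - inner ℝ m₂ c) ≤ (1 + ‖c‖) * (1 + ‖c‖) :=
      mul_le_mul (hle _ hm₁) (hle _ hm₂) (hpos' _ hm₂).le (by positivity)
    have h3 : (1 + ‖c‖) * (1 + ‖c‖) ≤ 4 + 2 * T := by nlinarith [sq_nonneg (1 - ‖c‖)]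
    have h4 : T * δ ^ 2 ≤ 160 * ε ^ 2 * (4 + 2 * T) :=
      h1.trans (mul_le_mul_of_nonneg_left (h2.trans h3) (by positivity))
    have h5 : T * (2500 * ε ^ 2) ≤ T * δ ^ 2 := mul_le_mul_of_nonneg_left hδ2 hT0.le
    have h6 : ε ^ 2 * (2500 * T) ≤ ε ^ 2 * (160 * (4 + 2 * T)) := by linarith
    have := le_of_mul_le_mul_left h6 hε2
    linarith
  have hcle : ‖c‖ ≤ 2 := by nlinarith
  refine ⟨hs, by nlinarith, hcle, fun m hm => ?_⟩
  -- One of `m₁`, `m₂` is at distance at least `δ / 2` from `m`. Bounding its factor by 3 turns the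
  -- product inequality into a linear one for `m`, namely `625 T ≤ 480 (1 - ⟨m, c⟩)`.
  obtain ⟨m', hm', hfar⟩ : ∃ m' ∈ L, δ / 2 ≤ ‖m - m'‖ := by
    by_contra hcon
    push Not at hcon
    have h1 := hcon m₁ hm₁
    have h2 := hcon m₂ hm₂
    have h3 : δ ≤ ‖m - m₁‖ + ‖m - m₂‖ := by
      rw [hδ, norm_sub_rev m m₁]
      exact norm_sub_le_norm_sub_add_norm_sub _ _ _
    linarith
  have h1 := hmul' m hm m' hm'
  have h2 : (1 - inner ℝ m c) * (1 - inner ℝ m' c) ≤ (1 - inner ℝ m c) * 3 :=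
    mul_le_mul_of_nonneg_left ((hle _ hm').trans (by linarith)) (hpos' m hm).le
  have h3 : (δ / 2) ^ 2 ≤ ‖m - m'‖ ^ 2 := pow_le_pow_left₀ (by positivity) hfar 2
  have h4 : T * (625 * ε ^ 2) ≤ 160 * ε ^ 2 * ((1 - inner ℝ m c) * 3) := by
    calc T * (625 * ε ^ 2) ≤ T * ‖m - m'‖ ^ 2 :=
          mul_le_mul_of_nonneg_left (by nlinarith) hT0.le
      _ ≤ _ := h1.trans (mul_le_mul_of_nonneg_left h2 (by positivity))
  have h5 : ε ^ 2 * (625 * T) ≤ ε ^ 2 * (480 * (1 - inner ℝ m c)) := by linarith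
  have := le_of_mul_le_mul_left h5 hε2
  linarith [hpos' m hm]

/-! ### The gauge of the graph -/

section Gauge

variable (Γ : Subgroup (Equiv.Perm (CBall n))) (ε : ℝ)

/-- Centres of Euclidean balls, orthogonal to the unit sphere, which meet the unit ball inside the
union of the half spaces. Points of the sphere count as degenerate balls. -/
def supportCenters : Set (E n) :=
  {c | 1 ≤ ‖c‖ ∧ ‖c‖ ≤ 2 ∧ (∀ m ∈ limitSet Γ, ‖c‖ ^ 2 - 1 ≤ 1 - inner ℝ m c) ∧
    ∀ y, ‖y‖ < 1 → y ∉ domeUnion Γ ε → 2 * inner ℝ y c ≤ 1 + ‖y‖ ^ 2}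

/-- The support function of the set of centres. -/
def supportFn (y : E n) : ℝ := sSup ((fun c => inner ℝ y c) '' supportCenters Γ ε)

/-- The `1`-homogeneous function which equals `1` on the graph. -/
def graphGauge (y : E n) : ℝ := supportFn Γ ε y + Real.sqrt (supportFn Γ ε y ^ 2 - ‖y‖ ^ 2)

/-- Compactness makes every supremum in `supportFn` attained by an actual ball. As `|m - c|^2 = 2 (1
- ⟨m, c⟩) + (|c|^2 - 1)`, the third condition says that limit points have distance at least `√3`
radii from the centre. -/
lemma isCompact_supportCenters : IsCompact (supportCenters Γ ε) := by
  refine Metric.isCompact_of_isClosed_isBounded ?_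
    ((Metric.isBounded_closedBall (x := (0 : E n)) (r := 2)).subset fun c hc => by simpa using hc.2.1)
  have h3 : IsClosed {c : E n | ∀ m ∈ limitSet Γ, ‖c‖ ^ 2 - 1 ≤ 1 - inner ℝ m c} := by
    simp only [Set.ofPred_forall]
    exact isClosed_iInter fun m => isClosed_iInter fun hm => isClosed_le (by fun_prop) (by fun_prop)
  have h4 : IsClosed {c : E n | ∀ y, ‖y‖ < 1 → y ∉ domeUnion Γ ε →
      2 * inner ℝ y c ≤ 1 + ‖y‖ ^ 2} := by
    simp only [Set.ofPred_forall]
    exact isClosed_iInter fun y => isClosed_iInter fun _ => isClosed_iInter fun _ =>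
      isClosed_le (by fun_prop) (by fun_prop)
  exact (isClosed_le continuous_const continuous_norm).inter
    ((isClosed_le continuous_norm continuous_const).inter (h3.inter h4))

variable {Γ ε}

/-- The degenerate balls add nothing to the union, but they force `supportFn ≥ ‖·‖`, so the square
root in `graphGauge` is real everywhere. -/
lemma unit_mem_supportCenters {θ : E n} (hθ : ‖θ‖ = 1) : θ ∈ supportCenters Γ ε := by
  refine ⟨hθ.ge, by linarith, fun m hm => ?_, fun y _ _ => ?_⟩
  · have := real_inner_le_norm m θ
    rw [norm_of_mem_limitSet hm, hθ] at this
    rw [hθ]; linarith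
  · have := real_inner_le_norm y θ
    rw [hθ] at this
    nlinarith [sq_nonneg (1 - ‖y‖)]

lemma supportCenters_nonempty : (supportCenters Γ ε).Nonempty :=
  ⟨EuclideanSpace.single 0 1, unit_mem_supportCenters (by simp)⟩

lemma exists_supportFn_eq (y : E n) : ∃ c ∈ supportCenters Γ ε, supportFn Γ ε y = inner ℝ y c := by
  obtain ⟨c, hc, h, -⟩ := (isCompact_supportCenters Γ ε).exists_sSup_image_eq_and_ge
    supportCenters_nonempty (f := fun c => inner ℝ y c) (by fun_prop)
  exact ⟨c, hc, h⟩

lemma inner_le_supportFn {c : E n} (hc : c ∈ supportCenters Γ ε) (y : E n) :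
    inner ℝ y c ≤ supportFn Γ ε y :=
  le_csSup ((isCompact_supportCenters Γ ε).image (by fun_prop)).bddAbove ⟨c, hc, rfl⟩

lemma norm_le_supportFn (y : E n) : ‖y‖ ≤ supportFn Γ ε y := by
  rcases eq_or_ne y 0 with rfl | hy
  · obtain ⟨c, -, h⟩ := exists_supportFn_eq (Γ := Γ) (ε := ε) (0 : E n)
    rw [h]; simp
  · have h1 : ‖(‖y‖⁻¹ • y)‖ = 1 := by
      rw [norm_smul, norm_inv, norm_norm, inv_mul_cancel₀ (norm_ne_zero_iff.2 hy)]
    refine le_trans (le_of_eq ?_) (inner_le_supportFn (unit_mem_supportCenters h1) y)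
    rw [inner_smul_right, real_inner_self_eq_norm_sq]
    have := norm_ne_zero_iff.2 hy
    field_simp

lemma supportFn_smul {r : ℝ} (hr : 0 ≤ r) (y : E n) :
    supportFn Γ ε (r • y) = r * supportFn Γ ε y := by
  apply le_antisymm
  · obtain ⟨c, hc, h⟩ := exists_supportFn_eq (Γ := Γ) (ε := ε) (r • y)
    rw [h, inner_smul_left]
    exact mul_le_mul_of_nonneg_left (inner_le_supportFn hc y) hr
  · obtain ⟨c, hc, h⟩ := exists_supportFn_eq (Γ := Γ) (ε := ε) y
    have := inner_le_supportFn hc (r • y)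
    rw [inner_smul_left] at this
    rw [h]; exact this

lemma supportFn_sub_le (y z : E n) : supportFn Γ ε y - supportFn Γ ε z ≤ 2 * ‖y - z‖ := by
  obtain ⟨c, hc, h⟩ := exists_supportFn_eq (Γ := Γ) (ε := ε) y
  have h1 := inner_le_supportFn hc z
  have h2 := real_inner_le_norm (y - z) c
  rw [inner_sub_left] at h2
  nlinarith [hc.2.1, norm_nonneg (y - z)]

lemma graphGauge_smul {r : ℝ} (hr : 0 ≤ r) (y : E n) :
    graphGauge Γ ε (r • y) = r * graphGauge Γ ε y := by
  rw [graphGauge, graphGauge, supportFn_smul hr, norm_smul, Real.norm_of_nonneg hr]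
  rw [show (r * supportFn Γ ε y) ^ 2 - (r * ‖y‖) ^ 2 =
    r ^ 2 * (supportFn Γ ε y ^ 2 - ‖y‖ ^ 2) by ring, Real.sqrt_mul (sq_nonneg r),
    Real.sqrt_sq hr]
  ring

lemma norm_le_graphGauge (y : E n) : ‖y‖ ≤ graphGauge Γ ε y :=
  (norm_le_supportFn y).trans (le_add_of_nonneg_right (Real.sqrt_nonneg _))

/-- The point `y / t` satisfies the equation `1 + |y|^2 = 2 M(y)` of the boundary when `t^2 - 2 M(y)
t + |y|^2 = 0`, and the gauge is the larger root, the one with `t ≥ |y|`. -/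
lemma one_lt_graphGauge_iff {y : E n} (hy : ‖y‖ < 1) :
    1 < graphGauge Γ ε y ↔ 1 + ‖y‖ ^ 2 < 2 * supportFn Γ ε y := by
  rw [graphGauge]
  set M := supportFn Γ ε y
  have hM : ‖y‖ ≤ M := norm_le_supportFn y
  have hy0 := norm_nonneg y
  constructor
  · intro h
    by_contra hcon
    push Not at hcon
    have : Real.sqrt (M ^ 2 - ‖y‖ ^ 2) ≤ 1 - M := by
      apply Real.sqrt_le_iff.2
      constructor <;> nlinarith
    linarith
  · intro h
    have : 1 - M < Real.sqrt (M ^ 2 - ‖y‖ ^ 2) := by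
      rcases lt_or_ge M 1 with hM1 | hM1
      · apply Real.lt_sqrt_of_sq_lt
        nlinarith
      · refine lt_of_le_of_lt (by linarith) (Real.sqrt_pos.2 (by nlinarith))
    linarith

/-- The half spaces of the family are cut out by balls with centres in `supportCenters`. -/
lemma exists_center (hΓ : IsKleinian Γ) {m₁ m₂ : E n} (hm₁ : m₁ ∈ limitSet Γ)
    (hm₂ : m₂ ∈ limitSet Γ) (hε : 0 < ε) (hε4 : ε ≤ 1 / 4) (hεδ : 50 * ε ≤ ‖m₁ - m₂‖)
    {γ : Equiv.Perm (CBall n)} (hγ : γ ∈ Γ) {p : E n} (hp : p ∈ domainOfDiscontinuity Γ) :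
    ∃ c ∈ supportCenters Γ ε, ∀ y : CBall n, ‖(y : E n)‖ < 1 →
      ((y : E n) ∈ halfSpace p (ε * sphericalInfDist p (limitSet Γ)) ↔
        1 + ‖(γ y : E n)‖ ^ 2 < 2 * inner ℝ (γ y : E n) c) := by
  have hI := hΓ.isBallIsometry hγ
  have hp1 := norm_of_mem_domain hp
  set ρ := ε * sphericalInfDist p (limitSet Γ) with hρ
  have hd := sphericalInfDist_pos hΓ ⟨m₁, hm₁⟩ hp
  have hdπ := sphericalInfDist_le_pi ⟨m₁, hm₁⟩ p
  have hρ0 : 0 < ρ := by positivity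
  have hρπ : ρ < Real.pi / 2 := by nlinarith [Real.pi_pos]
  have hcosρ : 0 < Real.cos ρ := Real.cos_pos_of_mem_Ioo ⟨by linarith, hρπ⟩
  have hsin : 0 < Real.sin ρ := Real.sin_pos_of_pos_of_lt_pi hρ0 (by linarith)
  have hcap : ∀ l ∈ limitSet Γ, ‖p - l‖ ^ 2 / 4 ≤ Real.cos ρ - inner ℝ p l ∧
      ρ ^ 2 ≤ 5 / 2 * ε ^ 2 * ‖p - l‖ ^ 2 := fun l hl =>
    cap_estimate hp1 (norm_of_mem_limitSet hl) hρ0.le hε.le hε4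
      (mul_le_mul_of_nonneg_left (sphericalInfDist_le hl) hε.le)
  have hpl : ∀ l ∈ limitSet Γ, 0 < ‖p - l‖ ^ 2 := by
    intro l hl
    have : p - l ≠ 0 := by
      rw [sub_ne_zero]
      rintro rfl
      exact hp.2 hl
    positivity
  -- The half space is the positivity set of the functional `(p, cos ρ)`; its image is that of the
  -- transported functional `(v, s)`, with the same invariant `sin^2 ρ`.
  obtain ⟨v, s, hvs, hmap⟩ := hI.exists_lorentzFun_map p (Real.cos ρ)
  have hS : ‖v‖ ^ 2 - s ^ 2 = Real.sin ρ ^ 2 := by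
    rw [hvs, hp1, Real.sin_sq]; ring
  have hk : ∀ l : CBall n, (l : E n) ∈ limitSet Γ → s - inner ℝ (γ l : E n) v =
      (Real.cos ρ - inner ℝ p (l : E n)) * confFactor γ l := by
    intro l hl
    have h1 := hmap l
    rw [lorentzFun, lorentzFun, norm_of_mem_limitSet hl, hI.norm_map_eq_one
      (norm_of_mem_limitSet hl), real_inner_comm p] at h1
    linarith
  have hpos : ∀ m ∈ limitSet Γ, 0 < s - inner ℝ m v := by
    intro m hm
    obtain ⟨l, hl, rfl⟩ := exists_mem_limitSet_map hΓ hγ hm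
    rw [hk l hl]
    have h1 := (hcap l hl).1
    have h2 := hpl l hl
    exact mul_pos (by linarith) (hI.confFactor_pos (cball_norm_le l))
  -- Both sides are multiplied by `confFactor γ l * confFactor γ l'` under `γ`, so it suffices to
  -- compare before applying `γ`; this gives uniformity in `γ`. The constant is `160 = 10 * 16`: the
  -- 10 from the triangle inequality and `5 / 2` twice, the 16 from the two factors `1 / 4` in
  -- `cap_estimate`.
  have hmul : ∀ m ∈ limitSet Γ, ∀ m' ∈ limitSet Γ, Real.sin ρ ^ 2 * ‖m - m'‖ ^ 2 ≤
      160 * ε ^ 2 * ((s - inner ℝ m v) * (s - inner ℝ m' v)) := by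
    intro m hm m' hm'
    obtain ⟨l, hl, rfl⟩ := exists_mem_limitSet_map hΓ hγ hm
    obtain ⟨l', hl', rfl⟩ := exists_mem_limitSet_map hΓ hγ hm'
    rw [hk l hl, hk l' hl', hI.norm_sub_sq l l']
    have c1 := hI.confFactor_pos (cball_norm_le l)
    have c2 := hI.confFactor_pos (cball_norm_le l')
    obtain ⟨a1, a2⟩ := hcap l hl
    obtain ⟨b1, b2⟩ := hcap l' hl'
    have hA := hpl l hl
    have hB := hpl l' hl'
    set A := ‖p - (l : E n)‖ ^ 2 with hAdef
    set B := ‖p - (l' : E n)‖ ^ 2 with hBdef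
    have h1 : Real.sin ρ ^ 2 ≤ ρ ^ 2 := pow_le_pow_left₀ hsin.le (Real.sin_le hρ0.le) 2
    have h2 : ‖(l : E n) - l'‖ ^ 2 ≤ 2 * A + 2 * B := by
      have h3 : ‖(l : E n) - l'‖ ≤ ‖p - l‖ + ‖p - l'‖ := by
        rw [norm_sub_rev p (l : E n)]
        exact norm_sub_le_norm_sub_add_norm_sub _ _ _
      nlinarith [sq_nonneg (‖p - (l : E n)‖ - ‖p - (l' : E n)‖), norm_nonneg ((l : E n) - l'),
        norm_nonneg (p - (l : E n)), norm_nonneg (p - (l' : E n))]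
    have h4 : Real.sin ρ ^ 2 * ‖(l : E n) - l'‖ ^ 2 ≤ 10 * ε ^ 2 * (A * B) := by
      have e1 : Real.sin ρ ^ 2 * ‖(l : E n) - l'‖ ^ 2 ≤ Real.sin ρ ^ 2 * (2 * A + 2 * B) :=
        mul_le_mul_of_nonneg_left h2 (sq_nonneg _)
      have e2 : Real.sin ρ ^ 2 * A ≤ 5 / 2 * ε ^ 2 * B * A :=
        mul_le_mul_of_nonneg_right (h1.trans b2) hA.le
      have e3 : Real.sin ρ ^ 2 * B ≤ 5 / 2 * ε ^ 2 * A * B :=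
        mul_le_mul_of_nonneg_right (h1.trans a2) hB.le
      nlinarith
    have h5 : A * B ≤ 16 * ((Real.cos ρ - inner ℝ p (l : E n)) *
        (Real.cos ρ - inner ℝ p (l' : E n))) := by
      have := mul_le_mul a1 b1 (by positivity) (by linarith)
      linarith
    have h6 : Real.sin ρ ^ 2 * ‖(l : E n) - l'‖ ^ 2 ≤ 160 * ε ^ 2 *
        ((Real.cos ρ - inner ℝ p (l : E n)) * (Real.cos ρ - inner ℝ p (l' : E n))) := by
      have := mul_le_mul_of_nonneg_left h5 (by positivity : 0 ≤ 10 * ε ^ 2)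
      linarith
    have h7 := mul_le_mul_of_nonneg_right h6 (mul_pos c1 c2).le
    linarith
  obtain ⟨hs, hc1, hc2, hc3⟩ := center_estimate (fun m hm => norm_of_mem_limitSet hm) hm₁ hm₂ hε
    hεδ (by positivity) hS hpos hmul
  have hiff : ∀ y : CBall n, ‖(y : E n)‖ < 1 →
      ((y : E n) ∈ halfSpace p ρ ↔ 1 + ‖(γ y : E n)‖ ^ 2 < 2 * inner ℝ (γ y : E n) (s⁻¹ • v)) := by
    intro y hy
    have h1 := hmap y
    have h2 := hI.confFactor_pos (cball_norm_le y)
    rw [halfSpace, Set.mem_ofPred_eq, and_iff_right hy, inner_smul_right]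
    have h3 : (1 + ‖(y : E n)‖ ^ 2) * Real.cos ρ < 2 * inner ℝ (y : E n) p ↔
        0 < lorentzFun p (Real.cos ρ) y * confFactor γ y := by
      rw [mul_pos_iff_of_pos_right h2, lorentzFun, sub_pos]
    rw [h3, h1, lorentzFun, sub_pos, ← mul_lt_mul_iff_right₀ (inv_pos.2 hs)]
    have h4 : s⁻¹ * ((1 + ‖(γ y : E n)‖ ^ 2) * s) = 1 + ‖(γ y : E n)‖ ^ 2 := by field_simp
    rw [h4]
    have h5 : s⁻¹ * (2 * inner ℝ (γ y : E n) v) = 2 * (s⁻¹ * inner ℝ (γ y : E n) v) := by ring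
    rw [h5]
  refine ⟨s⁻¹ • v, ⟨hc1, hc2, hc3, fun z hz hzU => ?_⟩, hiff⟩
  by_contra hcon
  push Not at hcon
  apply hzU
  let z' : CBall n := ⟨z, by simpa using hz.le⟩
  have hz' : γ (γ⁻¹ z') = z' := γ.apply_symm_apply z'
  refine ⟨γ, hγ, p, hp, γ⁻¹ z', ?_, by rw [hz']⟩
  rw [hiff _ (hI.maps_inv z' hz), hz']
  exact hcon

lemma norm_lt_one_of_mem_domeUnion (hΓ : IsKleinian Γ) {z : E n} (hz : z ∈ domeUnion Γ ε) :
    ‖z‖ < 1 := by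
  obtain ⟨γ, hγ, p, -, y, hy, rfl⟩ := hz
  exact hΓ.maps_ball γ hγ y hy.1

lemma map_mem_domeUnion {γ : Equiv.Perm (CBall n)} (hγ : γ ∈ Γ) {z : CBall n}
    (hz : (z : E n) ∈ domeUnion Γ ε) : (γ z : E n) ∈ domeUnion Γ ε := by
  obtain ⟨γ', hγ', p, hp, y, hy, hzy⟩ := hz
  refine ⟨γ * γ', Γ.mul_mem hγ hγ', p, hp, y, hy, ?_⟩
  rw [show z = γ' y from Subtype.ext hzy]
  rfl

lemma map_mem_domeUnion_iff {γ : Equiv.Perm (CBall n)} (hγ : γ ∈ Γ) {z : CBall n} :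
    (γ z : E n) ∈ domeUnion Γ ε ↔ (z : E n) ∈ domeUnion Γ ε := by
  refine ⟨fun h => ?_, map_mem_domeUnion hγ⟩
  have := map_mem_domeUnion (Γ.inv_mem hγ) h
  rwa [show γ⁻¹ (γ z) = z from γ.symm_apply_apply z] at this

/-- The properties of the gauge of the graph which the analysis uses. -/
structure IsGraphGauge (Γ : Subgroup (Equiv.Perm (CBall n))) (ε : ℝ) (N : E n → ℝ) : Prop where
  lipschitz : ∃ K, LipschitzWith K N
  smul : ∀ r : ℝ, 0 ≤ r → ∀ y, N (r • y) = r * N y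
  norm_le : ∀ y, ‖y‖ ≤ N y
  mem_iff : ∀ y, ‖y‖ < 1 → (y ∈ domeUnion Γ ε ↔ 1 < N y)
  limit_iff : ∀ θ, ‖θ‖ = 1 → (N θ = 1 ↔ θ ∈ limitSet Γ)

/-- This is the ball over the original cap at `θ`, with no group element applied. Its radius is `tan
ρ`, and the condition at `m` becomes `sin^2 ρ ≤ cos ρ (cos ρ - ⟨θ, m⟩)`. -/
lemma center_of_unit (hΓ : IsKleinian Γ) {m₁ : E n} (hm₁ : m₁ ∈ limitSet Γ)
    (hε : 0 < ε) (hε4 : ε ≤ 1 / 4)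
    {θ : E n} (hθ : θ ∈ domainOfDiscontinuity Γ) :
    (Real.cos (ε * sphericalInfDist θ (limitSet Γ)))⁻¹ • θ ∈ supportCenters Γ ε := by
  have hp1 := norm_of_mem_domain hθ
  set ρ := ε * sphericalInfDist θ (limitSet Γ) with hρ
  have hd := sphericalInfDist_pos hΓ ⟨m₁, hm₁⟩ hθ
  have hdπ := sphericalInfDist_le_pi ⟨m₁, hm₁⟩ θ
  have hρ0 : 0 < ρ := by positivity
  have hρ1 : ρ < 1 := by nlinarith [Real.pi_lt_four]
  have hcos : 1 / 2 ≤ Real.cos ρ := by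
    have := Real.one_sub_sq_div_two_le_cos (x := ρ)
    nlinarith
  have hcos0 : 0 < Real.cos ρ := by linarith
  have hn : ‖(Real.cos ρ)⁻¹ • θ‖ = (Real.cos ρ)⁻¹ := by
    rw [norm_smul, hp1, mul_one, Real.norm_of_nonneg (by positivity)]
  refine ⟨?_, ?_, fun m hm => ?_, fun y hy hyU => ?_⟩
  · rw [hn]
    exact (one_le_inv₀ hcos0).2 (Real.cos_le_one ρ)
  · rw [hn]
    rw [inv_le_comm₀ hcos0 two_pos]
    linarith
  · obtain ⟨h1, h2⟩ := cap_estimate hp1 (norm_of_mem_limitSet hm) hρ0.le hε.le hε4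
      (mul_le_mul_of_nonneg_left (sphericalInfDist_le hm) hε.le)
    rw [hn, inner_smul_right, real_inner_comm]
    have h3 : Real.sin ρ ^ 2 ≤ ρ ^ 2 :=
      pow_le_pow_left₀ (Real.sin_nonneg_of_nonneg_of_le_pi hρ0.le (by linarith [Real.pi_gt_three]))
        (Real.sin_le hρ0.le) 2
    have h4 : ρ ^ 2 ≤ 1 / 2 * (‖θ - m‖ ^ 2 / 4) * 2 := by
      have : ε ^ 2 ≤ 1 / 16 := by nlinarith
      nlinarith [sq_nonneg ‖θ - m‖]
    have h5 : Real.sin ρ ^ 2 ≤ Real.cos ρ * (Real.cos ρ - inner ℝ θ m) := by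
      have : ε ^ 2 ≤ 1 / 16 := by nlinarith
      have h6 : Real.sin ρ ^ 2 ≤ 5 / 32 * ‖θ - m‖ ^ 2 := by nlinarith [sq_nonneg ‖θ - m‖]
      -- From `ρ ≤ π / 4 < 0.7863` and `cos ρ ≥ 1 - ρ^2 / 2`; the value `5 / 8` matches the `5 / 32`
      -- of the preceding bound.
      have h7 : 5 / 8 ≤ Real.cos ρ := by
        have := Real.one_sub_sq_div_two_le_cos (x := ρ)
        have : ρ ≤ 0.7863 := by
          have : Real.pi < 3.1416 := by linarith [Real.pi_lt_d4]
          nlinarith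
        nlinarith
      have h8 : 5 / 8 * (‖θ - m‖ ^ 2 / 4) ≤ Real.cos ρ * (Real.cos ρ - inner ℝ θ m) :=
        mul_le_mul h7 h1 (by positivity) hcos0.le
      linarith
    rw [← sub_nonneg]
    have h9 : 1 - (Real.cos ρ)⁻¹ * inner ℝ θ m - ((Real.cos ρ)⁻¹ ^ 2 - 1) =
        (Real.cos ρ * (Real.cos ρ - inner ℝ θ m) - (1 - Real.cos ρ ^ 2)) / Real.cos ρ ^ 2 := by
      field_simp
    rw [h9, ← Real.sin_sq]
    exact div_nonneg (by linarith) (sq_nonneg _)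
  · by_contra hcon
    push Not at hcon
    apply hyU
    refine ⟨1, Γ.one_mem, θ, hθ, ⟨y, by simpa using hy.le⟩, ⟨hy, ?_⟩, rfl⟩
    rw [inner_smul_right] at hcon
    change (1 + ‖y‖ ^ 2) * Real.cos ρ < 2 * inner ℝ y θ
    have h1 := mul_lt_mul_of_pos_right hcon hcos0
    have h2 : 2 * ((Real.cos ρ)⁻¹ * inner ℝ y θ) * Real.cos ρ = 2 * inner ℝ y θ := by field_simp
    linarith

lemma tan_le_supportFn (hΓ : IsKleinian Γ) {m₁ : E n} (hm₁ : m₁ ∈ limitSet Γ)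
    (hε : 0 < ε) (hε4 : ε ≤ 1 / 4) {θ : E n} (hθ : θ ∈ domainOfDiscontinuity Γ) :
    (ε * sphericalInfDist θ (limitSet Γ)) ^ 2 ≤ supportFn Γ ε θ ^ 2 - 1 := by
  have h1 := inner_le_supportFn (center_of_unit hΓ hm₁ hε hε4 hθ) θ
  have hp1 := norm_of_mem_domain hθ
  set ρ := ε * sphericalInfDist θ (limitSet Γ) with hρ
  have hd := sphericalInfDist_pos hΓ ⟨m₁, hm₁⟩ hθ
  have hdπ := sphericalInfDist_le_pi ⟨m₁, hm₁⟩ θ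
  have hρ0 : 0 < ρ := by positivity
  have hρ1 : ρ < 1 := by nlinarith [Real.pi_lt_four]
  have hcos0 : 0 < Real.cos ρ :=
    Real.cos_pos_of_mem_Ioo ⟨by linarith, by linarith [Real.pi_gt_three]⟩
  rw [inner_smul_right, real_inner_self_eq_norm_sq, hp1] at h1
  have h2 : (Real.cos ρ)⁻¹ ^ 2 ≤ supportFn Γ ε θ ^ 2 :=
    pow_le_pow_left₀ (by positivity) (by linarith) 2
  have h3 := Real.le_tan hρ0.le (by linarith [Real.pi_gt_three])
  have h4 : Real.tan ρ ^ 2 = (Real.cos ρ)⁻¹ ^ 2 - 1 := by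
    rw [Real.tan_eq_sin_div_cos, div_pow, Real.sin_sq]
    field_simp
  have h5 : ρ ^ 2 ≤ Real.tan ρ ^ 2 := pow_le_pow_left₀ hρ0.le h3 2
  linarith

/-- If `⟨θ, c⟩ ≥ 1`, then `θ` lies in the closed ball of radius `t` about `c`. That ball is well
separated from the limit set, so `θ` is at distance at least `t / 2` from it, and the cap at `θ`
itself already lifts `supportFn Γ ε θ` by an amount comparable to `ε^2 t^2`. -/
lemma center_excess_le (hΓ : IsKleinian Γ) {m₁ : E n} (hm₁ : m₁ ∈ limitSet Γ)
    (hε : 0 < ε) (hε4 : ε ≤ 1 / 4) {θ c : E n} (hθ : ‖θ‖ = 1) (hc : c ∈ supportCenters Γ ε)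
    (hθc : 1 ≤ inner ℝ θ c) : ‖c‖ ^ 2 - 1 ≤ 4 / ε ^ 2 * (supportFn Γ ε θ ^ 2 - 1) := by
  have hM : 1 ≤ supportFn Γ ε θ := hθ ▸ norm_le_supportFn θ
  by_cases hθL : θ ∈ limitSet Γ
  · have h1 := hc.2.2.1 θ hθL
    have : 0 ≤ 4 / ε ^ 2 * (supportFn Γ ε θ ^ 2 - 1) :=
      mul_nonneg (by positivity) (by nlinarith)
    linarith
  have hθΩ : θ ∈ domainOfDiscontinuity Γ := ⟨by simpa using hθ, hθL⟩
  set t := Real.sqrt (‖c‖ ^ 2 - 1) with ht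
  have hT0 : 0 ≤ ‖c‖ ^ 2 - 1 := by nlinarith [hc.1]
  have ht2 : t ^ 2 = ‖c‖ ^ 2 - 1 := Real.sq_sqrt hT0
  have ht0 : 0 ≤ t := Real.sqrt_nonneg _
  have hcθ : ‖c - θ‖ ≤ t := by
    apply Real.le_sqrt_of_sq_le
    rw [norm_sub_sq_real, hθ, real_inner_comm]
    linarith
  have h2 : t / 2 ≤ sphericalInfDist θ (limitSet Γ) := by
    apply le_csInf (Set.Nonempty.image _ ⟨m₁, hm₁⟩)
    rintro _ ⟨m, hm, rfl⟩
    refine le_trans ?_ (norm_sub_le_angle hθ (norm_of_mem_limitSet hm))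
    have h3 := hc.2.2.1 m hm
    have h4 : inner ℝ (θ - m) c = inner ℝ (θ - m) (c - θ) + ‖θ - m‖ ^ 2 / 2 := by
      rw [norm_sub_sq_of_unit hθ (norm_of_mem_limitSet hm)]
      simp only [inner_sub_left, inner_sub_right, real_inner_self_eq_norm_sq, hθ]
      rw [real_inner_comm m θ]
      ring
    have h5 := real_inner_le_norm (θ - m) (c - θ)
    have h6 : inner ℝ (θ - m) c = inner ℝ θ c - inner ℝ m c := inner_sub_left _ _ _
    have h7 : t ^ 2 ≤ ‖θ - m‖ * t + ‖θ - m‖ ^ 2 / 2 := by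
      have := mul_le_mul_of_nonneg_left hcθ (norm_nonneg (θ - m))
      rw [ht2]; linarith
    nlinarith [norm_nonneg (θ - m)]
  have h3 := tan_le_supportFn hΓ hm₁ hε hε4 hθΩ
  have h4 : (ε * (t / 2)) ^ 2 ≤ supportFn Γ ε θ ^ 2 - 1 :=
    (pow_le_pow_left₀ (by positivity) (mul_le_mul_of_nonneg_left h2 hε.le) 2).trans h3
  rw [← ht2, div_mul_eq_mul_div, le_div_iff₀ (by positivity)]
  nlinarith

/-- For `c` attaining the supremum, `⟨y, c⟩ c - y` plays the role of half the gradient of `M^2 -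
|y|^2`. A gradient bounded by a multiple of the square root of the function is what makes that
square root Lipschitz. The squared length is at most `⟨y, c⟩^2 (|c|^2 - 1)`. -/
lemma norm_reflection_le (hΓ : IsKleinian Γ) {m₁ : E n} (hm₁ : m₁ ∈ limitSet Γ)
    (hε : 0 < ε) (hε4 : ε ≤ 1 / 4) {y c : E n} (hc : c ∈ supportCenters Γ ε)
    (hyc : ‖y‖ ≤ inner ℝ y c) :
    ‖inner ℝ y c • c - y‖ ≤ 4 / ε * Real.sqrt (supportFn Γ ε y ^ 2 - ‖y‖ ^ 2) := by
  rcases eq_or_ne y 0 with rfl | hy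
  · simp; positivity
  have hy0 : 0 < ‖y‖ := norm_pos_iff.2 hy
  set θ := ‖y‖⁻¹ • y with hθdef
  have hyθ : y = ‖y‖ • θ := by rw [hθdef, smul_smul, mul_inv_cancel₀ hy0.ne', one_smul]
  have hθ : ‖θ‖ = 1 := by rw [hθdef, norm_smul, norm_inv, norm_norm, inv_mul_cancel₀ hy0.ne']
  have hM : supportFn Γ ε y = ‖y‖ * supportFn Γ ε θ := by
    conv_lhs => rw [hyθ]
    rw [supportFn_smul hy0.le]
  have hin : inner ℝ y c = ‖y‖ * inner ℝ θ c := by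
    conv_lhs => rw [hyθ]
    rw [inner_smul_left]; rfl
  have hθc : 1 ≤ inner ℝ θ c := by
    rw [hin] at hyc
    exact le_of_mul_le_mul_left (by linarith) hy0
  have h1 := center_excess_le hΓ hm₁ hε hε4 hθ hc hθc
  have hM1 : 1 ≤ supportFn Γ ε θ := hθ ▸ norm_le_supportFn θ
  have hW : 0 ≤ supportFn Γ ε y ^ 2 - ‖y‖ ^ 2 := by
    nlinarith [norm_le_supportFn (Γ := Γ) (ε := ε) y, norm_nonneg y]
  apply le_of_sq_le_sq _ (by positivity)
  rw [mul_pow, Real.sq_sqrt hW, norm_sub_sq_real, norm_smul, inner_smul_left, mul_pow,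
    Real.norm_eq_abs, sq_abs, real_inner_comm y c]
  simp only [conj_trivial]
  have h2 : inner ℝ y c ≤ 2 * ‖y‖ := by
    have := real_inner_le_norm y c
    nlinarith [hc.2.1]
  have h3 : inner ℝ y c ^ 2 ≤ 4 * ‖y‖ ^ 2 := by nlinarith
  have h0 : 0 ≤ ‖c‖ ^ 2 - 1 := by nlinarith [hc.1]
  have h4 : inner ℝ y c ^ 2 * (‖c‖ ^ 2 - 1) ≤ 4 * ‖y‖ ^ 2 * (4 / ε ^ 2 * (supportFn Γ ε θ ^ 2 - 1)) :=
    mul_le_mul h3 h1 h0 (by positivity)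
  have h5 : 4 * ‖y‖ ^ 2 * (4 / ε ^ 2 * (supportFn Γ ε θ ^ 2 - 1)) =
      (4 / ε) ^ 2 * (supportFn Γ ε y ^ 2 - ‖y‖ ^ 2) := by
    rw [hM]; field_simp
  have h6 : ‖y‖ ^ 2 ≤ inner ℝ y c ^ 2 := pow_le_pow_left₀ hy0.le hyc 2
  linarith

lemma sqrt_supportFn_sub_le (hΓ : IsKleinian Γ) {m₁ : E n} (hm₁ : m₁ ∈ limitSet Γ)
    (hε : 0 < ε) (hε4 : ε ≤ 1 / 4) (y z : E n) :
    Real.sqrt (supportFn Γ ε y ^ 2 - ‖y‖ ^ 2) - Real.sqrt (supportFn Γ ε z ^ 2 - ‖z‖ ^ 2) ≤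
      (8 / ε + 2) * ‖y - z‖ := by
  set M₁ := supportFn Γ ε y with hM₁
  set M₂ := supportFn Γ ε z with hM₂
  have hy := norm_le_supportFn (Γ := Γ) (ε := ε) y
  have hz := norm_le_supportFn (Γ := Γ) (ε := ε) z
  have hW1 : 0 ≤ M₁ ^ 2 - ‖y‖ ^ 2 := by nlinarith [norm_nonneg y]
  have hW2 : 0 ≤ M₂ ^ 2 - ‖z‖ ^ 2 := by nlinarith [norm_nonneg z]
  set W₁ := Real.sqrt (M₁ ^ 2 - ‖y‖ ^ 2) with hW₁
  set W₂ := Real.sqrt (M₂ ^ 2 - ‖z‖ ^ 2) with hW₂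
  have s1 : W₁ ^ 2 = M₁ ^ 2 - ‖y‖ ^ 2 := Real.sq_sqrt hW1
  have s2 : W₂ ^ 2 = M₂ ^ 2 - ‖z‖ ^ 2 := Real.sq_sqrt hW2
  have p1 : 0 ≤ W₁ := Real.sqrt_nonneg _
  have p2 : 0 ≤ W₂ := Real.sqrt_nonneg _
  have he := norm_nonneg (y - z)
  set e := ‖y - z‖ with he'
  have h8 : 0 < 8 / ε := by positivity
  have h8e : 0 ≤ 8 / ε * e := by positivity
  have hexp : (8 / ε + 2) * e = 8 / ε * e + 2 * e := by ring
  rw [hexp]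
  -- In the remaining case `M₁ ≥ W₁ > 2 e`, so `⟨z, c⟩` is still nonnegative and the lower bound `M₂
  -- ≥ ⟨z, c⟩` may be squared.
  rcases le_or_gt W₁ (2 * e) with hWe | hWe
  · linarith
  obtain ⟨c, hc, hyc⟩ := exists_supportFn_eq (Γ := Γ) (ε := ε) y
  rw [← hM₁] at hyc
  have hM0 : 0 ≤ M₁ := (norm_nonneg y).trans hy
  have hWM : W₁ ≤ M₁ := by
    apply Real.sqrt_le_iff.2
    exact ⟨hM0, by nlinarith [sq_nonneg ‖y‖]⟩
  have hdc : inner ℝ (y - z) c ≤ 2 * e := by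
    have := real_inner_le_norm (y - z) c
    nlinarith [hc.2.1]
  have hzc : inner ℝ z c = M₁ - inner ℝ (y - z) c := by
    rw [inner_sub_left, hyc]; ring
  have hzc0 : 0 ≤ inner ℝ z c := by rw [hzc]; linarith
  have hM₂ge : inner ℝ z c ^ 2 ≤ M₂ ^ 2 :=
    pow_le_pow_left₀ hzc0 (inner_le_supportFn hc z) 2
  have hB := norm_reflection_le hΓ hm₁ hε hε4 hc (by rw [← hyc]; exact hy : ‖y‖ ≤ inner ℝ y c)
  rw [← hM₁, ← hW₁, ← hyc] at hB
  have hin := real_inner_le_norm (y - z) (M₁ • c - y)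
  rw [inner_sub_right, inner_smul_right] at hin
  have hzn : ‖z‖ ^ 2 = ‖y‖ ^ 2 - 2 * inner ℝ (y - z) y + e ^ 2 := by
    have : z = y - (y - z) := by abel
    conv_lhs => rw [this]
    rw [norm_sub_sq_real, real_inner_comm]
  have hkey : W₁ ^ 2 - W₂ ^ 2 ≤ 2 * (e * (4 / ε * W₁)) + e ^ 2 := by
    have h1 : e * ‖M₁ • c - y‖ ≤ e * (4 / ε * W₁) := mul_le_mul_of_nonneg_left hB he
    have h3 := sq_nonneg (inner ℝ (y - z) c)
    have h4 : M₁ ^ 2 - 2 * (M₁ * inner ℝ (y - z) c) + inner ℝ (y - z) c ^ 2 ≤ M₂ ^ 2 := by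
      rw [hzc] at hM₂ge
      linarith
    rw [s1, s2, hzn]
    linarith
  rcases le_or_gt W₁ W₂ with hle | hlt
  · linarith
  have hpos : 0 < W₁ := by linarith
  have h2 : (W₁ - W₂) * W₁ ≤ (8 / ε * e + 2 * e) * W₁ := by
    have e1 : (W₁ - W₂) * W₁ ≤ W₁ ^ 2 - W₂ ^ 2 := by
      have := mul_nonneg p2 (sub_nonneg.2 hlt.le)
      linarith
    have e2 : 2 * (e * (4 / ε * W₁)) = 8 / ε * e * W₁ := by ring
    have e3 : e ^ 2 ≤ 2 * e * W₁ := by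
      have := mul_le_mul_of_nonneg_left hWe.le he
      linarith [sq_nonneg e]
    linarith
  exact le_of_mul_le_mul_right h2 hpos

/-- Each half space has a centre in the family; conversely the supremum is attained by a ball whose
part in the unit ball lies in the union. At a limit point `θ` the maximizing centre satisfies `0 ≤
|c|^2 - 1 ≤ 1 - M(θ)`, which forces `M(θ) = 1`; off the limit set the cap at `θ` gives `M(θ) > 1`.
-/
lemma isGraphGauge_graphGauge (hΓ : IsKleinian Γ) {m₁ m₂ : E n} (hm₁ : m₁ ∈ limitSet Γ)
    (hm₂ : m₂ ∈ limitSet Γ) (hε : 0 < ε) (hε4 : ε ≤ 1 / 4) (hεδ : 50 * ε ≤ ‖m₁ - m₂‖) :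
    IsGraphGauge Γ ε (graphGauge Γ ε) where
  lipschitz := by
    refine ⟨Real.toNNReal (8 / ε + 4), LipschitzWith.of_le_add_mul' _ fun y z => ?_⟩
    have h1 := sqrt_supportFn_sub_le hΓ hm₁ hε hε4 y z
    have h2 := supportFn_sub_le (Γ := Γ) (ε := ε) y z
    rw [graphGauge, graphGauge, dist_eq_norm]
    linarith
  smul r hr y := graphGauge_smul hr y
  norm_le := norm_le_graphGauge
  mem_iff y hy := by
    rw [one_lt_graphGauge_iff hy]
    constructor
    · rintro ⟨γ, hγ, p, hp, w, hw, rfl⟩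
      obtain ⟨c, hc, hiff⟩ := exists_center hΓ hm₁ hm₂ hε hε4 hεδ hγ hp
      have := (hiff w hw.1).1 hw
      linarith [inner_le_supportFn hc (γ w : E n)]
    · intro h
      obtain ⟨c, hc, hM⟩ := exists_supportFn_eq (Γ := Γ) (ε := ε) y
      by_contra hU
      have := hc.2.2.2 y hy hU
      linarith
  limit_iff θ hθ := by
    constructor
    · intro h
      by_contra hL
      have hθΩ : θ ∈ domainOfDiscontinuity Γ := ⟨by simpa using hθ, hL⟩
      have h1 := tan_le_supportFn hΓ hm₁ hε hε4 hθΩ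
      have h2 := sphericalInfDist_pos hΓ ⟨m₁, hm₁⟩ hθΩ
      have h3 : supportFn Γ ε θ ≤ 1 := by
        rw [graphGauge] at h
        linarith [Real.sqrt_nonneg (supportFn Γ ε θ ^ 2 - ‖θ‖ ^ 2)]
      have h4 : 1 ≤ supportFn Γ ε θ := hθ ▸ norm_le_supportFn θ
      have h5 : 0 < (ε * sphericalInfDist θ (limitSet Γ)) ^ 2 := by positivity
      nlinarith
    · intro hL
      have h4 : 1 ≤ supportFn Γ ε θ := hθ ▸ norm_le_supportFn θ
      obtain ⟨c, hc, hM⟩ := exists_supportFn_eq (Γ := Γ) (ε := ε) θ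
      have h5 := hc.2.2.1 θ hL
      have h6 : supportFn Γ ε θ = 1 := by
        have : 0 ≤ ‖c‖ ^ 2 - 1 := by nlinarith [hc.1]
        linarith
      rw [graphGauge, h6, hθ]; simp

end Gauge

/-! ### Polar coordinates -/

lemma finrank_E : Module.finrank ℝ (E n) - 1 = n := by simp

lemma lintegral_polar_prod (F : E n → ENNReal) :
    ∫⁻ y, F y = ∫⁻ p : Metric.sphere (0 : E n) 1 × Set.Ioi (0 : ℝ),
      F ((p.2 : ℝ) • (p.1 : E n))
        ∂((volume : Measure (E n)).toSphere.prod (Measure.volumeIoiPow n)) := by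
  have hmp := (volume : Measure (E n)).measurePreserving_homeomorphUnitSphereProd
  rw [finrank_E] at hmp
  rw [← hmp.lintegral_comp_emb (Homeomorph.measurableEmbedding _)]
  conv_lhs => rw [← restrict_compl_singleton (μ := (volume : Measure (E n))) 0,
    ← lintegral_subtype_comap (measurableSet_singleton _).compl]
  refine lintegral_congr fun y => ?_
  have := congrArg Subtype.val ((homeomorphUnitSphereProd (E n)).symm_apply_apply y)
  rw [homeomorphUnitSphereProd_symm_apply_coe] at this
  rw [this]

lemma lintegral_volumeIoiPow (f : ℝ → ENNReal) (hf : Measurable f) :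
    ∫⁻ r : Set.Ioi (0 : ℝ), f r ∂(Measure.volumeIoiPow n) =
      ∫⁻ r in Set.Ioi (0 : ℝ), ENNReal.ofReal (r ^ n) * f r := by
  rw [Measure.volumeIoiPow, lintegral_withDensity_eq_lintegral_mul _ (by fun_prop) (by fun_prop)]
  exact lintegral_subtype_comap measurableSet_Ioi (fun r => ENNReal.ofReal (r ^ n) * f r)

lemma lintegral_polar (F : E n → ENNReal) (hF : Measurable F) :
    ∫⁻ y, F y = ∫⁻ θ : Metric.sphere (0 : E n) 1, ∫⁻ r in Set.Ioi (0 : ℝ),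
      ENNReal.ofReal (r ^ n) * F (r • (θ : E n)) ∂(volume : Measure ℝ)
        ∂(volume : Measure (E n)).toSphere := by
  rw [lintegral_polar_prod, lintegral_prod _ (by fun_prop)]
  refine lintegral_congr fun θ => ?_
  exact lintegral_volumeIoiPow (fun r => F (r • (θ : E n))) (by fun_prop)

lemma measurePreserving_polar :
    MeasurePreserving (fun y : ({(0 : E n)}ᶜ : Set (E n)) => homeomorphUnitSphereProd (E n) y)
      ((volume : Measure (E n)).comap Subtype.val)
      ((volume : Measure (E n)).toSphere.prod (Measure.volumeIoiPow n)) := by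
  have hmp := (volume : Measure (E n)).measurePreserving_homeomorphUnitSphereProd
  rwa [finrank_E] at hmp

lemma integral_polar (F : E n → ℝ) (hF : Integrable F) :
    ∫ y, F y = ∫ θ : Metric.sphere (0 : E n) 1, ∫ r in Set.Ioi (0 : ℝ),
      r ^ n * F (r • (θ : E n)) ∂(volume : Measure ℝ) ∂(volume : Measure (E n)).toSphere := by
  have hcongr : ∀ y : ({(0 : E n)}ᶜ : Set (E n)), F y =
      (fun p : Metric.sphere (0 : E n) 1 × Set.Ioi (0 : ℝ) => F ((p.2 : ℝ) • (p.1 : E n)))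
        (homeomorphUnitSphereProd (E n) y) := by
    intro y
    have := congrArg Subtype.val ((homeomorphUnitSphereProd (E n)).symm_apply_apply y)
    rw [homeomorphUnitSphereProd_symm_apply_coe] at this
    simp only [this]
  have hint : Integrable (fun p : Metric.sphere (0 : E n) 1 × Set.Ioi (0 : ℝ) =>
      F ((p.2 : ℝ) • (p.1 : E n)))
        ((volume : Measure (E n)).toSphere.prod (Measure.volumeIoiPow n)) := by
    rw [← measurePreserving_polar.integrable_comp_emb (Homeomorph.measurableEmbedding _)]
    have : Integrable (fun y : ({(0 : E n)}ᶜ : Set (E n)) => F y)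
        ((volume : Measure (E n)).comap Subtype.val) :=
      (integrableOn_iff_comap_subtypeVal (measurableSet_singleton _).compl).1 hF.integrableOn
    exact this.congr (Filter.Eventually.of_forall hcongr)
  conv_lhs => rw [← restrict_compl_singleton (μ := (volume : Measure (E n))) 0,
    ← integral_subtype_comap (measurableSet_singleton _).compl]
  rw [integral_congr_ae (Filter.Eventually.of_forall hcongr),
    measurePreserving_polar.integral_comp (Homeomorph.measurableEmbedding _)
    (fun p : Metric.sphere (0 : E n) 1 × Set.Ioi (0 : ℝ) => F ((p.2 : ℝ) • (p.1 : E n))),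
    integral_prod _ hint]
  refine integral_congr_ae (Filter.Eventually.of_forall fun θ => ?_)
  simp only [Measure.volumeIoiPow, ENNReal.ofReal]
  rw [integral_withDensity_eq_integral_smul (measurable_subtype_coe.pow_const _).real_toNNReal,
    integral_subtype_comap measurableSet_Ioi
      (fun r : ℝ => Real.toNNReal (r ^ n) • F (r • (θ : E n)))]
  refine setIntegral_congr_fun measurableSet_Ioi fun r hr => ?_
  simp only [NNReal.smul_def, Real.coe_toNNReal _ (pow_nonneg (le_of_lt hr) n), smul_eq_mul]

/-- A property of points which is invariant under scaling and holds almost everywhere holds at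
almost all points of the sphere. -/
lemma ae_toSphere_of_ae {p : E n → Prop} (hp : ∀ᵐ y : E n, p y)
    (hinv : ∀ r : ℝ, 0 < r → ∀ y, p (r • y) → p y) :
    ∀ᵐ θ : Metric.sphere (0 : E n) 1 ∂(volume : Measure (E n)).toSphere, p θ := by
  obtain ⟨s, hs, hsm, hs0⟩ := exists_measurable_superset_of_null (show volume {y | ¬ p y} = 0 from hp)
  have h1 : ∫⁻ y, s.indicator 1 y = 0 := by
    rw [lintegral_indicator_one hsm, hs0]
  rw [lintegral_polar _ (measurable_one.indicator hsm), lintegral_eq_zero_iff (by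
    have : Measurable (s.indicator (1 : E n → ENNReal)) := measurable_one.indicator hsm
    refine Measurable.lintegral_prod_right' (f := fun q : Metric.sphere (0 : E n) 1 × ℝ =>
      ENNReal.ofReal (q.2 ^ n) * s.indicator 1 (q.2 • (q.1 : E n))) ?_
    fun_prop)] at h1
  filter_upwards [h1] with θ hθ
  by_contra hcon
  simp only [Pi.zero_apply] at hθ
  have h2 : ∀ r ∈ Set.Ioi (0 : ℝ), s.indicator (1 : E n → ENNReal) (r • (θ : E n)) = 1 := by
    intro r hr
    rw [Set.indicator_of_mem]; rfl
    exact hs (fun h => hcon (hinv r hr _ h))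
  rw [setLIntegral_congr_fun measurableSet_Ioi (g := fun r : ℝ => ENNReal.ofReal (r ^ n))
    (fun r hr => by simp only [h2 r hr, mul_one])] at hθ
  rw [lintegral_eq_zero_iff (by fun_prop)] at hθ
  have h3 : ∀ᵐ r : ℝ ∂volume.restrict (Set.Ioi (0 : ℝ)), False := by
    filter_upwards [hθ, ae_restrict_mem measurableSet_Ioi] with r hr hr0
    simp only [Pi.zero_apply, ENNReal.ofReal_eq_zero] at hr
    exact absurd hr (not_le.2 (pow_pos hr0 n))
  have h4 := h3
  rw [ae_iff] at h4
  simp at h4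

/-! ### The divergence theorem for star-shaped Lipschitz domains -/

/-- The divergence of a vector field. -/
def divergence (Y : E n → E n) (y : E n) : ℝ :=
  ∑ i, (fderiv ℝ Y y (EuclideanSpace.single i 1)) i

section Gauge

variable {N : E n → ℝ}

lemma gauge_pos (hnorm : ∀ y, ‖y‖ ≤ N y) {θ : E n} (hθ : ‖θ‖ = 1) : 0 < N θ := by
  linarith [hnorm θ]

lemma fderiv_gauge_smul (hsmul : ∀ r : ℝ, 0 ≤ r → ∀ y, N (r • y) = r * N y) {r : ℝ} (hr : 0 < r)
    (y : E n) : fderiv ℝ N (r • y) = fderiv ℝ N y := by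
  have h1 : fderiv ℝ (fun z : E n => N (r • z)) y = r • fderiv ℝ N (r • y) := fderiv_comp_smul r
  have h2 : (fun z : E n => N (r • z)) = r • N := by
    funext z; exact hsmul r hr.le z
  rw [h2, fderiv_const_smul_field] at h1
  exact (smul_right_injective _ hr.ne' h1).symm

lemma differentiableAt_gauge_smul (hsmul : ∀ r : ℝ, 0 ≤ r → ∀ y, N (r • y) = r * N y) {r : ℝ}
    (hr : 0 < r) {y : E n} (h : DifferentiableAt ℝ N (r • y)) : DifferentiableAt ℝ N y := by
  have h1 : DifferentiableAt ℝ (fun z : E n => N (r • z)) y :=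
    DifferentiableAt.comp (f := fun z : E n => r • z) y h (by fun_prop)
  have h2 : (fun z : E n => N (r • z)) = fun z => r * N z := by
    funext z; exact hsmul r hr.le z
  rw [h2] at h1
  have h3 := h1.const_mul r⁻¹
  refine h3.congr_of_eventuallyEq (Filter.Eventually.of_forall fun z => ?_)
  simp only []
  rw [inv_mul_cancel_left₀ hr.ne']

lemma fderiv_gauge_self (hsmul : ∀ r : ℝ, 0 ≤ r → ∀ y, N (r • y) = r * N y) {y : E n}
    (h : DifferentiableAt ℝ N y) : fderiv ℝ N y y = N y := by
  have h1 := h.hasFDerivAt.hasLineDerivAt y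
  have h2 : HasDerivAt (fun t : ℝ => N (y + t • y)) (N y) 0 := by
    have h3 : (fun t : ℝ => N (y + t • y)) =ᶠ[nhds 0] fun t => (1 + t) * N y := by
      filter_upwards [Ioi_mem_nhds (show (-1 : ℝ) < 0 by norm_num)] with t ht
      have ht : -1 < t := ht
      rw [← hsmul (1 + t) (by linarith), add_smul, one_smul]
    refine HasDerivAt.congr_of_eventuallyEq ?_ h3
    simpa using ((hasDerivAt_id (0 : ℝ)).const_add 1).mul_const (N y)
  exact HasDerivAt.unique h1 h2

lemma norm_fderiv_gauge_le {K : NNReal} (hLip : LipschitzWith K N) (y : E n) :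
    ‖fderiv ℝ N y‖ ≤ K := norm_fderiv_le_of_lipschitz ℝ hLip

/-- The flux density through the surface `N = s`, on the sphere. -/
def fluxDensity (N : E n → ℝ) (Y : E n → E n) (s : ℝ) (θ : E n) : ℝ :=
  fderiv ℝ N θ (Y ((s * (N θ)⁻¹) • θ)) * (N θ)⁻¹ ^ (n + 1)

lemma measurable_fluxDensity (hN : Continuous N) {Y : E n → E n} (hY : Continuous Y) :
    Measurable (fun q : E n × ℝ => fluxDensity N Y q.2 q.1) := by
  have hN' := hN.measurable
  have h2 : Measurable (fun q : E n × ℝ => Y ((q.2 * (N q.1)⁻¹) • q.1)) :=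
    hY.measurable.comp (by fun_prop)
  have h1 : Measurable (fun q : E n × ℝ => (fderiv ℝ N q.1, Y ((q.2 * (N q.1)⁻¹) • q.1))) :=
    ((measurable_fderiv ℝ N).comp measurable_fst).prodMk h2
  have h3 : Measurable (fun q : E n × ℝ => fderiv ℝ N q.1 (Y ((q.2 * (N q.1)⁻¹) • q.1))) :=
    (ContinuousLinearMap.measurable_apply₂ (𝕜 := ℝ) (E := E n) (F := ℝ)).comp h1
  unfold fluxDensity
  fun_prop

lemma abs_fluxDensity_le {K : NNReal} (hLip : LipschitzWith K N) (hnorm : ∀ y, ‖y‖ ≤ N y)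
    {Y : E n → E n} {C : ℝ} (hC : ∀ y, ‖Y y‖ ≤ C) (s : ℝ) {θ : E n} (hθ : ‖θ‖ = 1) :
    |fluxDensity N Y s θ| ≤ K * C := by
  have hN1 : 1 ≤ N θ := hθ ▸ hnorm θ
  have h1 : |fderiv ℝ N θ (Y ((s * (N θ)⁻¹) • θ))| ≤ K * C :=
    ((fderiv ℝ N θ).le_opNorm _).trans
      (mul_le_mul (norm_fderiv_gauge_le hLip θ) (hC _) (norm_nonneg _) K.2)
  have h2 : (N θ)⁻¹ ^ (n + 1) ≤ 1 := pow_le_one₀ (by positivity) (inv_le_one_of_one_le₀ hN1)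
  have h3 : 0 ≤ (N θ)⁻¹ ^ (n + 1) := by positivity
  rw [fluxDensity, abs_mul, abs_of_nonneg h3]
  exact (mul_le_of_le_one_right (abs_nonneg _) h2).trans h1

lemma continuous_flux {K : NNReal} (hLip : LipschitzWith K N) (hnorm : ∀ y, ‖y‖ ≤ N y)
    {Y : E n → E n} (hY : Continuous Y) {C : ℝ} (hC : ∀ y, ‖Y y‖ ≤ C) :
    Continuous (fun s : ℝ => ∫ θ : Metric.sphere (0 : E n) 1, fluxDensity N Y s θ
      ∂(volume : Measure (E n)).toSphere) := by
  refine continuous_of_dominated (bound := fun _ => K * C) (fun s => ?_) (fun s => ?_)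
    (integrable_const _) ?_
  · exact ((measurable_fluxDensity hLip.continuous hY).comp
      (measurable_subtype_coe.prodMk measurable_const)).aestronglyMeasurable
  · refine Filter.Eventually.of_forall fun θ => ?_
    exact abs_fluxDensity_le hLip hnorm hC s (by simp)
  · refine Filter.Eventually.of_forall fun θ => ?_
    unfold fluxDensity
    fun_prop

/-- A coarea formula for the level sets of `N`: on the ray through `θ` substitute `s = r N(θ)`,
using that the differential of `N` is constant along rays. -/
lemma integral_polar_gauge {K : NNReal} (hLip : LipschitzWith K N)
    (hsmul : ∀ r : ℝ, 0 ≤ r → ∀ y, N (r • y) = r * N y) (hnorm : ∀ y, ‖y‖ ≤ N y)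
    {Y : E n → E n} (hY : Continuous Y) {C : ℝ} (hC : ∀ y, ‖Y y‖ ≤ C) {ψ : ℝ → ℝ}
    (hψ : Continuous ψ) (hψc : HasCompactSupport ψ) :
    ∫ y, ψ (N y) * fderiv ℝ N y (Y y) = ∫ s in Set.Ioi (0 : ℝ), ψ s * (s ^ n *
      ∫ θ : Metric.sphere (0 : E n) 1, fluxDensity N Y s θ ∂(volume : Measure (E n)).toSphere) := by
  have hC0 : 0 ≤ C := (norm_nonneg _).trans (hC 0)
  have hmeas : Measurable (fun y : E n => fderiv ℝ N y (Y y)) :=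
    (ContinuousLinearMap.measurable_apply₂ (𝕜 := ℝ) (E := E n) (F := ℝ)).comp
      ((measurable_fderiv ℝ N).prodMk hY.measurable)
  have hψN : Integrable (fun y : E n => ψ (N y)) := by
    refine (hψ.comp hLip.continuous).integrable_of_hasCompactSupport ?_
    obtain ⟨R, hR⟩ := hψc.isBounded.exists_norm_le
    refine HasCompactSupport.of_support_subset_isCompact (isCompact_closedBall (0 : E n) R) ?_
    intro y hy
    have h1 := hR (N y) (subset_tsupport _ hy)
    rw [mem_closedBall_zero_iff]
    exact (hnorm y).trans ((le_abs_self _).trans h1)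
  have hint : Integrable (fun y : E n => ψ (N y) * fderiv ℝ N y (Y y)) := by
    refine hψN.mul_bdd (c := K * C) hmeas.aestronglyMeasurable
      (Filter.Eventually.of_forall fun y => ?_)
    exact ((fderiv ℝ N y).le_opNorm _).trans
      (mul_le_mul (norm_fderiv_gauge_le hLip y) (hC _) (norm_nonneg _) K.2)
  rw [integral_polar _ hint]
  have h1 : ∀ θ : Metric.sphere (0 : E n) 1, ∫ r in Set.Ioi (0 : ℝ),
      r ^ n * (ψ (N (r • (θ : E n))) * fderiv ℝ N (r • (θ : E n)) (Y (r • (θ : E n)))) =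
      ∫ s in Set.Ioi (0 : ℝ), ψ s * (s ^ n * fluxDensity N Y s θ) := by
    intro θ
    have hθ : ‖(θ : E n)‖ = 1 := by simp
    have hN0 := gauge_pos hnorm hθ
    have h2 := integral_comp_mul_right_Ioi
      (fun s => ψ s * (s ^ n * fluxDensity N Y s θ)) 0 hN0
    rw [zero_mul, smul_eq_mul, eq_comm, inv_mul_eq_iff_eq_mul₀ hN0.ne',
      ← integral_const_mul] at h2
    rw [h2]
    refine setIntegral_congr_fun measurableSet_Ioi fun r hr => ?_
    have hr : 0 < r := hr
    simp only [fluxDensity]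
    rw [fderiv_gauge_smul hsmul hr, hsmul r hr.le, mul_assoc r, mul_inv_cancel₀ hN0.ne', mul_one,
      mul_pow, pow_succ, inv_pow]
    field_simp
  rw [integral_congr_ae (Filter.Eventually.of_forall h1), integral_integral_swap]
  · refine setIntegral_congr_fun measurableSet_Ioi fun s hs => ?_
    rw [integral_const_mul, integral_const_mul]
  · have hb : Integrable (fun q : Metric.sphere (0 : E n) 1 × ℝ => (1 : ℝ) * (ψ q.2 * q.2 ^ n))
        ((volume : Measure (E n)).toSphere.prod (volume.restrict (Set.Ioi (0 : ℝ)))) := by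
      refine Integrable.mul_prod (f := fun _ => (1 : ℝ)) (g := fun s : ℝ => ψ s * s ^ n)
        (integrable_const _) ?_
      exact ((hψ.mul (continuous_pow n)).integrable_of_hasCompactSupport
        hψc.mul_right).integrableOn
    have h3 : Measurable (fun q : Metric.sphere (0 : E n) 1 × ℝ => fluxDensity N Y q.2 q.1) :=
      (measurable_fluxDensity hLip.continuous hY).comp
        ((measurable_subtype_coe.comp measurable_fst).prodMk measurable_snd)
    refine (hb.mul_bdd (c := K * C) h3.aestronglyMeasurable
      (Filter.Eventually.of_forall fun q => ?_)).congr (Filter.Eventually.of_forall fun q => ?_)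
    · exact abs_fluxDensity_le hLip hnorm hC q.2 (by simp)
    · simp only [Function.uncurry]
      ring

/-- Integration by parts coordinate by coordinate with line derivatives, which by Rademacher's
theorem assemble almost everywhere to the differential. -/
lemma integral_fderiv_comp_mul_eq {φ : E n → ℝ} {K : NNReal} (hφ : LipschitzWith K φ)
    {Y : E n → E n} (hY : ContDiff ℝ 1 Y) (hYc : HasCompactSupport Y) :
    ∫ y, fderiv ℝ φ y (Y y) = - ∫ y, φ y * divergence Y y := by
  have hYL : ∀ i, ∃ D, LipschitzWith D (fun y => Y y i) := by
    intro i
    have h1 : ContDiff ℝ 1 (fun y => Y y i) := by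
      exact (contDiff_euclidean.1 hY) i
    have h2 : HasCompactSupport (fun y => Y y i) :=
      hYc.comp_left (g := fun v : E n => v i) rfl
    exact h1.lipschitzWith_of_hasCompactSupport h2 one_ne_zero
  have hYci : ∀ i, HasCompactSupport (fun y => Y y i) := fun i =>
    hYc.comp_left (g := fun v : E n => v i) rfl
  have hYd : ∀ i y, DifferentiableAt ℝ (fun y => Y y i) y := fun i y =>
    ((contDiff_euclidean.1 hY) i).differentiable one_ne_zero y
  have hYdf : ∀ i y v, fderiv ℝ (fun y => Y y i) y v = fderiv ℝ Y y v i := by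
    intro i y v
    have h1 := (hY.differentiable one_ne_zero y).hasFDerivAt
    have h2 := ((hasFDerivWithinAt_euclidean.1 h1.hasFDerivWithinAt) i).hasFDerivAt Filter.univ_mem
    rw [h2.fderiv]
    rfl
  have hdcont : ∀ i, Continuous (fun y => fderiv ℝ Y y (EuclideanSpace.single i 1) i) := by
    intro i
    have := hY.continuous_fderiv one_ne_zero
    fun_prop
  have hint1 : ∀ i, Integrable (fun y => lineDeriv ℝ φ y (EuclideanSpace.single i 1) * Y y i) := by
    intro i
    have h1 : Integrable (fun y => Y y i) :=
      ((contDiff_euclidean.1 hY) i).continuous.integrable_of_hasCompactSupport (hYci i)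
    refine h1.bdd_mul (c := K) (aestronglyMeasurable_lineDeriv hφ.continuous volume)
      (Filter.Eventually.of_forall fun y => ?_)
    have := norm_lineDeriv_le_of_lipschitz ℝ hφ (x₀ := y)
      (v := (EuclideanSpace.single i 1 : E n))
    simpa using this
  have hint2 : ∀ i, Integrable (fun y => φ y * fderiv ℝ Y y (EuclideanSpace.single i 1) i) := by
    intro i
    refine (hφ.continuous.mul (hdcont i)).integrable_of_hasCompactSupport ?_
    refine HasCompactSupport.mul_left ?_
    exact (hYc.fderiv ℝ).comp_left
      (g := fun L : E n →L[ℝ] E n => L (EuclideanSpace.single i 1) i) rfl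
  have hkey : ∀ i, ∫ y, lineDeriv ℝ φ y (EuclideanSpace.single i 1) * Y y i =
      - ∫ y, φ y * fderiv ℝ Y y (EuclideanSpace.single i 1) i := by
    intro i
    obtain ⟨D, hD⟩ := hYL i
    rw [hφ.integral_lineDeriv_mul_eq hD (hYci i), ← integral_neg]
    refine integral_congr_ae (Filter.Eventually.of_forall fun y => ?_)
    simp only []
    rw [(hYd i y).lineDeriv_eq_fderiv, map_neg, hYdf]
    ring
  have hae : ∀ᵐ y, fderiv ℝ φ y (Y y) =
      ∑ i, lineDeriv ℝ φ y (EuclideanSpace.single i 1) * Y y i := by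
    filter_upwards [hφ.ae_differentiableAt] with y hy
    have h1 : Y y = ∑ i, Y y i • (EuclideanSpace.single i 1 : E n) := by
      ext j
      simp [Finset.sum_apply, Pi.single_apply]
    conv_lhs => rw [h1]
    rw [map_sum]
    refine Finset.sum_congr rfl fun i _ => ?_
    rw [map_smul, hy.lineDeriv_eq_fderiv, smul_eq_mul, mul_comm]
  rw [integral_congr_ae hae, integral_finsetSum _ fun i _ => hint1 i]
  simp only [hkey, divergence, Finset.mul_sum]
  rw [integral_finsetSum _ fun i _ => hint2 i, Finset.sum_neg_distrib]

/-- The divergence theorem: the flux of a vector field through the surface `N = 1` only depends on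
its divergence in the unit ball, if it is divergence free between the surface and the sphere. -/
theorem integral_fluxDensity_eq {K : NNReal} (hLip : LipschitzWith K N)
    (hsmul : ∀ r : ℝ, 0 ≤ r → ∀ y, N (r • y) = r * N y) (hnorm : ∀ y, ‖y‖ ≤ N y)
    {Y : E n → E n} (hY : ContDiff ℝ 1 Y) (hYc : HasCompactSupport Y) {δ : ℝ} (hδ : 0 < δ)
    (hδ1 : δ < 1) (hdiv : ∀ y, 1 - δ < N y → ‖y‖ < 1 → divergence Y y = 0) :
    ∫ θ : Metric.sphere (0 : E n) 1, fluxDensity N Y 1 θ ∂(volume : Measure (E n)).toSphere =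
      ∫ y in Metric.ball (0 : E n) 1, divergence Y y := by
  obtain ⟨C, hC⟩ := hY.continuous.bounded_above_of_compact_support hYc
  set I := ∫ y in Metric.ball (0 : E n) 1, divergence Y y with hI
  set J : ℝ → ℝ := fun s => ∫ θ : Metric.sphere (0 : E n) 1, fluxDensity N Y s θ
    ∂(volume : Measure (E n)).toSphere with hJ
  have hJc : Continuous J := continuous_flux hLip hnorm hY.continuous hC
  -- Test the divergence with `η(N(y))`, where `η' = -ψ`. This equals `∫ ψ` where `N ≤ 1 - δ`,
  -- vanishes outside the unit ball because `N ≥ |y|`, and varies only where the divergence is zero.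
  -- Hence `s^n J(s)` is weakly equal to the constant `I` on `(1 - δ, 1)`.
  have hmain : ∀ ψ : ℝ → ℝ, ContDiff ℝ (⊤ : ℕ∞) ψ → HasCompactSupport ψ →
      tsupport ψ ⊆ Set.Ioo (1 - δ) 1 → ∫ s, ψ s • (s ^ n * J s - I) = 0 := by
    intro ψ hψ hψc hsupp
    have hψcont := hψ.continuous
    have hψint : Integrable ψ := hψcont.integrable_of_hasCompactSupport hψc
    have hψ0 : ∀ s, s ∉ Set.Ioo (1 - δ) 1 → ψ s = 0 := fun s hs =>
      image_eq_zero_of_notMem_tsupport fun h => hs (hsupp h)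
    set η : ℝ → ℝ := fun s => ∫ t in s..1, ψ t with hη
    have hηd : ∀ s, HasDerivAt η (-ψ s) s := fun s =>
      intervalIntegral.integral_hasDerivAt_left (hψcont.intervalIntegrable _ _)
        hψcont.stronglyMeasurable.stronglyMeasurableAtFilter hψcont.continuousAt
    have hη1 : ∀ s, 1 ≤ s → η s = 0 := by
      intro s hs
      simp only [hη]
      rw [intervalIntegral.integral_symm, intervalIntegral.integral_of_le hs,
        setIntegral_congr_fun measurableSet_Ioc (g := fun _ => (0 : ℝ))
        (fun t ht => hψ0 t fun h => by linarith [ht.1, h.2])]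
      simp
    have hη0 : ∀ s, s ≤ 1 - δ → η s = ∫ t, ψ t := by
      intro s hs
      simp only [hη]
      apply intervalIntegral.integral_eq_integral_of_support_subset
      intro t ht
      have := hsupp (subset_tsupport _ ht)
      exact ⟨by linarith [this.1], this.2.le⟩
    obtain ⟨B, hB⟩ := hψcont.bounded_above_of_compact_support hψc
    have hB0 : 0 ≤ B := (norm_nonneg _).trans (hB 0)
    have hηL : LipschitzWith ⟨B, hB0⟩ η := by
      apply lipschitzWith_of_nnnorm_deriv_le fun s => (hηd s).differentiableAt
      intro s
      rw [(hηd s).deriv, nnnorm_neg]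
      exact hB s
    have hφL := hηL.comp hLip
    have h1 := integral_fderiv_comp_mul_eq hφL hY hYc
    have h2 : ∀ᵐ y, fderiv ℝ (η ∘ N) y (Y y) = -(ψ (N y) * fderiv ℝ N y (Y y)) := by
      filter_upwards [hLip.ae_differentiableAt] with y hy
      rw [((hηd (N y)).comp_hasFDerivAt y hy.hasFDerivAt).fderiv]
      simp
    rw [integral_congr_ae h2, integral_neg, neg_inj,
      integral_polar_gauge hLip hsmul hnorm hY.continuous hC hψcont hψc] at h1
    have h3 : ∫ y, (η ∘ N) y * divergence Y y = (∫ t, ψ t) * I := by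
      rw [hI, ← integral_const_mul, ← integral_indicator measurableSet_ball]
      refine integral_congr_ae (Filter.Eventually.of_forall fun y => ?_)
      simp only [Function.comp]
      by_cases hy : ‖y‖ < 1
      · rw [Set.indicator_of_mem (by simpa using hy)]
        by_cases hN : 1 - δ < N y
        · rw [hdiv y hN hy]; simp
        · rw [hη0 _ (not_lt.1 hN)]
      · rw [Set.indicator_of_notMem (by simpa using hy), hη1 _ ((not_lt.1 hy).trans (hnorm y)),
          zero_mul]
    rw [h3] at h1
    have h4 : ∫ s in Set.Ioi (0 : ℝ), ψ s * (s ^ n * J s) = ∫ s, ψ s * (s ^ n * J s) := by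
      apply setIntegral_eq_integral_of_forall_compl_eq_zero
      intro s hs
      rw [hψ0 s fun h => hs (by have := h.1; simp only [Set.mem_Ioi]; linarith), zero_mul]
    simp only [smul_eq_mul, mul_sub]
    rw [integral_sub, ← h4, h1, integral_mul_const, sub_self]
    · exact (hψcont.mul ((continuous_pow n).mul hJc)).integrable_of_hasCompactSupport
        hψc.mul_right
    · exact hψint.mul_const _
  have hgc : Continuous (fun s : ℝ => s ^ n * J s - I) :=
    ((continuous_pow n).mul hJc).sub continuous_const
  have hae := isOpen_Ioo.ae_eq_zero_of_integral_contDiff_smul_eq_zero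
    (U := Set.Ioo (1 - δ) 1) (μ := volume) (f := fun s : ℝ => s ^ n * J s - I)
    (hgc.locallyIntegrable.locallyIntegrableOn _) hmain
  -- Equality for almost every `s < 1` extends to the surface `s = 1` by continuity of the flux.
  have hae' : (fun s : ℝ => s ^ n * J s - I) =ᵐ[volume.restrict (Set.Icc (1 - δ) 1)]
      fun _ => 0 := by
    rw [← restrict_Ioo_eq_restrict_Icc, Filter.EventuallyEq, ae_restrict_iff' measurableSet_Ioo]
    exact hae
  have := Measure.eqOn_Icc_of_ae_eq volume (by linarith : (1 - δ) ≠ 1) hae' hgc.continuousOn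
    continuousOn_const (Set.right_mem_Icc.2 (by linarith))
  simp only [one_pow, one_mul] at this
  linarith

end Gauge

/-! ### The graph in terms of its gauge -/

section Graph

variable {Γ : Subgroup (Equiv.Perm (CBall n))} {ε : ℝ} {N : E n → ℝ}

namespace IsGraphGauge

lemma continuous (hN : IsGraphGauge Γ ε N) : Continuous N := by
  obtain ⟨K, hK⟩ := hN.lipschitz
  exact hK.continuous

lemma zero (hN : IsGraphGauge Γ ε N) : N 0 = 0 := by
  have := hN.smul 0 le_rfl 0
  simpa using this

lemma pos (hN : IsGraphGauge Γ ε N) {y : E n} (hy : y ≠ 0) : 0 < N y :=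
  (norm_pos_iff.2 hy).trans_le (hN.norm_le y)

lemma pos_of_lt (_hN : IsGraphGauge Γ ε N) {y : E n} (hy : ‖y‖ < N y) : 0 < N y :=
  (norm_nonneg y).trans_lt hy

lemma domeUnion_eq (hN : IsGraphGauge Γ ε N) (hΓ : IsKleinian Γ) :
    domeUnion Γ ε = {y | ‖y‖ < 1 ∧ 1 < N y} := by
  ext y
  constructor
  · intro hy
    have h1 := norm_lt_one_of_mem_domeUnion hΓ hy
    exact ⟨h1, (hN.mem_iff y h1).1 hy⟩
  · rintro ⟨h1, h2⟩
    exact (hN.mem_iff y h1).2 h2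

lemma isOpen_domeUnion (hN : IsGraphGauge Γ ε N) (hΓ : IsKleinian Γ) : IsOpen (domeUnion Γ ε) := by
  rw [hN.domeUnion_eq hΓ]
  exact (isOpen_lt continuous_norm continuous_const).inter
    (isOpen_lt continuous_const hN.continuous)

lemma mem_closure_domeUnion (hN : IsGraphGauge Γ ε N) {y : E n} (hy : ‖y‖ < 1) (h : N y = 1) :
    y ∈ closure (domeUnion Γ ε) := by
  have h1 : Filter.Tendsto (fun t : ℝ => (1 + t) • y) (nhdsWithin 0 (Set.Ioi 0)) (nhds y) := by
    have : Filter.Tendsto (fun t : ℝ => (1 + t) • y) (nhds 0) (nhds ((1 + 0 : ℝ) • y)) := by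
      apply Continuous.tendsto
      fun_prop
    rw [add_zero, one_smul] at this
    exact this.mono_left nhdsWithin_le_nhds
  refine mem_closure_of_tendsto h1 ?_
  have h2 : ∀ᶠ t : ℝ in nhdsWithin 0 (Set.Ioi 0), ‖(1 + t) • y‖ < 1 :=
    h1.norm.eventually_lt tendsto_const_nhds hy
  filter_upwards [h2, self_mem_nhdsWithin] with t ht ht0
  have ht0 : 0 < t := ht0
  rw [hN.mem_iff _ ht, hN.smul _ (by linarith), h]
  linarith

lemma mem_graphSet_iff (hN : IsGraphGauge Γ ε N) (hΓ : IsKleinian Γ) {y : E n} :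
    y ∈ graphSet Γ ε ↔ ‖y‖ < 1 ∧ N y = 1 := by
  rw [graphSet, frontier, (hN.isOpen_domeUnion hΓ).interior_eq]
  constructor
  · rintro ⟨⟨h1, h2⟩, h3⟩
    have h3 : ‖y‖ < 1 := by simpa using h3
    refine ⟨h3, le_antisymm ?_ ?_⟩
    · by_contra hcon
      exact h2 ((hN.mem_iff y h3).2 (not_le.1 hcon))
    · have : closure (domeUnion Γ ε) ⊆ {y | 1 ≤ N y} := by
        apply closure_minimal _ (isClosed_le continuous_const hN.continuous)
        rw [hN.domeUnion_eq hΓ]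
        exact fun z hz => hz.2.le
      exact this h1
  · rintro ⟨h1, h2⟩
    refine ⟨⟨hN.mem_closure_domeUnion h1 h2, fun h => ?_⟩, by simpa using h1⟩
    have := (hN.mem_iff y h1).1 h
    linarith

lemma lt_one_of_notMem_closure (hN : IsGraphGauge Γ ε N) {x : E n} (hx : ‖x‖ < 1)
    (h : x ∉ closure (domeUnion Γ ε)) : N x < 1 := by
  by_contra hcon
  rcases (not_lt.1 hcon).eq_or_lt with h1 | h1
  · exact h (hN.mem_closure_domeUnion hx h1.symm)
  · exact h (subset_closure ((hN.mem_iff x hx).2 h1))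

lemma radialFn_eq (hN : IsGraphGauge Γ ε N) (hΓ : IsKleinian Γ) {z : E n} (hz : z ≠ 0)
    (h : ‖z‖ < N z) : radialFn Γ ε z = ‖z‖ / N z := by
  have hz0 : 0 < ‖z‖ := norm_pos_iff.2 hz
  have hNz := hN.pos hz
  have : {t : ℝ | 0 < t ∧ (t / ‖z‖) • z ∈ graphSet Γ ε} = {‖z‖ / N z} := by
    ext t
    simp only [Set.mem_ofPred_eq, Set.mem_singleton_iff]
    rw [hN.mem_graphSet_iff hΓ]
    constructor
    · rintro ⟨ht, -, h2⟩
      rw [hN.smul _ (by positivity)] at h2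
      field_simp at h2 ⊢
      linarith
    · rintro rfl
      have e : ‖z‖ / N z / ‖z‖ = (N z)⁻¹ := by field_simp
      refine ⟨by positivity, ?_, ?_⟩
      · rw [e, norm_smul, norm_inv, Real.norm_of_nonneg hNz.le, inv_mul_lt_one₀ hNz]
        exact h
      · rw [e, hN.smul _ (by positivity), inv_mul_cancel₀ hNz.ne']
  rw [radialFn, this, csInf_singleton]

/-- In these directions no point of the graph is met, and the infimum of the empty set has the
default value 0. -/
lemma radialFn_eq_zero (hN : IsGraphGauge Γ ε N) (hΓ : IsKleinian Γ) {z : E n}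
    (h : ¬ (‖z‖ < N z)) : radialFn Γ ε z = 0 := by
  have : {t : ℝ | 0 < t ∧ (t / ‖z‖) • z ∈ graphSet Γ ε} = ∅ := by
    ext t
    simp only [Set.mem_ofPred_eq, Set.mem_empty_iff_false, iff_false]
    rw [hN.mem_graphSet_iff hΓ]
    rintro ⟨ht, h1, h2⟩
    have h3 : N z = ‖z‖ := le_antisymm (not_lt.1 h) (hN.norm_le z)
    rw [hN.smul _ (by positivity), h3] at h2
    rw [norm_smul, Real.norm_of_nonneg (by positivity)] at h1
    linarith
  rw [radialFn, this, Real.sInf_empty]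

lemma measurable_radialFn (hN : IsGraphGauge Γ ε N) (hΓ : IsKleinian Γ) :
    Measurable (radialFn Γ ε) := by
  have hm := hN.continuous.measurable
  have : radialFn Γ ε = Set.indicator {z | ‖z‖ < N z} (fun z => ‖z‖ / N z) := by
    funext z
    by_cases h : ‖z‖ < N z
    · rw [Set.indicator_of_mem (by exact h)]
      refine hN.radialFn_eq hΓ ?_ h
      rintro rfl
      rw [hN.zero] at h
      simp at h
    · rw [Set.indicator_of_notMem (by exact h), hN.radialFn_eq_zero hΓ h]
  rw [this]
  exact (by fun_prop : Measurable fun z : E n => ‖z‖ / N z).indicator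
    (measurableSet_lt measurable_norm hm)

lemma mem_domain_iff (hN : IsGraphGauge Γ ε N) {θ : E n} (hθ : ‖θ‖ = 1) :
    θ ∈ domainOfDiscontinuity Γ ↔ 1 < N θ := by
  have h1 := hN.norm_le θ
  rw [hθ] at h1
  rw [domainOfDiscontinuity, Set.mem_sdiff, ← hN.limit_iff θ hθ]
  simp only [mem_sphere_zero_iff_norm, hθ, true_and]
  exact ⟨fun h => lt_of_le_of_ne h1 (Ne.symm h), fun h => h.ne'⟩

lemma isOpen_cone (hN : IsGraphGauge Γ ε N) : IsOpen {y : E n | ‖y‖ < N y} :=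
  isOpen_lt continuous_norm hN.continuous

lemma ne_zero_of_lt (hN : IsGraphGauge Γ ε N) {y : E n} (h : ‖y‖ < N y) : y ≠ 0 := by
  rintro rfl
  rw [hN.zero] at h
  simp at h

/-- Near a point of the graph the defining function is `|z| (1 - 1 / N(z))`; its second factor
vanishes there, so only its derivative survives. -/
lemma hasFDerivAt_defFn (hN : IsGraphGauge Γ ε N) (hΓ : IsKleinian Γ) {y : E n}
    (hy : y ∈ graphSet Γ ε) (hd : DifferentiableAt ℝ N y) :
    HasFDerivAt (defFn Γ ε) (‖y‖ • fderiv ℝ N y) y := by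
  obtain ⟨hy1, hNy⟩ := (hN.mem_graphSet_iff hΓ).1 hy
  have hlt : ‖y‖ < N y := by rw [hNy]; exact hy1
  have h1 : defFn Γ ε =ᶠ[nhds y] fun z => ‖z‖ - ‖z‖ * (N z)⁻¹ := by
    filter_upwards [hN.isOpen_cone.mem_nhds hlt] with z hz
    rw [defFn, hN.radialFn_eq hΓ (hN.ne_zero_of_lt hz) hz, div_eq_mul_inv]
  refine HasFDerivAt.congr_of_eventuallyEq ?_ h1
  have h2 : HasFDerivAt (fun z : E n => ‖z‖) (fderiv ℝ (fun z : E n => ‖z‖) y) y :=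
    (differentiableAt_id.norm ℝ (hN.ne_zero_of_lt hlt)).hasFDerivAt
  have h3 : HasFDerivAt (fun z => (N z)⁻¹) (-fderiv ℝ N y) y := by
    have := (hasDerivAt_inv (x := N y) (by rw [hNy]; exact one_ne_zero)).comp_hasFDerivAt y
      hd.hasFDerivAt
    refine HasFDerivAt.congr_fderiv (f := fun z => (N z)⁻¹) this ?_
    ext v
    simp [hNy]
  have h4 := h2.sub (h2.mul h3)
  rw [hNy] at h4
  refine h4.congr_fderiv ?_
  ext v
  simp

lemma gradient_defFn (hN : IsGraphGauge Γ ε N) (hΓ : IsKleinian Γ) {y : E n}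
    (hy : y ∈ graphSet Γ ε) (hd : DifferentiableAt ℝ N y) :
    gradient (defFn Γ ε) y = ‖y‖ • gradient N y := by
  rw [gradient, (hN.hasFDerivAt_defFn hΓ hy hd).fderiv, gradient]
  simp

lemma norm_gradient (f : E n → ℝ) (y : E n) : ‖gradient f y‖ = ‖fderiv ℝ f y‖ := by
  rw [gradient, LinearIsometryEquiv.norm_map]

lemma fderiv_ne_zero (hN : IsGraphGauge Γ ε N) {y : E n} (hy : y ≠ 0)
    (hd : DifferentiableAt ℝ N y) : fderiv ℝ N y ≠ 0 := by
  intro h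
  have := fderiv_gauge_self hN.smul hd
  rw [h] at this
  have h2 := hN.pos hy
  simp at this
  linarith

lemma ae_differentiableAt (hN : IsGraphGauge Γ ε N) : ∀ᵐ y, DifferentiableAt ℝ N y := by
  obtain ⟨K, hK⟩ := hN.lipschitz
  exact hK.ae_differentiableAt

lemma ae_sphere_differentiableAt (hN : IsGraphGauge Γ ε N) :
    ∀ᵐ θ : Metric.sphere (0 : E n) 1 ∂(volume : Measure (E n)).toSphere,
      DifferentiableAt ℝ N θ :=
  ae_toSphere_of_ae hN.ae_differentiableAt fun _ hr _ h => differentiableAt_gauge_smul hN.smul hr h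

lemma smul_mem_graphSet (hN : IsGraphGauge Γ ε N) (hΓ : IsKleinian Γ) {y : E n} (h : ‖y‖ < N y) :
    (N y)⁻¹ • y ∈ graphSet Γ ε := by
  have h0 := hN.pos_of_lt h
  rw [hN.mem_graphSet_iff hΓ, norm_smul, norm_inv, Real.norm_of_nonneg h0.le, inv_mul_lt_one₀ h0,
    hN.smul _ (by positivity), inv_mul_cancel₀ h0.ne']
  exact ⟨h, rfl⟩

end IsGraphGauge

/-- The `n`-th power of the conformal factor of the hyperbolic metric. -/
def hypWeight (n : ℕ) (y : E n) : ℝ := (2 / (1 - ‖y‖ ^ 2)) ^ n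

lemma measurable_hypWeight : Measurable (hypWeight n) := by
  unfold hypWeight; fun_prop

namespace IsGraphGauge

lemma area_density (hN : IsGraphGauge Γ ε N) (hΓ : IsKleinian Γ) {θ : E n} (hθ : ‖θ‖ = 1)
    (h : 1 < N θ) (hd : DifferentiableAt ℝ N θ) :
    (2 * radialFn Γ ε θ / (1 - radialFn Γ ε θ ^ 2)) ^ n *
          ‖gradient (defFn Γ ε) (radialFn Γ ε θ • θ)‖ =
      hypWeight n ((N θ)⁻¹ • θ) * (N θ)⁻¹ ^ (n + 1) * ‖fderiv ℝ N θ‖ := by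
  have hlt : ‖θ‖ < N θ := by rwa [hθ]
  have hN0 := hN.pos_of_lt hlt
  rw [hN.radialFn_eq hΓ (hN.ne_zero_of_lt hlt) hlt, hθ, one_div]
  have hd' : DifferentiableAt ℝ N ((N θ)⁻¹ • θ) := by
    apply differentiableAt_gauge_smul hN.smul hN0
    rwa [smul_smul, mul_inv_cancel₀ hN0.ne', one_smul]
  rw [hN.gradient_defFn hΓ (hN.smul_mem_graphSet hΓ hlt) hd', norm_smul, norm_gradient,
    fderiv_gauge_smul hN.smul (by positivity), hypWeight, norm_smul, hθ, mul_one, norm_norm,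
    norm_inv, Real.norm_of_nonneg hN0.le]
  rw [pow_succ, div_pow, div_pow, mul_pow]
  ring

/-- The sphere integral which represents the area of the graph. -/
lemma lintegral_ambientArea (hN : IsGraphGauge Γ ε N) (hΓ : IsKleinian Γ) {H : E n → ENNReal}
    (hH : Measurable H) :
    ∫⁻ y, H y ∂(ambientArea Γ ε) =
      ∫⁻ θ in {θ : Metric.sphere (0 : E n) 1 | 1 < N θ},
        ENNReal.ofReal (hypWeight n ((N θ)⁻¹ • (θ : E n)) * (N θ)⁻¹ ^ (n + 1) * ‖fderiv ℝ N θ‖) *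
        H ((N θ)⁻¹ • (θ : E n)) ∂(volume : Measure (E n)).toSphere := by
  have hr := hN.measurable_radialFn hΓ
  have hr' : Measurable (fun θ : Metric.sphere (0 : E n) 1 => radialFn Γ ε (θ : E n)) :=
    hr.comp measurable_subtype_coe
  have hm : Measurable (fun θ : Metric.sphere (0 : E n) 1 => radialFn Γ ε (θ : E n) • (θ : E n)) :=
    hr'.smul measurable_subtype_coe
  have hg : Measurable (gradient (defFn Γ ε)) :=
    (LinearIsometryEquiv.continuous _).measurable.comp (measurable_fderiv ℝ _)
  have hset : {θ : Metric.sphere (0 : E n) 1 | (θ : E n) ∈ domainOfDiscontinuity Γ} =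
      {θ : Metric.sphere (0 : E n) 1 | 1 < N θ} := by
    ext θ
    exact hN.mem_domain_iff (by simp)
  have hms : MeasurableSet {θ : Metric.sphere (0 : E n) 1 | 1 < N θ} :=
    measurableSet_lt measurable_const (hN.continuous.measurable.comp measurable_subtype_coe)
  have hmd : Measurable (fun θ : Metric.sphere (0 : E n) 1 => ENNReal.ofReal
        ((2 * radialFn Γ ε (θ : E n) / (1 - radialFn Γ ε (θ : E n) ^ 2)) ^ n *
          ‖gradient (defFn Γ ε) (radialFn Γ ε (θ : E n) • (θ : E n))‖)) := by
    have := (hg.comp hm).norm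
    simp only [Function.comp_def] at this
    fun_prop
  rw [ambientArea, lintegral_map hH hm, lintegral_withDensity_eq_lintegral_mul _ hmd
    (show Measurable fun θ : Metric.sphere (0 : E n) 1 => H (radialFn Γ ε (θ : E n) • (θ : E n))
      from hH.comp hm), hset]
  refine lintegral_congr_ae ?_
  filter_upwards [ae_restrict_of_ae hN.ae_sphere_differentiableAt, ae_restrict_mem hms] with θ hd h1
  have h1 : 1 < N θ := h1
  have hθ : ‖(θ : E n)‖ = 1 := by simp
  have hlt : ‖(θ : E n)‖ < N θ := by rwa [hθ]
  simp only [Pi.mul_apply]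
  rw [hN.area_density hΓ hθ h1 hd, hN.radialFn_eq hΓ (hN.ne_zero_of_lt hlt) hlt, hθ, one_div]

lemma lintegral_area (hN : IsGraphGauge Γ ε N) (hΓ : IsKleinian Γ) {H : E n → ENNReal}
    (hH : Measurable H) :
    ∫⁻ z : CBall n, H z ∂(area Γ ε) = ∫⁻ y, H y ∂(ambientArea Γ ε) := by
  rw [area, lintegral_subtype_comap Metric.isClosed_closedBall.measurableSet H,
    ← lintegral_indicator Metric.isClosed_closedBall.measurableSet,
    hN.lintegral_ambientArea hΓ (hH.indicator Metric.isClosed_closedBall.measurableSet),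
    hN.lintegral_ambientArea hΓ hH]
  have hms : MeasurableSet {θ : Metric.sphere (0 : E n) 1 | 1 < N θ} :=
    measurableSet_lt measurable_const (hN.continuous.measurable.comp measurable_subtype_coe)
  refine setLIntegral_congr_fun hms fun θ h1 => ?_
  have h1 : 1 < N θ := h1
  have hlt : ‖(θ : E n)‖ < N θ := by
    rwa [show ‖(θ : E n)‖ = 1 by simp]
  rw [Set.indicator_of_mem]
  have := ((hN.mem_graphSet_iff hΓ).1 (hN.smul_mem_graphSet hΓ hlt)).1
  rw [mem_closedBall_zero_iff]
  exact this.le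

/-- The solid integral which represents the area of the graph. -/
lemma lintegral_area_cone (hN : IsGraphGauge Γ ε N) (hΓ : IsKleinian Γ) {H : E n → ENNReal}
    (hH : Measurable H) :
    ∫⁻ z : CBall n, H z ∂(area Γ ε) = ENNReal.ofReal (n + 1) *
      ∫⁻ y in {y : E n | ‖y‖ < N y ∧ N y < 1},
        ENNReal.ofReal (hypWeight n ((N y)⁻¹ • y) * ‖fderiv ℝ N y‖) * H ((N y)⁻¹ • y) := by
  have hNm := hN.continuous.measurable
  have hw : Measurable (hypWeight n) := measurable_hypWeight
  have hfd : Measurable (fderiv ℝ N) := measurable_fderiv ℝ N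
  have hms : MeasurableSet {y : E n | ‖y‖ < N y ∧ N y < 1} :=
    (measurableSet_lt measurable_norm hNm).inter (measurableSet_lt hNm measurable_const)
  have hG : Measurable (fun y : E n =>
      ENNReal.ofReal (hypWeight n ((N y)⁻¹ • y) * ‖fderiv ℝ N y‖) * H ((N y)⁻¹ • y)) := by
    have h1 : Measurable (fun y : E n => (N y)⁻¹ • y) := by fun_prop
    have h2 := hH.comp h1
    have h3 := hw.comp h1
    simp only [Function.comp_def] at h2 h3
    fun_prop
  have hms' : MeasurableSet {θ : Metric.sphere (0 : E n) 1 | 1 < N θ} :=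
    measurableSet_lt measurable_const (hNm.comp measurable_subtype_coe)
  rw [hN.lintegral_area hΓ hH, hN.lintegral_ambientArea hΓ hH, ← lintegral_indicator hms,
    lintegral_polar _ (hG.indicator hms), ← lintegral_const_mul' _ _ ENNReal.ofReal_ne_top,
    ← lintegral_indicator hms']
  refine lintegral_congr fun θ => ?_
  have hθ : ‖(θ : E n)‖ = 1 := by simp
  have hN0 := gauge_pos hN.norm_le hθ
  by_cases h1 : 1 < N θ
  · rw [Set.indicator_of_mem (by exact h1)]
    set c := ENNReal.ofReal (hypWeight n ((N θ)⁻¹ • (θ : E n)) * ‖fderiv ℝ N θ‖) *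
      H ((N θ)⁻¹ • (θ : E n)) with hc
    have h2 : ∫⁻ r in Set.Ioi (0 : ℝ), ENNReal.ofReal (r ^ n) *
        Set.indicator {y : E n | ‖y‖ < N y ∧ N y < 1} (fun y : E n =>
        ENNReal.ofReal (hypWeight n ((N y)⁻¹ • y) * ‖fderiv ℝ N y‖) * H ((N y)⁻¹ • y))
        (r • (θ : E n)) = ∫⁻ r in Set.Ioi (0 : ℝ),
          Set.indicator (Set.Iio (N θ)⁻¹) (fun r => ENNReal.ofReal (r ^ n) * c) r := by
      refine setLIntegral_congr_fun measurableSet_Ioi fun r hr => ?_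
      have hr : 0 < r := hr
      have hdir : (N (r • (θ : E n)))⁻¹ • (r • (θ : E n)) = (N θ)⁻¹ • (θ : E n) := by
        rw [hN.smul r hr.le, smul_smul, mul_inv, mul_assoc, mul_comm _ r, ← mul_assoc,
          inv_mul_cancel₀ hr.ne', one_mul]
      by_cases hrN : r < (N θ)⁻¹
      · rw [Set.indicator_of_mem, Set.indicator_of_mem (by exact hrN), hdir,
          fderiv_gauge_smul hN.smul hr]
        refine ⟨?_, ?_⟩
        · rw [hN.smul r hr.le, norm_smul, hθ, Real.norm_of_nonneg hr.le]
          nlinarith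
        · rw [hN.smul r hr.le, ← lt_inv_mul_iff₀' hN0]
          simpa using hrN
      · rw [Set.indicator_of_notMem, Set.indicator_of_notMem (by exact hrN), mul_zero]
        rintro ⟨-, h⟩
        apply hrN
        rw [hN.smul r hr.le, ← lt_inv_mul_iff₀' hN0] at h
        simpa using h
    -- The radial integral of `r^n` over `(0, 1 / N(θ))` is `N(θ)^(-(n + 1)) / (n + 1)`, which
    -- accounts for the power of `N` in the area and the factor `n + 1`.
    rw [h2, lintegral_indicator measurableSet_Iio, Measure.restrict_restrict measurableSet_Iio,
      Set.inter_comm, Set.Ioi_inter_Iio, lintegral_mul_const _ (by fun_prop),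
      ← ofReal_integral_eq_lintegral_ofReal, ← integral_Ioc_eq_integral_Ioo,
      ← intervalIntegral.integral_of_le (by positivity), integral_pow,
      zero_pow (Nat.succ_ne_zero n), sub_zero]
    · rw [hc, ← mul_assoc, ← ENNReal.ofReal_mul (by positivity), ← mul_assoc,
        ← ENNReal.ofReal_mul (by positivity)]
      congr 2
      field_simp
    · exact ((continuous_pow n).integrableOn_Ioc).mono_set Set.Ioo_subset_Ioc_self
    · filter_upwards [ae_restrict_mem measurableSet_Ioo] with r hr
      exact pow_nonneg hr.1.le n
  · rw [Set.indicator_of_notMem (by exact h1), eq_comm, mul_eq_zero]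
    right
    rw [setLIntegral_congr_fun measurableSet_Ioi (g := fun _ => 0), lintegral_zero]
    intro r hr
    have hr : 0 < r := hr
    beta_reduce
    rw [Set.indicator_of_notMem, mul_zero]
    rintro ⟨h, -⟩
    rw [hN.smul r hr.le, norm_smul, hθ, Real.norm_of_nonneg hr.le] at h
    exact h1 (lt_of_mul_lt_mul_left h hr.le)

end IsGraphGauge

/-! ### Invariance of the area -/

lemma addHaar_image_eq_zero_of_lipschitzOnWith {f : E n → E n} {K : NNReal} {s : Set (E n)}
    (hf : LipschitzOnWith K f s) (hs : volume s = 0) : volume (f '' s) = 0 := by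
  have h1 := hf.hausdorffMeasure_image_le (d := (Module.finrank ℝ (E n) : ℝ)) (by positivity)
  have h2 : (volume : Measure (E n)) ≪ Measure.hausdorffMeasure (Module.finrank ℝ (E n) : ℝ) :=
    Measure.absolutelyContinuous_isAddHaarMeasure _ _
  have h3 : Measure.hausdorffMeasure (Module.finrank ℝ (E n) : ℝ) ≪ (volume : Measure (E n)) :=
    Measure.absolutelyContinuous_isAddHaarMeasure _ _
  apply h2
  rw [h3 hs, mul_zero] at h1
  exact le_antisymm h1 zero_le

/-- The radial extension of the action of an isometry on the graph. -/
def coneMap (N : E n → ℝ) (γ : Equiv.Perm (CBall n)) (y : E n) : E n :=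
  N y • ballExt γ ((N y)⁻¹ • y)

lemma IsBallIsometry.exists_lipschitz {γ : Equiv.Perm (CBall n)} (h : IsBallIsometry γ) :
    ∃ C : ℝ, 0 ≤ C ∧ ∀ x y : CBall n, ‖(γ x : E n) - γ y‖ ≤ C * ‖(x : E n) - y‖ := by
  have : CompactSpace (CBall n) := isCompact_iff_compactSpace.1 (isCompact_closedBall (0 : E n) 1)
  obtain ⟨C, hC⟩ := isCompact_univ.exists_bound_of_continuousOn h.continuous_confFactor.continuousOn
  have hC' : ∀ z : CBall n, confFactor γ z ≤ C := fun z =>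
    (le_abs_self _).trans (hC z (Set.mem_univ _))
  have hC0 : 0 ≤ C := (h.confFactor_pos (cball_norm_le cOrigin)).le.trans (hC' cOrigin)
  refine ⟨C, hC0, fun x y => ?_⟩
  apply le_of_sq_le_sq _ (by positivity)
  rw [h.norm_sub_sq, mul_pow, sq C]
  have h1 := (h.confFactor_pos (cball_norm_le x)).le
  have h2 := (h.confFactor_pos (cball_norm_le y)).le
  exact mul_le_mul_of_nonneg_right (mul_le_mul (hC' x) (hC' y) h2 hC0) (sq_nonneg _)

lemma measurable_ballExt {γ : Equiv.Perm (CBall n)} (h : IsBallIsometry γ) :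
    Measurable (ballExt γ) := by
  have h1 : ContinuousOn (ballExt γ) (Metric.closedBall (0 : E n) 1) := by
    rw [continuousOn_iff_continuous_domRestrict]
    have : (Metric.closedBall (0 : E n) 1).domRestrict (ballExt γ) = fun z : CBall n => (γ z : E n) := by
      funext z
      exact ballExt_coe γ z
    rw [this]
    exact continuous_subtype_val.comp h.cont
  classical
  have h2 : ballExt γ = (Metric.closedBall (0 : E n) 1).piecewise (ballExt γ) (fun _ => 0) := by
    funext z
    by_cases hz : z ∈ Metric.closedBall (0 : E n) 1
    · rw [Set.piecewise_eq_of_mem _ _ _ hz]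
    · rw [Set.piecewise_eq_of_notMem _ _ _ hz, ballExt, dif_neg (by simpa using hz)]
  rw [h2]
  exact h1.measurable_piecewise continuousOn_const Metric.isClosed_closedBall.measurableSet

namespace IsGraphGauge

variable {γ : Equiv.Perm (CBall n)}

lemma map_mem_graphSet (hN : IsGraphGauge Γ ε N) (hΓ : IsKleinian Γ) (hγ : γ ∈ Γ) {z : CBall n}
    (hz : (z : E n) ∈ graphSet Γ ε) : (γ z : E n) ∈ graphSet Γ ε := by
  obtain ⟨h1, h2⟩ := (hN.mem_graphSet_iff hΓ).1 hz
  have hI := hΓ.isBallIsometry hγ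
  have h3 := hI.maps z h1
  rw [hN.mem_graphSet_iff hΓ]
  refine ⟨h3, le_antisymm ?_ ?_⟩
  · by_contra hcon
    have := (map_mem_domeUnion_iff hγ).1 ((hN.mem_iff _ h3).2 (not_le.1 hcon))
    rw [hN.mem_iff _ h1] at this
    linarith
  · have hc : z ∈ closure {w : CBall n | (w : E n) ∈ domeUnion Γ ε} := by
      rw [Topology.IsInducing.subtypeVal.closure_eq_preimage_closure_image]
      have : Subtype.val '' {w : CBall n | (w : E n) ∈ domeUnion Γ ε} = domeUnion Γ ε := by
        ext w
        constructor
        · rintro ⟨w, hw, rfl⟩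
          exact hw
        · intro hw
          have := norm_lt_one_of_mem_domeUnion hΓ hw
          exact ⟨⟨w, by simpa using this.le⟩, hw, rfl⟩
      rw [Set.mem_preimage, this]
      exact hN.mem_closure_domeUnion h1 h2
    have hcl : IsClosed {w : CBall n | 1 ≤ N (γ w : E n)} :=
      isClosed_le continuous_const (hN.continuous.comp (continuous_subtype_val.comp hI.cont))
    refine closure_minimal (fun w hw => ?_) hcl hc
    have hw : (w : E n) ∈ domeUnion Γ ε := hw
    have h4 := map_mem_domeUnion hγ hw
    exact ((hN.mem_iff _ (norm_lt_one_of_mem_domeUnion hΓ h4)).1 h4).le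

lemma ballExt_mem_graphSet (hN : IsGraphGauge Γ ε N) (hΓ : IsKleinian Γ) (hγ : γ ∈ Γ) {y : E n}
    (hy : y ∈ graphSet Γ ε) : ballExt γ y ∈ graphSet Γ ε := by
  have h1 := ((hN.mem_graphSet_iff hΓ).1 hy).1
  have := hN.map_mem_graphSet hΓ hγ (z := ⟨y, by simpa using h1.le⟩) hy
  rwa [ballExt, dif_pos h1.le]

lemma ballExt_inv_ballExt {y : E n} (hy : ‖y‖ ≤ 1) : ballExt γ⁻¹ (ballExt γ y) = y := by
  have h1 : ballExt γ y = (γ ⟨y, by simpa using hy⟩ : E n) := by rw [ballExt, dif_pos hy]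
  rw [h1, ballExt_coe, show γ⁻¹ (γ ⟨y, by simpa using hy⟩) = ⟨y, by simpa using hy⟩ from
    γ.symm_apply_apply _]

lemma gauge_coneMap (hN : IsGraphGauge Γ ε N) (hΓ : IsKleinian Γ) (hγ : γ ∈ Γ) {y : E n}
    (hy : ‖y‖ < N y) : N (coneMap N γ y) = N y := by
  have h1 := hN.ballExt_mem_graphSet hΓ hγ (hN.smul_mem_graphSet hΓ hy)
  rw [coneMap, hN.smul _ (hN.pos_of_lt hy).le, ((hN.mem_graphSet_iff hΓ).1 h1).2, mul_one]

lemma norm_coneMap_lt (hN : IsGraphGauge Γ ε N) (hΓ : IsKleinian Γ) (hγ : γ ∈ Γ) {y : E n}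
    (hy : ‖y‖ < N y) : ‖coneMap N γ y‖ < N (coneMap N γ y) := by
  have h1 := hN.ballExt_mem_graphSet hΓ hγ (hN.smul_mem_graphSet hΓ hy)
  have h0 := hN.pos_of_lt hy
  rw [hN.gauge_coneMap hΓ hγ hy, coneMap, norm_smul, Real.norm_of_nonneg h0.le]
  have := ((hN.mem_graphSet_iff hΓ).1 h1).1
  nlinarith

lemma inv_smul_coneMap (hN : IsGraphGauge Γ ε N) (hΓ : IsKleinian Γ) (hγ : γ ∈ Γ) {y : E n}
    (hy : ‖y‖ < N y) :
    (N (coneMap N γ y))⁻¹ • coneMap N γ y = ballExt γ ((N y)⁻¹ • y) := by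
  rw [hN.gauge_coneMap hΓ hγ hy, coneMap, smul_smul, inv_mul_cancel₀ (hN.pos_of_lt hy).ne',
    one_smul]

lemma coneMap_inv (hN : IsGraphGauge Γ ε N) (hΓ : IsKleinian Γ) (hγ : γ ∈ Γ) {y : E n}
    (hy : ‖y‖ < N y) : coneMap N γ⁻¹ (coneMap N γ y) = y := by
  have h1 := ((hN.mem_graphSet_iff hΓ).1 (hN.smul_mem_graphSet hΓ hy)).1.le
  rw [coneMap, hN.inv_smul_coneMap hΓ hγ hy, hN.gauge_coneMap hΓ hγ hy,
    ballExt_inv_ballExt h1, smul_smul, mul_inv_cancel₀ (hN.pos_of_lt hy).ne', one_smul]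

lemma exists_lipschitzOnWith_coneMap (hN : IsGraphGauge Γ ε N) (h : IsBallIsometry γ) :
    ∃ K, LipschitzOnWith K (coneMap N γ) {0}ᶜ := by
  obtain ⟨C, hC0, hC⟩ := h.exists_lipschitz
  obtain ⟨K, hK⟩ := hN.lipschitz
  have hK' : ∀ y z, |N y - N z| ≤ K * ‖y - z‖ := by
    intro y z
    have := hK.dist_le_mul y z
    rwa [Real.dist_eq, dist_eq_norm] at this
  refine ⟨Real.toNNReal (K + C * (1 + K)), LipschitzOnWith.of_dist_le_mul fun y hy z hz => ?_⟩
  rw [Real.coe_toNNReal _ (by positivity), dist_eq_norm, dist_eq_norm]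
  have hy0 : y ≠ 0 := hy
  have hz0 : z ≠ 0 := hz
  have hNy := hN.pos hy0
  have hNz := hN.pos hz0
  have hn : ∀ w : E n, w ≠ 0 → ‖(N w)⁻¹ • w‖ ≤ 1 := by
    intro w hw
    rw [norm_smul, norm_inv, Real.norm_of_nonneg (hN.pos hw).le, inv_mul_le_one₀ (hN.pos hw)]
    exact hN.norm_le w
  have e1 : ballExt γ ((N y)⁻¹ • y) = (γ ⟨(N y)⁻¹ • y, by simpa using hn y hy0⟩ : E n) := by
    rw [ballExt, dif_pos (hn y hy0)]
  have e2 : ballExt γ ((N z)⁻¹ • z) = (γ ⟨(N z)⁻¹ • z, by simpa using hn z hz0⟩ : E n) := by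
    rw [ballExt, dif_pos (hn z hz0)]
  have h1 : coneMap N γ y - coneMap N γ z = (N y - N z) • ballExt γ ((N y)⁻¹ • y) +
      N z • (ballExt γ ((N y)⁻¹ • y) - ballExt γ ((N z)⁻¹ • z)) := by
    simp only [coneMap, sub_smul, smul_sub]
    abel
  have h2 : ‖ballExt γ ((N y)⁻¹ • y)‖ ≤ 1 := by
    rw [e1]; exact cball_norm_le _
  have h3 : N z * ‖(N y)⁻¹ • y - (N z)⁻¹ • z‖ ≤ (1 + K) * ‖y - z‖ := by
    have h4 : N z • ((N y)⁻¹ • y - (N z)⁻¹ • z) = (y - z) + (N z - N y) • ((N y)⁻¹ • y) := by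
      rw [smul_sub, smul_smul, smul_smul, mul_inv_cancel₀ hNz.ne', one_smul, smul_smul, sub_mul,
        sub_smul, mul_inv_cancel₀ hNy.ne', one_smul]
      abel
    have h5 : N z * ‖(N y)⁻¹ • y - (N z)⁻¹ • z‖ = ‖N z • ((N y)⁻¹ • y - (N z)⁻¹ • z)‖ := by
      rw [norm_smul, Real.norm_of_nonneg hNz.le]
    rw [h5, h4]
    refine (norm_add_le _ _).trans ?_
    rw [norm_smul, Real.norm_eq_abs, abs_sub_comm]
    have := mul_le_mul (hK' y z) (hn y hy0) (norm_nonneg _) (by positivity)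
    linarith
  rw [h1]
  refine (norm_add_le _ _).trans ?_
  rw [norm_smul, norm_smul, Real.norm_eq_abs, Real.norm_of_nonneg hNz.le]
  have h6 : |N y - N z| * ‖ballExt γ ((N y)⁻¹ • y)‖ ≤ K * ‖y - z‖ * 1 :=
    mul_le_mul (hK' y z) h2 (norm_nonneg _) (by positivity)
  have h7 : ‖ballExt γ ((N y)⁻¹ • y) - ballExt γ ((N z)⁻¹ • z)‖ ≤
      C * ‖(N y)⁻¹ • y - (N z)⁻¹ • z‖ := by
    rw [e1, e2]
    exact hC _ _
  have h8 := mul_le_mul_of_nonneg_left h7 hNz.le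
  have h9 := mul_le_mul_of_nonneg_left h3 hC0
  linarith

/-- The differential of the gauge is equivariant up to a positive factor. -/
lemma exists_fderiv_map (hN : IsGraphGauge Γ ε N) (hΓ : IsKleinian Γ) (hγ : γ ∈ Γ) {y : E n}
    (hy : y ∈ graphSet Γ ε) (hd : DifferentiableAt ℝ N y)
    (hd' : DifferentiableAt ℝ N (ballExt γ y)) {A : E n →L[ℝ] E n}
    (hA : HasFDerivAt (ballExt γ) A y) (hAs : Function.Surjective A) :
    ∃ c : ℝ, 0 < c ∧ ∀ v, fderiv ℝ N (ballExt γ y) (A v) = c * fderiv ℝ N y v := by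
  obtain ⟨hy1, hNy⟩ := (hN.mem_graphSet_iff hΓ).1 hy
  obtain ⟨hy1', hNy'⟩ := (hN.mem_graphSet_iff hΓ).1 (hN.ballExt_mem_graphSet hΓ hγ hy)
  set a := fderiv ℝ N y with ha
  set b := (fderiv ℝ N (ballExt γ y)).comp A with hb
  have hcomp : HasFDerivAt (fun z => N (ballExt γ z)) b y := hd'.hasFDerivAt.comp y hA
  have hay : a y = 1 := by rw [ha, fderiv_gauge_self hN.smul hd, hNy]
  -- A direction in which `N` increases at `y` leads into the union of half spaces, which `γ`
  -- preserves; so `N ∘ γ` cannot decrease in that direction.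
  have hpos : ∀ w, 0 < a w → 0 ≤ b w := by
    intro w hw
    have h1 := (hd.hasFDerivAt.hasLineDerivAt w).tendsto_slope_zero_right
    have h2 := (hcomp.hasLineDerivAt w).tendsto_slope_zero_right
    refine ge_of_tendsto h2 ?_
    have h3 : ∀ᶠ t : ℝ in nhdsWithin 0 (Set.Ioi 0), ‖y + t • w‖ < 1 := by
      refine nhdsWithin_le_nhds ?_
      have : ContinuousAt (fun t : ℝ => ‖y + t • w‖) 0 := by fun_prop
      exact this.eventually_lt continuousAt_const (by simpa using hy1)
    filter_upwards [h1.eventually (lt_mem_nhds hw), h3, self_mem_nhdsWithin] with t ht ht1 ht0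
    have ht0 : 0 < t := ht0
    rw [smul_eq_mul, hNy] at ht
    have h4 : 1 < N (y + t • w) := by
      have := pos_of_mul_pos_right ht (by positivity)
      linarith
    have h5 := (hN.mem_iff _ ht1).2 h4
    have h6 := map_mem_domeUnion hγ (z := ⟨y + t • w, by simpa using ht1.le⟩) h5
    rw [hN.mem_iff _ (norm_lt_one_of_mem_domeUnion hΓ h6)] at h6
    have h7 : ballExt γ (y + t • w) = (γ ⟨y + t • w, by simpa using ht1.le⟩ : E n) := by
      rw [ballExt, dif_pos ht1.le]
    rw [smul_eq_mul, h7, hNy']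
    have : 0 < t⁻¹ := by positivity
    nlinarith
  -- A vector in the kernel of `a` is the limit of `w + τ y` as `τ` decreases to 0, and `a` is
  -- positive on these; apply this to both `w` and `-w`.
  have hker : ∀ w, a w = 0 → b w = 0 := by
    have h1 : ∀ w, a w = 0 → 0 ≤ b w := by
      intro w hw
      have h2 : ∀ τ : ℝ, 0 < τ → 0 ≤ b w + τ * b y := by
        intro τ hτ
        have := hpos (w + τ • y) (by rw [map_add, map_smul, hw, hay]; simpa using hτ)
        rwa [map_add, map_smul, smul_eq_mul] at this
      by_contra hcon
      push Not at hcon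
      have hby := hpos y (by rw [hay]; exact one_pos)
      have h3 := h2 (-b w / (2 * (b y + 1))) (div_pos (by linarith) (by linarith))
      have h4 : -b w / (2 * (b y + 1)) * b y ≤ -b w / 2 := by
        rw [div_mul_eq_mul_div, div_le_div_iff₀ (by linarith) two_pos]
        nlinarith
      linarith
    intro w hw
    apply le_antisymm _ (h1 w hw)
    have := h1 (-w) (by rw [map_neg, hw, neg_zero])
    rw [map_neg] at this
    linarith
  have hprop : ∀ v, b v = b y * a v := by
    intro v
    have := hker (v - a v • y) (by rw [map_sub, map_smul, hay]; simp)
    rw [map_sub, map_smul, smul_eq_mul] at this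
    linarith
  refine ⟨b y, ?_, fun v => hprop v⟩
  have h0 := hpos y (by rw [hay]; exact one_pos)
  -- The factor cannot be 0: by surjectivity some `v` is mapped to the radial vector at `γ y`, on
  -- which the differential of `N` is 1.
  rcases h0.eq_or_lt with h | h
  · exfalso
    obtain ⟨v, hv⟩ := hAs (ballExt γ y)
    have h1 := hprop v
    rw [← h, zero_mul] at h1
    have h2 : b v = 1 := by
      change fderiv ℝ N (ballExt γ y) (A v) = 1
      rw [hv, fderiv_gauge_self hN.smul hd', hNy']
    linarith
  · exact h

end IsGraphGauge

end Graph

/-! ### Change of variables on the cone over the graph -/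

section AreaInvariance

variable {Γ : Subgroup (Equiv.Perm (CBall n))} {ε : ℝ} {N : E n → ℝ}

/-- The rank one update factors as `M` after the transvection along `M⁻¹ u`. -/
lemma det_add_smulRight (M : E n ≃L[ℝ] E n) (f : E n →L[ℝ] ℝ) (u : E n) :
    ((M : E n →L[ℝ] E n) + f.smulRight u).det =
      (M : E n →L[ℝ] E n).det * (1 + f (M.symm u)) := by
  have h1 : (((M : E n →L[ℝ] E n) + f.smulRight u : E n →L[ℝ] E n) : E n →ₗ[ℝ] E n) =
      ((M : E n →L[ℝ] E n) : E n →ₗ[ℝ] E n) ∘ₗ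
        LinearMap.transvection (f : E n →ₗ[ℝ] ℝ) (M.symm u) := by
    ext v
    simp [LinearMap.transvection]
  rw [ContinuousLinearMap.det, h1, LinearMap.det_comp, LinearMap.transvection.det]
  rfl

lemma abs_det_smul_isometry (A : E n ≃ₗᵢ[ℝ] E n) {c : ℝ} (hc : 0 < c) :
    |(c • (A.toContinuousLinearEquiv : E n →L[ℝ] E n)).det| = c ^ (n + 1) := by
  have h1 : |LinearMap.det (A.toLinearEquiv : E n →ₗ[ℝ] E n)| = 1 := by
    have := LinearMap.normDet_eq_abs_det (A.toLinearEquiv : E n →ₗ[ℝ] E n)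
    rw [← this]
    exact A.toLinearIsometry.normDet_eq_one
  have h2 : ((c • (A.toContinuousLinearEquiv : E n →L[ℝ] E n) : E n →L[ℝ] E n) : E n →ₗ[ℝ] E n) =
      c • (A.toLinearEquiv : E n →ₗ[ℝ] E n) := rfl
  rw [ContinuousLinearMap.det, h2, LinearMap.det_smul, abs_mul, h1, mul_one, abs_pow, abs_of_pos hc]
  simp

lemma norm_eq_of_map_isometry {a b : E n →L[ℝ] ℝ} (A : E n ≃ₗᵢ[ℝ] E n) {k c : ℝ} (hk : 0 < k)
    (hc : 0 < c) (h : ∀ v, b (k • A v) = c * a v) : k * ‖b‖ = c * ‖a‖ := by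
  have h1 : k • (b.comp (A.toContinuousLinearEquiv : E n →L[ℝ] E n)) = c • a := by
    ext v
    have := h v
    rw [map_smul] at this
    simpa using this
  have h2 : ‖b.comp (A.toContinuousLinearEquiv : E n →L[ℝ] E n)‖ = ‖b‖ :=
    ContinuousLinearMap.opNorm_comp_linearIsometryEquiv b A
  rw [← h2, ← Real.norm_of_nonneg hk.le, ← norm_smul, h1, norm_smul, Real.norm_of_nonneg hc.le]

namespace IsGraphGauge

variable {γ : Equiv.Perm (CBall n)}

lemma hypWeight_map (hI : IsBallIsometry γ) {y : E n} (hy : ‖y‖ < 1) :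
    hypWeight n (ballExt γ y) * confFactor γ y ^ n = hypWeight n y := by
  have h1 := hI.one_sub_sq_map ⟨y, by simpa using hy.le⟩
  have h2 : ballExt γ y = (γ ⟨y, by simpa using hy.le⟩ : E n) := by rw [ballExt, dif_pos hy.le]
  have h3 := hI.confFactor_pos hy.le
  have h4 := one_sub_sq_pos hy
  rw [hypWeight, hypWeight, h2, h1, ← mul_pow]
  congr 1
  field_simp

lemma hasFDerivAt_coneMap (hN : IsGraphGauge Γ ε N) {y : E n} (hy : ‖y‖ < N y)
    (hd : DifferentiableAt ℝ N y) {M : E n →L[ℝ] E n}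
    (hM : HasFDerivAt (ballExt γ) M ((N y)⁻¹ • y)) :
    HasFDerivAt (coneMap N γ) (M + (fderiv ℝ N y).smulRight
      (ballExt γ ((N y)⁻¹ • y) - M ((N y)⁻¹ • y))) y := by
  have hN0 := hN.pos_of_lt hy
  have h1 : HasFDerivAt (fun z => (N z)⁻¹) ((-(N y ^ 2)⁻¹) • fderiv ℝ N y) y :=
    (hasDerivAt_inv hN0.ne').comp_hasFDerivAt y hd.hasFDerivAt
  have h2 : HasFDerivAt (fun z => (N z)⁻¹ • z) _ y := h1.smul (hasFDerivAt_id y)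
  have h2' : HasFDerivAt (fun z => ballExt γ ((N z)⁻¹ • z)) _ y :=
    HasFDerivAt.comp (f := fun z => (N z)⁻¹ • z) y hM h2
  have h3 := hd.hasFDerivAt.smul h2'
  refine HasFDerivAt.congr_fderiv (f := coneMap N γ) h3 ?_
  ext v : 1
  simp only [add_apply, smul_apply,
    ContinuousLinearMap.comp_apply, ContinuousLinearMap.smulRight_apply, map_add, map_smul,
    smul_add, smul_sub, ContinuousLinearMap.id_apply, smul_smul,
    smul_eq_mul, mul_inv_cancel₀ hN0.ne', one_smul, add_assoc]
  have : N y * (-(N y ^ 2)⁻¹ * fderiv ℝ N y v) = - (fderiv ℝ N y v * (N y)⁻¹) := by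
    field_simp
  rw [this, neg_smul]
  abel

/-- With `y₀ = y / N(y)`, let `M = k A` be the derivative of `γ` at `y₀`, `A` orthogonal, and let
`dN ∘ M = c dN` relate the differentials at `γ y₀` and `y₀`. The cone map has derivative `M` plus a
rank one term, with determinant `± k^(n + 1) / c`, since `dN(y₀) = 1` and `dN(M⁻¹ γ y₀) = 1 / c`.
The norms of `dN` contribute `c / k` and the hyperbolic weights `k^(-n)`, and everything cancels. -/
lemma jacobian_coneMap (hN : IsGraphGauge Γ ε N) (hΓ : IsKleinian Γ) (hγ : γ ∈ Γ) {y : E n}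
    (hy : ‖y‖ < N y) (hd : DifferentiableAt ℝ N y) (hd' : DifferentiableAt ℝ N (coneMap N γ y)) :
    DifferentiableAt ℝ (coneMap N γ) y ∧ |(fderiv ℝ (coneMap N γ) y).det| *
      (hypWeight n ((N (coneMap N γ y))⁻¹ • coneMap N γ y) * ‖fderiv ℝ N (coneMap N γ y)‖) =
      hypWeight n ((N y)⁻¹ • y) * ‖fderiv ℝ N y‖ := by
  have hI := hΓ.isBallIsometry hγ
  have hN0 := hN.pos_of_lt hy
  have hg := hN.smul_mem_graphSet hΓ hy
  rw [hN.inv_smul_coneMap hΓ hγ hy]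
  obtain ⟨hy01, hNy0⟩ := (hN.mem_graphSet_iff hΓ).1 hg
  have hg' := hN.ballExt_mem_graphSet hΓ hγ hg
  have hd0 : DifferentiableAt ℝ N ((N y)⁻¹ • y) := by
    apply differentiableAt_gauge_smul hN.smul hN0
    rwa [smul_smul, mul_inv_cancel₀ hN0.ne', one_smul]
  have hfd0 : fderiv ℝ N y = fderiv ℝ N ((N y)⁻¹ • y) := by
    rw [fderiv_gauge_smul hN.smul (by positivity)]
  have hd1 : DifferentiableAt ℝ N (ballExt γ ((N y)⁻¹ • y)) :=
    differentiableAt_gauge_smul hN.smul hN0 hd'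
  have hfd1 : fderiv ℝ N (coneMap N γ y) = fderiv ℝ N (ballExt γ ((N y)⁻¹ • y)) := by
    rw [coneMap, fderiv_gauge_smul hN.smul hN0]
  obtain ⟨A, hA⟩ := hI.exists_hasFDerivAt hy01
  have hD := hN.hasFDerivAt_coneMap hy hd hA
  refine ⟨hD.differentiableAt, ?_⟩
  rw [hD.fderiv, hfd1, hfd0]
  have hNy1 := ((hN.mem_graphSet_iff hΓ).1 hg').2
  have hw := hypWeight_map hI hy01
  set y0 := (N y)⁻¹ • y with hy0
  set k := confFactor γ y0 with hk
  have hk0 : 0 < k := hI.confFactor_pos hy01.le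
  let M : E n ≃L[ℝ] E n := (ContinuousLinearEquiv.smulLeft (Units.mk0 k hk0.ne')).trans
    A.toContinuousLinearEquiv
  have hM : (M : E n →L[ℝ] E n) = k • (A.toContinuousLinearEquiv : E n →L[ℝ] E n) := by
    ext v : 1
    change A (k • v) = k • A v
    rw [map_smul]
  have hsurj : Function.Surjective (k • (A.toContinuousLinearEquiv : E n →L[ℝ] E n)) := by
    rw [← hM]
    exact M.surjective
  obtain ⟨c, hc, hcv⟩ := hN.exists_fderiv_map hΓ hγ hg hd0 hd1 hA hsurj
  have hcv' : ∀ v, fderiv ℝ N (ballExt γ y0) (M v) = c * fderiv ℝ N y0 v := by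
    intro v
    rw [← hcv v, ← hM]
    rfl
  have h1 : c * fderiv ℝ N y0 (M.symm (ballExt γ y0)) = 1 := by
    rw [← hcv', M.apply_symm_apply, fderiv_gauge_self hN.smul hd1, hNy1]
  have h2 : 1 + fderiv ℝ N y0 (M.symm (ballExt γ y0 - M y0)) = c⁻¹ := by
    rw [map_sub, M.symm_apply_apply, map_sub, fderiv_gauge_self hN.smul hd0, hNy0]
    field_simp
    linarith
  have h3 := norm_eq_of_map_isometry A hk0 hc hcv
  have h4 : |(M : E n →L[ℝ] E n).det| = k ^ (n + 1) := by
    rw [hM]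
    exact abs_det_smul_isometry A hk0
  have h5 : (k • (A.toContinuousLinearEquiv : E n →L[ℝ] E n)) y0 = M y0 := by rw [← hM]; rfl
  rw [h5, ← hM, det_add_smulRight, h2, abs_mul, h4, abs_of_pos (inv_pos.2 hc), ← hw]
  have h6 : ‖fderiv ℝ N y0‖ = c⁻¹ * (k * ‖fderiv ℝ N (ballExt γ y0)‖) := by
    rw [h3]
    field_simp
  rw [h6]
  ring

lemma injOn_coneMap (hN : IsGraphGauge Γ ε N) (hΓ : IsKleinian Γ) (hγ : γ ∈ Γ) :
    Set.InjOn (coneMap N γ) {y | ‖y‖ < N y} := by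
  intro y hy z hz h
  rw [← hN.coneMap_inv hΓ hγ hy, h, hN.coneMap_inv hΓ hγ hz]

lemma measurable_coneMap (hN : IsGraphGauge Γ ε N) (hI : IsBallIsometry γ) :
    Measurable (coneMap N γ) := by
  have hNm := hN.continuous.measurable
  have h1 : Measurable (fun y : E n => (N y)⁻¹ • y) := by fun_prop
  exact hNm.smul ((measurable_ballExt hI).comp h1)

/-- The bad set is contained in the image of a null set under the cone map of `γ⁻¹`, which is
Lipschitz. -/
lemma ae_differentiableAt_coneMap (hN : IsGraphGauge Γ ε N) (hΓ : IsKleinian Γ) (hγ : γ ∈ Γ) :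
    ∀ᵐ y : E n, ‖y‖ < N y → DifferentiableAt ℝ N (coneMap N γ y) := by
  have hI := hΓ.isBallIsometry (Γ.inv_mem hγ)
  obtain ⟨K, hK⟩ := hN.exists_lipschitzOnWith_coneMap hI
  have h1 : volume ({y | ¬ DifferentiableAt ℝ N y} ∩ {0}ᶜ) = 0 :=
    measure_mono_null Set.inter_subset_left hN.ae_differentiableAt
  have h2 := addHaar_image_eq_zero_of_lipschitzOnWith (hK.mono Set.inter_subset_right) h1
  refine measure_mono_null ?_ h2
  intro y hy
  change ¬ (‖y‖ < N y → DifferentiableAt ℝ N (coneMap N γ y)) at hy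
  push Not at hy
  refine ⟨coneMap N γ y, ⟨hy.2, hN.ne_zero_of_lt (hN.norm_coneMap_lt hΓ hγ hy.1)⟩, ?_⟩
  exact hN.coneMap_inv hΓ hγ hy.1

/-- The change of variables only needs the image of the good set to lie in the cone; equality
follows by applying the inequality to `γ⁻¹`. -/
lemma lintegral_area_comp_le (hN : IsGraphGauge Γ ε N) (hΓ : IsKleinian Γ) (hγ : γ ∈ Γ)
    {H : E n → ENNReal} (hH : Measurable H) :
    ∫⁻ z : CBall n, H (γ z) ∂(area Γ ε) ≤ ∫⁻ z : CBall n, H z ∂(area Γ ε) := by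
  have hI := hΓ.isBallIsometry hγ
  have e1 : ∫⁻ z : CBall n, H (γ z) ∂(area Γ ε) =
      ∫⁻ z : CBall n, (H ∘ ballExt γ) (z : E n) ∂(area Γ ε) := by
    simp
  rw [e1, hN.lintegral_area_cone hΓ hH,
    hN.lintegral_area_cone hΓ (hH.comp (measurable_ballExt hI))]
  gcongr 1
  have hNm := hN.continuous.measurable
  have hcm := hN.measurable_coneMap hI
  set C : Set (E n) := {y | ‖y‖ < N y ∧ N y < 1} with hC
  have hCm : MeasurableSet C :=
    (measurableSet_lt measurable_norm hNm).inter (measurableSet_lt hNm measurable_const)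
  have hdm : MeasurableSet {y : E n | DifferentiableAt ℝ N y} :=
    measurableSet_of_differentiableAt ℝ N
  set s : Set (E n) := C ∩ {y | DifferentiableAt ℝ N y} ∩
    (coneMap N γ ⁻¹' {y | DifferentiableAt ℝ N y}) with hs
  have hsm : MeasurableSet s := (hCm.inter hdm).inter (hcm hdm)
  have hCs : s =ᵐ[volume] C := by
    filter_upwards [hN.ae_differentiableAt, hN.ae_differentiableAt_coneMap hΓ hγ] with y h1 h2
    apply propext
    constructor
    · exact fun h => h.1.1
    · exact fun h => ⟨⟨h, h1⟩, h2 h.1⟩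
  have hsub : coneMap N γ '' s ⊆ C := by
    rintro _ ⟨y, hy, rfl⟩
    have h1 := hy.1.1
    exact ⟨hN.norm_coneMap_lt hΓ hγ h1.1, by rw [hN.gauge_coneMap hΓ hγ h1.1]; exact h1.2⟩
  rw [← setLIntegral_congr hCs]
  refine le_trans (le_of_eq ?_) (lintegral_mono_set hsub)
  rw [lintegral_image_eq_lintegral_abs_det_fderiv_mul volume hsm
    (f' := fun y => fderiv ℝ (coneMap N γ) y)]
  · refine setLIntegral_congr_fun hsm fun y hy => ?_
    have h1 := hy.1.1
    have h2 := (hN.jacobian_coneMap hΓ hγ h1.1 hy.1.2 hy.2).2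
    beta_reduce
    rw [← mul_assoc, ← ENNReal.ofReal_mul (abs_nonneg _), h2, hN.inv_smul_coneMap hΓ hγ h1.1]
    rfl
  · intro y hy
    exact (hN.jacobian_coneMap hΓ hγ hy.1.1.1 hy.1.2 hy.2).1.hasFDerivAt.hasFDerivWithinAt
  · exact (hN.injOn_coneMap hΓ hγ).mono fun y hy => hy.1.1.1

lemma lintegral_area_comp (hN : IsGraphGauge Γ ε N) (hΓ : IsKleinian Γ) (hγ : γ ∈ Γ)
    {H : E n → ENNReal} (hH : Measurable H) :
    ∫⁻ z : CBall n, H (γ z) ∂(area Γ ε) = ∫⁻ z : CBall n, H z ∂(area Γ ε) := by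
  refine le_antisymm (hN.lintegral_area_comp_le hΓ hγ hH) ?_
  have := hN.lintegral_area_comp_le hΓ (Γ.inv_mem hγ)
    (hH.comp (measurable_ballExt (hΓ.isBallIsometry hγ)))
  simpa using this

lemma measure_preimage_area (hN : IsGraphGauge Γ ε N) (hΓ : IsKleinian Γ) (hγ : γ ∈ Γ)
    {s : Set (CBall n)} (hs : MeasurableSet s) : area Γ ε (γ ⁻¹' s) = area Γ ε s := by
  have hs' : MeasurableSet (Subtype.val '' s) :=
    (MeasurableEmbedding.subtype_coe Metric.isClosed_closedBall.measurableSet).measurableSet_image.2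
      hs
  have h := hN.lintegral_area_comp hΓ hγ (H := (Subtype.val '' s).indicator 1)
    (measurable_one.indicator hs')
  have e : ∀ z : CBall n, (Subtype.val '' s).indicator (1 : E n → ENNReal) z = s.indicator 1 z := by
    intro z
    simp only [Set.indicator, Pi.one_apply]
    congr 1
    simp [cball_norm_le]
  simp only [e] at h
  have hγm : Measurable γ := (hΓ.isBallIsometry hγ).cont.measurable
  have e2 : ∀ z : CBall n, s.indicator (1 : CBall n → ENNReal) (γ z) = (γ ⁻¹' s).indicator 1 z :=
    fun z => rfl
  simp only [e2] at h
  rwa [lintegral_indicator_one hs, lintegral_indicator_one (hγm hs)] at h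

lemma smulInvariantMeasure (hN : IsGraphGauge Γ ε N) (hΓ : IsKleinian Γ) :
    SMulInvariantMeasure Γ (CBall n) (area Γ ε) :=
  ⟨fun γ _ hs => hN.measure_preimage_area hΓ γ.2 hs⟩

lemma ae_area (hN : IsGraphGauge Γ ε N) (hΓ : IsKleinian Γ) {p : E n → Prop}
    (hp : MeasurableSet {y | p y})
    (h : ∀ᵐ θ : Metric.sphere (0 : E n) 1 ∂(volume : Measure (E n)).toSphere, 1 < N θ →
      p ((N θ)⁻¹ • (θ : E n))) :
    ∀ᵐ z : CBall n ∂(area Γ ε), p z := by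
  have h1 := (hN.lintegral_area hΓ (H := {y | p y}ᶜ.indicator 1)
    (measurable_one.indicator hp.compl)).trans (hN.lintegral_ambientArea hΓ
    (measurable_one.indicator hp.compl))
  have hms : MeasurableSet {θ : Metric.sphere (0 : E n) 1 | 1 < N θ} :=
    measurableSet_lt measurable_const (hN.continuous.measurable.comp measurable_subtype_coe)
  have h2 : ∫⁻ θ in {θ : Metric.sphere (0 : E n) 1 | 1 < N θ},
        ENNReal.ofReal (hypWeight n ((N θ)⁻¹ • (θ : E n)) * (N θ)⁻¹ ^ (n + 1) * ‖fderiv ℝ N θ‖) *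
        {y | p y}ᶜ.indicator 1 ((N θ)⁻¹ • (θ : E n)) ∂(volume : Measure (E n)).toSphere = 0 := by
    rw [lintegral_congr_ae (g := fun _ => 0), lintegral_zero]
    filter_upwards [ae_restrict_of_ae h, ae_restrict_mem hms] with θ h3 h4
    rw [Set.indicator_of_notMem, mul_zero]
    exact fun hcon => hcon (h3 h4)
  rw [h2] at h1
  have e : ∀ z : CBall n, {y | p y}ᶜ.indicator (1 : E n → ENNReal) z =
      {z : CBall n | ¬ p z}.indicator 1 z := fun z => rfl
  simp only [e] at h1
  rw [lintegral_indicator_one] at h1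
  · exact h1
  · exact measurable_subtype_coe hp.compl

lemma measurableSet_graphSet (hN : IsGraphGauge Γ ε N) (hΓ : IsKleinian Γ) :
    MeasurableSet (graphSet Γ ε) := by
  have : graphSet Γ ε = {y | ‖y‖ < 1} ∩ {y | N y = 1} := by
    ext y
    exact hN.mem_graphSet_iff hΓ
  rw [this]
  exact (measurableSet_lt measurable_norm measurable_const).inter
    (measurableSet_eq_fun hN.continuous.measurable measurable_const)

lemma ae_area_mem_graphSet (hN : IsGraphGauge Γ ε N) (hΓ : IsKleinian Γ) :
    ∀ᵐ z : CBall n ∂(area Γ ε), (z : E n) ∈ graphSet Γ ε := by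
  refine hN.ae_area hΓ (hN.measurableSet_graphSet hΓ) (Filter.Eventually.of_forall fun θ h => ?_)
  exact hN.smul_mem_graphSet hΓ (by rwa [show ‖(θ : E n)‖ = 1 by simp])

lemma ae_area_differentiableAt (hN : IsGraphGauge Γ ε N) (hΓ : IsKleinian Γ) :
    ∀ᵐ z : CBall n ∂(area Γ ε), DifferentiableAt ℝ N z := by
  refine hN.ae_area hΓ (measurableSet_of_differentiableAt ℝ N) ?_
  filter_upwards [hN.ae_sphere_differentiableAt] with θ hd h
  have h0 : 0 < N θ := by linarith
  apply differentiableAt_gauge_smul hN.smul h0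
  rwa [smul_smul, mul_inv_cancel₀ h0.ne', one_smul]

lemma ae_area_map (hN : IsGraphGauge Γ ε N) (hΓ : IsKleinian Γ) (hγ : γ ∈ Γ) {p : CBall n → Prop}
    (h : ∀ᵐ z ∂(area Γ ε), p z) : ∀ᵐ z ∂(area Γ ε), p (γ z) := by
  have hγm : Measurable γ := (hΓ.isBallIsometry hγ).cont.measurable
  have : MeasurePreserving γ (area Γ ε) (area Γ ε) := by
    refine ⟨hγm, ?_⟩
    ext s hs
    rw [Measure.map_apply hγm hs, hN.measure_preimage_area hΓ hγ hs]
  exact this.quasiMeasurePreserving.ae h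

/-- The unit normal field is equivariant. -/
lemma unitNormal_map (hN : IsGraphGauge Γ ε N) (hΓ : IsKleinian Γ) (hγ : γ ∈ Γ) {y : E n}
    (hy : y ∈ graphSet Γ ε) (hd : DifferentiableAt ℝ N y)
    (hd' : DifferentiableAt ℝ N (ballExt γ y)) :
    unitNormal Γ ε (ballExt γ y) = fderiv ℝ (ballExt γ) y (unitNormal Γ ε y) := by
  have hI := hΓ.isBallIsometry hγ
  obtain ⟨hy1, hNy⟩ := (hN.mem_graphSet_iff hΓ).1 hy
  have hy' := hN.ballExt_mem_graphSet hΓ hγ hy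
  obtain ⟨hy1', hNy'⟩ := (hN.mem_graphSet_iff hΓ).1 hy'
  have key : ∀ z : E n, z ∈ graphSet Γ ε → DifferentiableAt ℝ N z → unitNormal Γ ε z =
      ((1 - ‖z‖ ^ 2) / 2) • (‖gradient N z‖⁻¹ • gradient N z) := by
    intro z hz hdz
    have hz0 : z ≠ 0 := hN.ne_zero_of_lt (by
      rw [((hN.mem_graphSet_iff hΓ).1 hz).2]; exact ((hN.mem_graphSet_iff hΓ).1 hz).1)
    rw [unitNormal, hN.gradient_defFn hΓ hz hdz, norm_smul, norm_norm, mul_inv,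
      smul_smul _ ‖z‖, mul_right_comm, inv_mul_cancel₀ (norm_ne_zero_iff.2 hz0), one_mul]
  obtain ⟨A, hA⟩ := hI.exists_hasFDerivAt hy1
  have hk := hI.confFactor_pos hy1.le
  have hsurj : Function.Surjective
      (confFactor γ y • (A.toContinuousLinearEquiv : E n →L[ℝ] E n)) := by
    intro w
    refine ⟨(confFactor γ y)⁻¹ • A.symm w, ?_⟩
    change confFactor γ y • A ((confFactor γ y)⁻¹ • A.symm w) = w
    rw [map_smul, A.apply_symm_apply, smul_smul, mul_inv_cancel₀ hk.ne', one_smul]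
  obtain ⟨c, hc, hcv⟩ := hN.exists_fderiv_map hΓ hγ hy hd hd' hA hsurj
  have hgrad : gradient N (ballExt γ y) = (c / confFactor γ y) • A (gradient N y) := by
    refine ext_inner_right ℝ fun w => ?_
    rw [gradient, InnerProductSpace.toDual_symm_apply]
    have h1 := hcv ((confFactor γ y)⁻¹ • A.symm w)
    have h2 : (confFactor γ y • (A.toContinuousLinearEquiv : E n →L[ℝ] E n))
        ((confFactor γ y)⁻¹ • A.symm w) = w := by
      change confFactor γ y • A ((confFactor γ y)⁻¹ • A.symm w) = w
      rw [map_smul, A.apply_symm_apply, smul_smul, mul_inv_cancel₀ hk.ne', one_smul]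
    rw [h2, map_smul, smul_eq_mul] at h1
    have h3 : inner ℝ (A (gradient N y)) w = fderiv ℝ N y (A.symm w) := by
      rw [gradient, ← InnerProductSpace.toDual_symm_apply (𝕜 := ℝ),
        ← A.inner_map_map _ (A.symm w), A.apply_symm_apply]
    rw [h1, inner_smul_left, h3]
    simp only [conj_trivial]
    field_simp
  have hb : ballExt γ y = (γ ⟨y, by simpa using hy1.le⟩ : E n) := by rw [ballExt, dif_pos hy1.le]
  have hsq := hI.one_sub_sq_map ⟨y, by simpa using hy1.le⟩
  rw [← hb] at hsq
  have hg0 : ‖gradient N y‖ ≠ 0 := by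
    rw [norm_gradient, norm_ne_zero_iff]
    refine hN.fderiv_ne_zero (hN.ne_zero_of_lt ?_) hd
    rw [hNy]
    exact hy1
  have hpos : 0 < c / confFactor γ y := by positivity
  rw [key y hy hd, key _ hy' hd', hA.fderiv, hgrad, hsq, norm_smul, A.norm_map,
    Real.norm_of_nonneg hpos.le]
  change _ = confFactor γ y • A _
  rw [map_smul, map_smul, smul_smul, smul_smul, smul_smul, smul_smul]
  congr 1
  field_simp

end IsGraphGauge

end AreaInvariance

/-! ### Discreteness and convergence of the Poincaré series -/

section Orbits

variable {Γ : Subgroup (Equiv.Perm (CBall n))} {ε : ℝ} {N : E n → ℝ}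

lemma IsKleinian.countable (hΓ : IsKleinian Γ) : Countable Γ := by
  let K : ℕ → Set (CBall n) := fun k => {z | ‖(z : E n)‖ ≤ 1 - 1 / ((k : ℝ) + 1)}
  have : CompactSpace (CBall n) := isCompact_iff_compactSpace.1 (isCompact_closedBall (0 : E n) 1)
  have hK : ∀ k, IsCompact (K k) := fun k =>
    (isClosed_le continuous_subtype_val.norm continuous_const).isCompact
  have hK1 : ∀ k, ∀ z ∈ K k, ‖(z : E n)‖ < 1 := by
    intro k z hz
    have hz : ‖(z : E n)‖ ≤ 1 - 1 / ((k : ℝ) + 1) := hz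
    have : (0 : ℝ) < 1 / ((k : ℝ) + 1) := by positivity
    linarith
  have hsub : (Γ : Set (Equiv.Perm (CBall n))) ⊆
      ⋃ k, {γ | γ ∈ Γ ∧ (γ '' K k ∩ K k).Nonempty} := by
    intro γ hγ
    have h1 : ‖(γ cOrigin : E n)‖ < 1 := hΓ.maps_ball γ hγ _ (by simp)
    obtain ⟨k, hk⟩ := exists_nat_one_div_lt (sub_pos.2 h1)
    refine Set.mem_iUnion.2 ⟨k, hγ, γ cOrigin, ⟨cOrigin, ?_, rfl⟩, ?_⟩
    · change ‖((cOrigin : CBall n) : E n)‖ ≤ _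
      rw [coe_cOrigin, norm_zero, sub_nonneg, div_le_one (by positivity)]
      linarith [Nat.cast_nonneg (α := ℝ) k]
    · change ‖(γ cOrigin : E n)‖ ≤ _
      linarith
  have : (Γ : Set (Equiv.Perm (CBall n))).Countable :=
    (Set.countable_iUnion fun k => (hΓ.discrete (K k) (hK k) (hK1 k)).countable).mono hsub
  exact this.to_subtype

lemma IsKleinian.finite_inter (hΓ : IsKleinian Γ) {r : ℝ} (hr : r < 1) :
    {γ : Γ | ∃ z : CBall n, ‖(z : E n)‖ ≤ r ∧ ‖((γ : Equiv.Perm (CBall n)) z : E n)‖ ≤ r}.Finite := by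
  have : CompactSpace (CBall n) := isCompact_iff_compactSpace.1 (isCompact_closedBall (0 : E n) 1)
  have h := hΓ.discrete {z | ‖(z : E n)‖ ≤ r}
    (isClosed_le continuous_subtype_val.norm continuous_const).isCompact
    (fun z hz => lt_of_le_of_lt (show ‖(z : E n)‖ ≤ r from hz) hr)
  refine Set.Finite.of_finite_image (f := Subtype.val) (h.subset ?_) Subtype.val_injective.injOn
  rintro _ ⟨γ, ⟨z, hz, hz'⟩, rfl⟩
  exact ⟨γ.2, _, ⟨z, hz, rfl⟩, hz'⟩

/-- Harnack's inequality for the distance to the sphere. -/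
lemma IsBallIsometry.one_sub_sq_le {γ : Equiv.Perm (CBall n)} (h : IsBallIsometry γ)
    {x y : CBall n} (hx : ‖(x : E n)‖ < 1) (hy : ‖(y : E n)‖ < 1) :
    1 - ‖(γ x : E n)‖ ^ 2 ≤
      (2 + 4 * (‖(x : E n) - y‖ ^ 2 / ((1 - ‖(x : E n)‖ ^ 2) * (1 - ‖(y : E n)‖ ^ 2)))) *
        (1 - ‖(γ y : E n)‖ ^ 2) := by
  rw [← h.sq_dist hx hy]
  have a3 := one_sub_sq_pos (h.maps x hx)
  have a4 := one_sub_sq_pos (h.maps y hy)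
  set a := 1 - ‖(γ x : E n)‖ ^ 2 with ha
  set b := 1 - ‖(γ y : E n)‖ ^ 2 with hb
  have h1 : a - b ≤ 2 * ‖(γ x : E n) - γ y‖ := by
    have h2 := norm_sub_norm_le (γ y : E n) (γ x)
    rw [norm_sub_rev] at h2
    have h3 := cball_norm_le (γ y)
    have h4 := cball_norm_le (γ x)
    have h5 := norm_nonneg (γ y : E n)
    have h6 := norm_nonneg (γ x : E n)
    have h7 := norm_nonneg ((γ x : E n) - γ y)
    rw [ha, hb]
    nlinarith
  set d := ‖(γ x : E n) - γ y‖ with hd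
  have h2 : (2 + 4 * (d ^ 2 / (a * b))) * b = 2 * b + 4 * d ^ 2 / a := by
    field_simp
  rw [h2]
  -- Arithmetic-geometric mean, weighted so that half of `a` is absorbed into the left side.
  have h3 : 2 * d ≤ a / 2 + 2 * d ^ 2 / a := by
    have : a / 2 + 2 * d ^ 2 / a - 2 * d = (a - 2 * d) ^ 2 / (2 * a) := by
      field_simp
      ring
    have h4 : 0 ≤ (a - 2 * d) ^ 2 / (2 * a) := by positivity
    linarith
  have h4 : 4 * d ^ 2 / a = 2 * (2 * d ^ 2 / a) := by ring
  rw [h4]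
  linarith

namespace IsGraphGauge

/-- The exponent `n` exactly cancels the hyperbolic weight, leaving a bounded density on the sphere.
This fixes the exponent of the Poincaré series. -/
lemma lintegral_area_pow_lt_top (hN : IsGraphGauge Γ ε N) (hΓ : IsKleinian Γ) :
    ∫⁻ z : CBall n, ENNReal.ofReal ((1 - ‖(z : E n)‖ ^ 2) ^ n) ∂(area Γ ε) < ⊤ := by
  have hm : Measurable (fun y : E n => ENNReal.ofReal ((1 - ‖y‖ ^ 2) ^ n)) := by fun_prop
  rw [hN.lintegral_area hΓ hm, hN.lintegral_ambientArea hΓ hm]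
  obtain ⟨K, hK⟩ := hN.lipschitz
  have hms : MeasurableSet {θ : Metric.sphere (0 : E n) 1 | 1 < N θ} :=
    measurableSet_lt measurable_const (hN.continuous.measurable.comp measurable_subtype_coe)
  refine lt_of_le_of_lt (setLIntegral_mono' (g := fun _ => ENNReal.ofReal (2 ^ n * K)) hms ?_) ?_
  · intro θ h
    have h : 1 < N θ := h
    have h0 : 0 < N θ := by linarith
    have hlt : ‖(θ : E n)‖ < N θ := by rwa [show ‖(θ : E n)‖ = 1 by simp]
    have h1 := ((hN.mem_graphSet_iff hΓ).1 (hN.smul_mem_graphSet hΓ hlt)).1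
    have h2 := one_sub_sq_pos h1
    rw [← ENNReal.ofReal_mul (by unfold hypWeight; positivity)]
    apply ENNReal.ofReal_le_ofReal
    rw [hypWeight, div_pow]
    have h3 := norm_fderiv_gauge_le hK (θ : E n)
    have h4 : (N θ)⁻¹ ^ (n + 1) ≤ 1 := pow_le_one₀ (by positivity) (inv_le_one_of_one_le₀ h.le)
    set q := (1 - ‖(N θ)⁻¹ • (θ : E n)‖ ^ 2) ^ n with hq
    have hq0 : 0 < q := by positivity
    have e : 2 ^ n / q * (N θ)⁻¹ ^ (n + 1) * ‖fderiv ℝ N θ‖ * q =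
      2 ^ n * ((N θ)⁻¹ ^ (n + 1) * ‖fderiv ℝ N θ‖) := by
      field_simp
    rw [e]
    gcongr
    calc _ ≤ 1 * (K : ℝ) := by gcongr
      _ = K := one_mul _
  · rw [lintegral_const]
    exact ENNReal.mul_lt_top ENNReal.ofReal_lt_top (measure_lt_top _ _)

lemma area_ne_zero (hN : IsGraphGauge Γ ε N) (hΓ : IsKleinian Γ) (hsk : IsSecondKind Γ) :
    area Γ ε ≠ 0 := by
  intro h0
  have h1 := hN.lintegral_area hΓ (H := fun _ => 1) measurable_const
  rw [hN.lintegral_ambientArea hΓ measurable_const, h0, lintegral_zero_measure] at h1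
  have hopen : IsOpen {θ : Metric.sphere (0 : E n) 1 | 1 < N θ} :=
    isOpen_lt continuous_const (hN.continuous.comp continuous_subtype_val)
  have hne : {θ : Metric.sphere (0 : E n) 1 | 1 < N θ}.Nonempty := by
    by_contra hcon
    apply hsk
    refine Set.Subset.antisymm (fun p hp => by simpa using norm_of_mem_limitSet hp) fun p hp => ?_
    by_contra hpl
    have hp1 : ‖p‖ = 1 := by simpa using hp
    exact hcon ⟨⟨p, hp⟩, (hN.mem_domain_iff hp1).1 ⟨hp, hpl⟩⟩
  have hpos := hopen.measure_pos (volume : Measure (E n)).toSphere hne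
  have hNm := hN.continuous.measurable
  have hw : Measurable (hypWeight n) := measurable_hypWeight
  have hfd : Measurable (fderiv ℝ N) := measurable_fderiv ℝ N
  have hN' : Measurable (fun θ : Metric.sphere (0 : E n) 1 => N θ) :=
    hNm.comp measurable_subtype_coe
  have hmeas : Measurable (fun θ : Metric.sphere (0 : E n) 1 =>
      ENNReal.ofReal (hypWeight n ((N θ)⁻¹ • (θ : E n)) * (N θ)⁻¹ ^ (n + 1) * ‖fderiv ℝ N θ‖) * 1) := by
    have h2 : Measurable (fun θ : Metric.sphere (0 : E n) 1 => (N θ)⁻¹ • (θ : E n)) :=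
      hN'.inv.smul measurable_subtype_coe
    have h3 := hw.comp h2
    have h4 := hfd.comp (measurable_subtype_coe (p := (· ∈ Metric.sphere (0 : E n) 1)))
    simp only [Function.comp_def] at h3 h4
    fun_prop
  have h2 := (lintegral_eq_zero_iff hmeas).1 h1.symm
  have h3 : (volume : Measure (E n)).toSphere {θ : Metric.sphere (0 : E n) 1 | 1 < N θ} = 0 := by
    rw [Filter.EventuallyEq, ae_restrict_iff' hopen.measurableSet] at h2
    refine measure_mono_null (fun θ hθ => ?_)
      (measure_union_null h2 hN.ae_sphere_differentiableAt)
    by_contra hcon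
    rw [Set.mem_union, not_or] at hcon
    obtain ⟨hc1, hc2⟩ := hcon
    have hd : DifferentiableAt ℝ N θ := not_not.1 hc2
    have hc1 := not_not.1 hc1 hθ
    have hθ : 1 < N θ := hθ
    have h0 : 0 < N θ := by linarith
    have hlt : ‖(θ : E n)‖ < N θ := by rwa [show ‖(θ : E n)‖ = 1 by simp]
    have h5 := ((hN.mem_graphSet_iff hΓ).1 (hN.smul_mem_graphSet hΓ hlt)).1
    have h6 := one_sub_sq_pos h5
    have h7 : 0 < ‖fderiv ℝ N θ‖ :=
      norm_pos_iff.2 (hN.fderiv_ne_zero (hN.ne_zero_of_lt hlt) hd)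
    have h8 : 0 < hypWeight n ((N θ)⁻¹ • (θ : E n)) * (N θ)⁻¹ ^ (n + 1) * ‖fderiv ℝ N θ‖ := by
      unfold hypWeight; positivity
    rw [mul_one] at hc1
    simp only [Pi.zero_apply, ENNReal.ofReal_eq_zero] at hc1
    linarith
  exact hpos.ne' h3

/-- Let `A` be a closed concentric ball of positive area. By invariance, the integrals over `A` of
the translates of `(1 - |z|^2)^n` sum to at most the finite total integral times the covering
multiplicity of the translates of `A`. So the series is finite at almost every point of `A`. -/
lemma exists_summable_orbit (hN : IsGraphGauge Γ ε N) (hΓ : IsKleinian Γ) (hsk : IsSecondKind Γ) :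
    ∃ y : CBall n, ‖(y : E n)‖ < 1 ∧
      Summable fun γ : Γ => (1 - ‖((γ : Equiv.Perm (CBall n)) y : E n)‖ ^ 2) ^ n := by
  have := hΓ.countable
  obtain ⟨k, hk⟩ : ∃ k : ℕ, area Γ ε {z : CBall n | ‖(z : E n)‖ ≤ 1 - 1 / ((k : ℝ) + 1)} ≠ 0 := by
    by_contra hcon
    push Not at hcon
    have h1 := measure_iUnion_null hcon
    have h2 := hN.ae_area_mem_graphSet hΓ
    apply hN.area_ne_zero hΓ hsk
    rw [← Measure.measure_univ_eq_zero]
    refine measure_mono_null (fun z _ => ?_) (measure_union_null h1 h2)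
    by_cases hz : (z : E n) ∈ graphSet Γ ε
    · left
      have h3 := ((hN.mem_graphSet_iff hΓ).1 hz).1
      obtain ⟨k, hk⟩ := exists_nat_one_div_lt (sub_pos.2 h3)
      refine Set.mem_iUnion.2 ⟨k, ?_⟩
      change ‖(z : E n)‖ ≤ 1 - 1 / ((k : ℝ) + 1)
      linarith
    · right
      exact hz
  set r : ℝ := 1 - 1 / ((k : ℝ) + 1) with hr
  have hr1 : r < 1 := by
    have : (0 : ℝ) < 1 / ((k : ℝ) + 1) := by positivity
    linarith
  set A : Set (CBall n) := {z : CBall n | ‖(z : E n)‖ ≤ r} with hA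
  have hAm : MeasurableSet A := by
    exact measurableSet_le measurable_subtype_coe.norm measurable_const
  set φ : CBall n → ENNReal := fun z => ENNReal.ofReal ((1 - ‖(z : E n)‖ ^ 2) ^ n) with hφ
  have hφm : Measurable φ := by
    have : Measurable (fun y : E n => ENNReal.ofReal ((1 - ‖y‖ ^ 2) ^ n)) := by fun_prop
    exact this.comp measurable_subtype_coe
  have hfin := hΓ.finite_inter hr1
  have hgm : ∀ γ : Γ, Measurable (γ : Equiv.Perm (CBall n)) := fun γ =>
    (hΓ.isBallIsometry γ.2).cont.measurable
  have h1 : ∑' γ : Γ, ∫⁻ z in A, φ ((γ : Equiv.Perm (CBall n)) z) ∂(area Γ ε) ≤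
      hfin.toFinset.card * ∫⁻ z, φ z ∂(area Γ ε) := by
    have h2 : ∀ γ : Γ, ∫⁻ z in A, φ ((γ : Equiv.Perm (CBall n)) z) ∂(area Γ ε) =
        ∫⁻ z, A.indicator 1 ((γ⁻¹ : Γ) • z) * φ z ∂(area Γ ε) := by
      intro γ
      have hmp : MeasurePreserving (γ : Equiv.Perm (CBall n)) (area Γ ε) (area Γ ε) := by
        refine ⟨hgm γ, ?_⟩
        ext s hs
        rw [Measure.map_apply (hgm γ) hs, hN.measure_preimage_area hΓ γ.2 hs]
      rw [← hmp.lintegral_comp (f := fun z => A.indicator 1 ((γ⁻¹ : Γ) • z) * φ z)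
        (((measurable_one.indicator hAm).comp (hgm γ⁻¹)).mul hφm), ← lintegral_indicator hAm]
      refine lintegral_congr fun z => ?_
      have e : (γ⁻¹ : Γ) • ((γ : Equiv.Perm (CBall n)) z) = z := inv_smul_smul γ z
      rw [e]
      by_cases hz : z ∈ A
      · rw [Set.indicator_of_mem hz, Set.indicator_of_mem hz, Pi.one_apply, one_mul]
      · rw [Set.indicator_of_notMem hz, Set.indicator_of_notMem hz, zero_mul]
    simp_rw [h2]
    have hm' : ∀ γ : Γ, AEMeasurable
        (fun z => A.indicator (1 : CBall n → ENNReal) ((γ⁻¹ : Γ) • z) * φ z) (area Γ ε) := fun γ =>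
      (((measurable_one.indicator hAm).comp (hgm γ⁻¹)).mul hφm).aemeasurable
    rw [← lintegral_tsum hm',
      ← lintegral_const_mul _ hφm]
    refine lintegral_mono fun z => ?_
    simp_rw [ENNReal.tsum_mul_right]
    gcongr
    -- Once some translate `γ₀⁻¹ z` lies in `A`, reindexing by `γ₀` leaves only elements whose
    -- inverse carries a point of `A` into `A`; discreteness bounds their number independently of
    -- `z`.
    by_cases hz : ∃ γ₀ : Γ, (γ₀⁻¹ : Γ) • z ∈ A
    · obtain ⟨γ₀, hγ₀⟩ := hz
      have h3 : ∑' γ : Γ, A.indicator (1 : CBall n → ENNReal) ((γ⁻¹ : Γ) • z) =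
          ∑' γ : Γ, A.indicator (1 : CBall n → ENNReal) ((γ⁻¹ : Γ) • (γ₀⁻¹ : Γ) • z) := by
        rw [← (Equiv.mulLeft γ₀).tsum_eq
          (fun γ : Γ => A.indicator (1 : CBall n → ENNReal) ((γ⁻¹ : Γ) • z))]
        refine tsum_congr fun γ => ?_
        rw [Equiv.coe_mulLeft, mul_inv_rev, mul_smul]
      have h4 : ∀ γ ∉ (hfin.toFinset.map (Equiv.inv Γ).toEmbedding),
          A.indicator (1 : CBall n → ENNReal) ((γ⁻¹ : Γ) • (γ₀⁻¹ : Γ) • z) = 0 := by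
        intro γ hγ
        refine Set.indicator_of_notMem (fun hcon => hγ ?_) _
        rw [Finset.mem_map_equiv, Set.Finite.mem_toFinset]
        exact ⟨(γ₀⁻¹ : Γ) • z, hγ₀, hcon⟩
      rw [h3, tsum_eq_sum h4]
      calc _ ≤ ∑ γ ∈ hfin.toFinset.map (Equiv.inv Γ).toEmbedding, (1 : ENNReal) := by
            gcongr with γ hγ
            exact Set.indicator_le_self' (fun _ _ => zero_le) _
        _ = _ := by simp
    · push Not at hz
      have : ∀ γ : Γ, A.indicator (1 : CBall n → ENNReal) ((γ⁻¹ : Γ) • z) = 0 := fun γ =>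
        Set.indicator_of_notMem (hz γ) _
      simp [this]
  have h2 : ∫⁻ z in A, ∑' γ : Γ, φ ((γ : Equiv.Perm (CBall n)) z) ∂(area Γ ε) < ⊤ := by
    have hm' : ∀ γ : Γ, AEMeasurable (fun z => φ ((γ : Equiv.Perm (CBall n)) z))
        ((area Γ ε).restrict A) := fun γ => (hφm.comp (hgm γ)).aemeasurable
    rw [lintegral_tsum hm']
    exact h1.trans_lt (ENNReal.mul_lt_top (ENNReal.natCast_lt_top _)
      (hN.lintegral_area_pow_lt_top hΓ))
  have h3 := ae_lt_top (Measurable.tsum fun γ : Γ => hφm.comp (hgm γ)) h2.ne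
  have h4 : (ae ((area Γ ε).restrict A)).NeBot := by
    rw [ae_neBot, Ne, Measure.restrict_eq_zero]
    exact hk
  obtain ⟨y, hy, hyA⟩ := (h3.and (ae_restrict_mem hAm)).exists
  have hy1 : ‖(y : E n)‖ < 1 := lt_of_le_of_lt hyA hr1
  refine ⟨y, hy1, ?_⟩
  have h5 := ENNReal.summable_toReal hy.ne
  refine h5.congr fun γ => ?_
  have := one_sub_sq_pos ((hΓ.isBallIsometry γ.2).maps y hy1)
  exact ENNReal.toReal_ofReal (pow_nonneg this.le n)

/-- The Poincaré series of `Γ` at the exponent `n` converges. -/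
theorem summable_orbit (hN : IsGraphGauge Γ ε N) (hΓ : IsKleinian Γ) (hsk : IsSecondKind Γ)
    {x : CBall n} (hx : ‖(x : E n)‖ < 1) :
    Summable fun γ : Γ => (1 - ‖((γ : Equiv.Perm (CBall n)) x : E n)‖ ^ 2) ^ n := by
  obtain ⟨y, hy, hs⟩ := hN.exists_summable_orbit hΓ hsk
  set C := 2 + 4 * (‖(x : E n) - y‖ ^ 2 / ((1 - ‖(x : E n)‖ ^ 2) * (1 - ‖(y : E n)‖ ^ 2))) with hC
  refine Summable.of_nonneg_of_le (fun γ => ?_) (fun γ => ?_) (hs.mul_left (C ^ n))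
  · have := one_sub_sq_pos ((hΓ.isBallIsometry γ.2).maps x hx)
    positivity
  · have := one_sub_sq_pos ((hΓ.isBallIsometry γ.2).maps x hx)
    rw [← mul_pow]
    exact pow_le_pow_left₀ this.le ((hΓ.isBallIsometry γ.2).one_sub_sq_le hx hy) n

end IsGraphGauge

end Orbits

/-! ### The gradient of the Green's function of the ball -/

/-- The trace of an endomorphism, in coordinates. -/
def coordTrace (M : E n →L[ℝ] E n) : ℝ := ∑ i, (M (EuclideanSpace.single i 1)) i

lemma divergence_eq_coordTrace {Y : E n → E n} {M : E n →L[ℝ] E n} {y : E n}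
    (h : HasFDerivAt Y M y) : divergence Y y = coordTrace M := by
  rw [divergence, h.fderiv, coordTrace]

lemma clm_apply_eq_sum (f : E n →L[ℝ] ℝ) (w : E n) :
    f w = ∑ i, f (EuclideanSpace.single i 1) * w i := by
  have h := (EuclideanSpace.basisFun (Fin (n + 1)) ℝ).sum_repr w
  conv_lhs => rw [← h]
  rw [map_sum]
  refine Finset.sum_congr rfl fun i _ => ?_
  rw [map_smul, smul_eq_mul, EuclideanSpace.basisFun_apply, EuclideanSpace.basisFun_repr, mul_comm]

lemma coordTrace_add (M M' : E n →L[ℝ] E n) :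
    coordTrace (M + M') = coordTrace M + coordTrace M' := by
  simp [coordTrace, Finset.sum_add_distrib]

lemma coordTrace_smul (c : ℝ) (M : E n →L[ℝ] E n) : coordTrace (c • M) = c * coordTrace M := by
  simp [coordTrace, Finset.mul_sum]

lemma coordTrace_smulRight (f : E n →L[ℝ] ℝ) (w : E n) : coordTrace (f.smulRight w) = f w := by
  rw [clm_apply_eq_sum f w]
  simp [coordTrace]

lemma coordTrace_id : coordTrace (ContinuousLinearMap.id ℝ (E n)) = n + 1 := by
  simp [coordTrace]

/-- The product of `|x - y|^2` and `|x - y|^2 + (1 - |x|^2) (1 - |y|^2)`. -/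
def greenDenom (x y : E n) : ℝ := ‖x - y‖ ^ 2 * (‖x - y‖ ^ 2 + (1 - ‖x‖ ^ 2) * (1 - ‖y‖ ^ 2))

/-- The direction of the gradient of the Green's function. -/
def greenDir (x y : E n) : E n := (1 - 2 * inner ℝ x y + ‖x‖ ^ 2) • y - (1 - ‖y‖ ^ 2) • x

/-- The divergence free field to which the gradient of the Green's function of the ball with pole
`x` is proportional. -/
def greenField (x y : E n) : E n :=
  (-(2 ^ (n - 1) * (1 - ‖x‖ ^ 2) ^ n)) • ((Real.sqrt (greenDenom x y))⁻¹ ^ (n + 1) • greenDir x y)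

/-- The differential of `greenDenom x`. -/
def greenDenomDeriv (x y : E n) : E n →L[ℝ] ℝ :=
  (2 * (2 * ‖x - y‖ ^ 2 + (1 - ‖x‖ ^ 2) * (1 - ‖y‖ ^ 2))) • innerSL ℝ (y - x) -
    (2 * (1 - ‖x‖ ^ 2) * ‖x - y‖ ^ 2) • innerSL ℝ y

/-- The differential of `greenDir x`. -/
def greenDirDeriv (x y : E n) : E n →L[ℝ] E n :=
  (1 - 2 * inner ℝ x y + ‖x‖ ^ 2) • ContinuousLinearMap.id ℝ (E n) +
    ((-2 : ℝ) • innerSL ℝ x).smulRight y + ((2 : ℝ) • innerSL ℝ y).smulRight x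

/-- The differential of `greenField x`. -/
def greenFieldDeriv (x y : E n) : E n →L[ℝ] E n :=
  (-(2 ^ (n - 1) * (1 - ‖x‖ ^ 2) ^ n)) • ((Real.sqrt (greenDenom x y))⁻¹ ^ (n + 1) •
    greenDirDeriv x y + ((-((n : ℝ) + 1) / 2 * (Real.sqrt (greenDenom x y))⁻¹ ^ (n + 1) *
      (greenDenom x y)⁻¹) • greenDenomDeriv x y).smulRight (greenDir x y))

lemma hasFDerivAt_norm_sq' (y : E n) : HasFDerivAt (fun z : E n => ‖z‖ ^ 2) ((2 : ℝ) • innerSL ℝ y) y := by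
  refine (hasStrictFDerivAt_norm_sq y).hasFDerivAt.congr_fderiv ?_
  ext v
  simp

lemma hasFDerivAt_norm_sub_sq' (x y : E n) :
    HasFDerivAt (fun z : E n => ‖x - z‖ ^ 2) ((2 : ℝ) • innerSL ℝ (y - x)) y := by
  have h := (hasFDerivAt_norm_sq' (y - x)).comp y ((hasFDerivAt_id y).sub_const x)
  refine HasFDerivAt.congr_of_eventuallyEq (f := fun z : E n => ‖z - x‖ ^ 2) ?_
    (Filter.Eventually.of_forall fun z => by beta_reduce; rw [norm_sub_rev])
  exact h

lemma hasFDerivAt_greenDenom (x y : E n) :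
    HasFDerivAt (greenDenom x) (greenDenomDeriv x y) y := by
  have h1 := hasFDerivAt_norm_sub_sq' x y
  have h2 := h1.mul (h1.add (((hasFDerivAt_norm_sq' y).const_sub 1).const_mul (1 - ‖x‖ ^ 2)))
  refine HasFDerivAt.congr_fderiv (f := greenDenom x) h2 ?_
  ext v
  simp [greenDenomDeriv]
  ring

lemma hasFDerivAt_greenDir (x y : E n) :
    HasFDerivAt (greenDir x) (greenDirDeriv x y) y := by
  have h1 : HasFDerivAt (fun z : E n => inner ℝ x z) (innerSL ℝ x) y :=
    (innerSL ℝ x).hasFDerivAt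
  have h2 := (((h1.const_mul 2).const_sub 1).add_const (‖x‖ ^ 2)).smul (hasFDerivAt_id y)
  have h3 := h2.sub (((hasFDerivAt_norm_sq' y).const_sub 1).smul_const x)
  refine HasFDerivAt.congr_fderiv (f := greenDir x) h3 ?_
  ext v : 1
  simp [greenDirDeriv]

lemma hasFDerivAt_greenField {x y : E n} (h : 0 < greenDenom x y) :
    HasFDerivAt (greenField x) (greenFieldDeriv x y) y := by
  have hs := Real.sqrt_pos.2 h
  have h1 := (((Real.hasDerivAt_sqrt h.ne').inv hs.ne').pow (n + 1)).comp_hasFDerivAt y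
    (hasFDerivAt_greenDenom x y)
  have h2 := (h1.smul (hasFDerivAt_greenDir x y)).const_smul
    (-(2 ^ (n - 1) * (1 - ‖x‖ ^ 2) ^ n))
  refine HasFDerivAt.congr_fderiv (f := greenField x) h2 ?_
  rw [greenFieldDeriv]
  congr 3
  congr 1
  push_cast
  simp only [Pi.inv_apply]
  have : greenDenom x y = Real.sqrt (greenDenom x y) ^ 2 := (Real.sq_sqrt h.le).symm
  rw [show (greenDenom x y)⁻¹ = (Real.sqrt (greenDenom x y) ^ 2)⁻¹ by rw [← this], pow_succ]
  generalize Real.sqrt (greenDenom x y) = R at hs ⊢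
  simp only [inv_pow]
  field_simp
  ring

lemma norm_sub_sq_eq (x y : E n) : ‖x - y‖ ^ 2 = ‖x‖ ^ 2 - 2 * inner ℝ x y + ‖y‖ ^ 2 :=
  norm_sub_sq_real x y

/-- The identity behind the vanishing divergence: the trace of `greenDirDeriv x y` is `n + 1` times
the same scalar, and the power `-(n + 1) / 2` of the denominator contributes its negative. -/
lemma greenDenomDeriv_greenDir (x y : E n) : greenDenomDeriv x y (greenDir x y) =
    2 * greenDenom x y * (1 - 2 * inner ℝ x y + ‖x‖ ^ 2) := by
  have h1 : inner ℝ (y - x) (greenDir x y) = (1 - 2 * inner ℝ x y + ‖x‖ ^ 2) *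
      (‖y‖ ^ 2 - inner ℝ x y) - (1 - ‖y‖ ^ 2) * (inner ℝ x y - ‖x‖ ^ 2) := by
    rw [greenDir, inner_sub_right, inner_smul_right, inner_smul_right, inner_sub_left,
      inner_sub_left, real_inner_self_eq_norm_sq, real_inner_self_eq_norm_sq, real_inner_comm]
  have h2 : inner ℝ y (greenDir x y) = (1 - 2 * inner ℝ x y + ‖x‖ ^ 2) * ‖y‖ ^ 2 -
      (1 - ‖y‖ ^ 2) * inner ℝ x y := by
    rw [greenDir, inner_sub_right, inner_smul_right, inner_smul_right,
      real_inner_self_eq_norm_sq, real_inner_comm]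
  rw [greenDenomDeriv]
  simp only [sub_apply, smul_apply, innerSL_apply_apply, h1, h2, greenDenom, norm_sub_sq_eq,
    smul_eq_mul]
  ring

lemma coordTrace_greenFieldDeriv {x y : E n} (h : 0 < greenDenom x y) :
    coordTrace (greenFieldDeriv x y) = 0 := by
  rw [greenFieldDeriv, coordTrace_smul, coordTrace_add, coordTrace_smul, coordTrace_smulRight,
    greenDirDeriv, coordTrace_add, coordTrace_add, coordTrace_smul, coordTrace_smulRight,
    coordTrace_smulRight, coordTrace_id, smul_apply, smul_apply, smul_apply,
    greenDenomDeriv_greenDir, innerSL_apply_apply, innerSL_apply_apply, real_inner_comm]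
  simp only [smul_eq_mul]
  field_simp
  ring

lemma divergence_greenField {x y : E n} (h : 0 < greenDenom x y) :
    divergence (greenField x) y = 0 := by
  rw [divergence_eq_coordTrace (hasFDerivAt_greenField h), coordTrace_greenFieldDeriv h]

lemma contDiffAt_greenField {x y : E n} (h : 0 < greenDenom x y) :
    ContDiffAt ℝ 2 (greenField x) y := by
  unfold greenField
  have h1 : ContDiffAt ℝ 2 (greenDenom x) y := by
    unfold greenDenom
    have : ContDiff ℝ 2 (fun z : E n => ‖x - z‖ ^ 2) := (contDiff_const.sub contDiff_id).norm_sq ℝ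
    have : ContDiff ℝ 2 (fun z : E n => ‖z‖ ^ 2) := contDiff_id.norm_sq ℝ
    fun_prop
  have h2 : ContDiffAt ℝ 2 (greenDir x) y := by
    unfold greenDir
    have : ContDiff ℝ 2 (fun z : E n => inner ℝ x z) := contDiff_const.inner ℝ contDiff_id
    have : ContDiff ℝ 2 (fun z : E n => ‖z‖ ^ 2) := contDiff_id.norm_sq ℝ
    fun_prop
  have h3 : ContDiffAt ℝ 2 (fun z => (Real.sqrt (greenDenom x z))⁻¹ ^ (n + 1) • greenDir x z) y :=
    (((h1.sqrt h.ne').inv (Real.sqrt_pos.2 h).ne').pow _).smul h2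
  exact h3.const_smul _

/-- The ball version of the Poisson kernel is the flux density of `greenField` on the sphere. -/
lemma inner_greenField_of_norm_eq_one {x y : E n} (hx : ‖x‖ < 1) (hy : ‖y‖ = 1) :
    inner ℝ (greenField x y) y = -(2 ^ (n - 1)) * ((1 - ‖x‖ ^ 2) / ‖x - y‖ ^ 2) ^ n := by
  have hxy : 0 < ‖x - y‖ := by
    rw [norm_pos_iff, sub_ne_zero]
    rintro rfl
    linarith
  have h1 : greenDenom x y = (‖x - y‖ ^ 2) ^ 2 := by
    rw [greenDenom, hy]
    ring
  have h2 : inner ℝ (greenDir x y) y = ‖x - y‖ ^ 2 := by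
    rw [greenDir, hy, inner_sub_left, inner_smul_left, inner_smul_left, real_inner_self_eq_norm_sq,
      norm_sub_sq_eq, hy]
    simp
    ring
  rw [greenField, inner_smul_left, inner_smul_left, h2, h1, Real.sqrt_sq (by positivity)]
  simp only [conj_trivial]
  have h3 : (‖x - y‖ ^ 2)⁻¹ ^ (n + 1) * ‖x - y‖ ^ 2 = (‖x - y‖ ^ 2)⁻¹ ^ n := by
    rw [pow_succ, mul_assoc, inv_mul_cancel₀ (by positivity), mul_one]
  rw [h3, div_eq_mul_inv, mul_pow]
  ring

/-! ### The Green's function of the ball -/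

lemma moebiusNorm_eq_sqrt (x y : E n) : moebiusNorm x y =
    Real.sqrt (‖x - y‖ ^ 2 * (‖x - y‖ ^ 2 + (1 - ‖x‖ ^ 2) * (1 - ‖y‖ ^ 2))⁻¹) := by
  rw [moebiusNorm, ← div_eq_mul_inv, Real.sqrt_div (by positivity), Real.sqrt_sq (norm_nonneg _)]

lemma quad_pos {x y : E n} (hx : ‖x‖ < 1) (hy : ‖y‖ < 1) :
    0 < ‖x - y‖ ^ 2 + (1 - ‖x‖ ^ 2) * (1 - ‖y‖ ^ 2) := by
  have := one_sub_sq_pos hx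
  have := one_sub_sq_pos hy
  positivity

lemma greenDenom_pos {x y : E n} (hx : ‖x‖ < 1) (hy : ‖y‖ < 1) (hxy : x ≠ y) :
    0 < greenDenom x y := by
  have := quad_pos hx hy
  have := norm_pos_iff.2 (sub_ne_zero.2 hxy)
  unfold greenDenom
  positivity

lemma moebiusNorm_lt_one {x y : E n} (hx : ‖x‖ < 1) (hy : ‖y‖ < 1) : moebiusNorm x y < 1 := by
  have h1 := one_sub_sq_pos hx
  have h2 := one_sub_sq_pos hy
  rw [moebiusNorm, div_lt_one (Real.sqrt_pos.2 (quad_pos hx hy))]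
  apply Real.lt_sqrt_of_sq_lt
  nlinarith [mul_pos h1 h2]

lemma moebiusNorm_pos {x y : E n} (hx : ‖x‖ < 1) (hy : ‖y‖ < 1) (hxy : x ≠ y) :
    0 < moebiusNorm x y :=
  div_pos (norm_pos_iff.2 (sub_ne_zero.2 hxy)) (Real.sqrt_pos.2 (quad_pos hx hy))

/-- The integrand of the Green's function. -/
def greenIntegrand (n : ℕ) (t : ℝ) : ℝ := (1 - t ^ 2) ^ (n - 1) / t ^ n

lemma continuousOn_greenIntegrand (n : ℕ) : ContinuousOn (greenIntegrand n) (Set.Ioi 0) := by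
  unfold greenIntegrand
  refine ContinuousOn.div (by fun_prop) (by fun_prop) fun t ht => ?_
  exact pow_ne_zero _ (ne_of_gt ht)

lemma intervalIntegrable_greenIntegrand (n : ℕ) {m m' : ℝ} (hm : 0 < m) (hm' : 0 < m') :
    IntervalIntegrable (greenIntegrand n) volume m m' := by
  apply ContinuousOn.intervalIntegrable
  refine (continuousOn_greenIntegrand n).mono fun t ht => ?_
  have := ht.1
  exact lt_of_lt_of_le (lt_min hm hm') this

lemma hasDerivAt_greenIntegral (n : ℕ) {m : ℝ} (hm : 0 < m) :
    HasDerivAt (fun u => ∫ t in u..1, greenIntegrand n t) (-greenIntegrand n m) m := by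
  refine intervalIntegral.integral_hasDerivAt_left
    (intervalIntegrable_greenIntegrand n hm one_pos) ?_ ?_
  · exact (continuousOn_greenIntegrand n).stronglyMeasurableAtFilter isOpen_Ioi m hm
  · exact (continuousOn_greenIntegrand n).continuousAt (Ioi_mem_nhds hm)

lemma greenIntegrand_nonneg (n : ℕ) {t : ℝ} (h0 : 0 < t) (h1 : t ≤ 1) : 0 ≤ greenIntegrand n t := by
  have : 0 ≤ 1 - t ^ 2 := by nlinarith
  unfold greenIntegrand
  positivity

lemma greenIntegrand_pos (n : ℕ) {t : ℝ} (h0 : 0 < t) (h1 : t < 1) : 0 < greenIntegrand n t := by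
  have : 0 < 1 - t ^ 2 := by nlinarith
  unfold greenIntegrand
  positivity

lemma ballGreen_pos {x y : E n} (hx : ‖x‖ < 1) (hy : ‖y‖ < 1) (hxy : x ≠ y) :
    0 < ballGreen x y := by
  have h0 := moebiusNorm_pos hx hy hxy
  have h1 := moebiusNorm_lt_one hx hy
  exact intervalIntegral.intervalIntegral_pos_of_pos_on
    (intervalIntegrable_greenIntegrand n h0 one_pos)
    (fun t ht => greenIntegrand_pos n (h0.trans ht.1) ht.2) h1

lemma one_sub_moebiusNorm_sq {x y : E n} (hx : ‖x‖ < 1) (hy : ‖y‖ < 1) :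
    1 - moebiusNorm x y ^ 2 = (1 - ‖x‖ ^ 2) * (1 - ‖y‖ ^ 2) /
      (‖x - y‖ ^ 2 + (1 - ‖x‖ ^ 2) * (1 - ‖y‖ ^ 2)) := by
  have := quad_pos hx hy
  rw [moebiusNorm, div_pow, Real.sq_sqrt this.le]
  field_simp
  ring

/-- The integrand decreases, and the length `1 - m` of the interval supplies the missing factor `1 -
m^2`. The resulting decay of order `n` is what the Poincaré series can sum. -/
lemma greenIntegral_le (n : ℕ) (hn : 1 ≤ n) {m : ℝ} (h0 : 0 < m) (h1 : m < 1) :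
    ∫ t in m..1, greenIntegrand n t ≤ (1 - m ^ 2) ^ n / m ^ n := by
  have hb : 0 < 1 - m ^ 2 := by nlinarith
  calc ∫ t in m..1, greenIntegrand n t ≤ ∫ _t in m..1, (1 - m ^ 2) ^ (n - 1) / m ^ n := by
        refine intervalIntegral.integral_mono_on h1.le
          (intervalIntegrable_greenIntegrand n h0 one_pos) (by simp) fun t ht => ?_
        have ht0 : 0 < t := h0.trans_le ht.1
        have h2 : 0 ≤ 1 - t ^ 2 := by nlinarith [ht.2]
        have h3 : 1 - t ^ 2 ≤ 1 - m ^ 2 := by nlinarith [ht.1]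
        exact div_le_div₀ (by positivity) (pow_le_pow_left₀ h2 h3 _) (by positivity)
          (pow_le_pow_left₀ h0.le ht.1 _)
    _ = (1 - m) * ((1 - m ^ 2) ^ (n - 1) / m ^ n) := by
        rw [intervalIntegral.integral_const, smul_eq_mul]
    _ ≤ (1 - m ^ 2) * ((1 - m ^ 2) ^ (n - 1) / m ^ n) := by
        gcongr
        nlinarith
    _ = (1 - m ^ 2) ^ n / m ^ n := by
        obtain ⟨k, rfl⟩ : ∃ k, n = k + 1 := ⟨n - 1, by omega⟩
        rw [add_tsub_cancel_right, pow_succ (1 - m ^ 2)]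
        ring

/-- The gradient of the Green's function of the ball. -/
lemma hasFDerivAt_ballGreen (hn : 1 ≤ n) {x y : E n} (hx : ‖x‖ < 1) (hy : ‖y‖ < 1) (hxy : x ≠ y) :
    HasFDerivAt (ballGreen x) (innerSL ℝ (((1 - ‖y‖ ^ 2) / 2) ^ (n - 1) • greenField x y)) y := by
  have hm := moebiusNorm_pos hx hy hxy
  have hQ := quad_pos hx hy
  have hz : 0 < ‖x - y‖ := norm_pos_iff.2 (sub_ne_zero.2 hxy)
  have h1 := hasFDerivAt_norm_sub_sq' x y
  have hQd := h1.add (((hasFDerivAt_norm_sq' y).const_sub 1).const_mul (1 - ‖x‖ ^ 2))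
  have h2 := h1.mul ((hasDerivAt_inv hQ.ne').comp_hasFDerivAt y hQd)
  have hpos : 0 < ‖x - y‖ ^ 2 * (‖x - y‖ ^ 2 + (1 - ‖x‖ ^ 2) * (1 - ‖y‖ ^ 2))⁻¹ := by positivity
  have h3 : HasFDerivAt (moebiusNorm x) _ y :=
    HasFDerivAt.congr_of_eventuallyEq ((Real.hasDerivAt_sqrt hpos.ne').comp_hasFDerivAt y h2)
      (Filter.Eventually.of_forall fun z => moebiusNorm_eq_sqrt x z)
  have h4 := (hasDerivAt_greenIntegral n hm).comp_hasFDerivAt y h3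
  refine HasFDerivAt.congr_fderiv (f := ballGreen x) h4 ?_
  ext v
  have hm2 : Real.sqrt (‖x - y‖ ^ 2 * (‖x - y‖ ^ 2 + (1 - ‖x‖ ^ 2) * (1 - ‖y‖ ^ 2))⁻¹) =
      ‖x - y‖ / Real.sqrt (‖x - y‖ ^ 2 + (1 - ‖x‖ ^ 2) * (1 - ‖y‖ ^ 2)) :=
    (moebiusNorm_eq_sqrt x y).symm
  have hden : Real.sqrt (greenDenom x y) =
      ‖x - y‖ * Real.sqrt (‖x - y‖ ^ 2 + (1 - ‖x‖ ^ 2) * (1 - ‖y‖ ^ 2)) := by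
    rw [greenDenom, Real.sqrt_mul (by positivity), Real.sqrt_sq (norm_nonneg _)]
  -- The numerator of the quotient rule for the square of `moebiusNorm` is a multiple of `greenDir`.
  have hdir : inner ℝ (greenDir x y) v * (2 * (1 - ‖x‖ ^ 2)) =
      (‖x - y‖ ^ 2 + (1 - ‖x‖ ^ 2) * (1 - ‖y‖ ^ 2)) * (2 * inner ℝ (y - x) v) -
      ‖x - y‖ ^ 2 * (2 * inner ℝ (y - x) v - (1 - ‖x‖ ^ 2) * (2 * inner ℝ y v)) := by
    rw [greenDir, inner_sub_left, inner_sub_left, inner_smul_left, inner_smul_left, norm_sub_sq_eq]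
    simp only [conj_trivial]
    ring
  simp only [smul_apply, add_apply, neg_apply, innerSL_apply_apply, smul_eq_mul,
    map_smul, greenField, hden, greenIntegrand, moebiusNorm, hm2]
  set q := Real.sqrt (‖x - y‖ ^ 2 + (1 - ‖x‖ ^ 2) * (1 - ‖y‖ ^ 2)) with hq
  have hq2 : ‖x - y‖ ^ 2 + (1 - ‖x‖ ^ 2) * (1 - ‖y‖ ^ 2) = q ^ 2 := (Real.sq_sqrt hQ.le).symm
  have hq0 : 0 < q := Real.sqrt_pos.2 hQ
  set z := ‖x - y‖ with hzz
  set a := 1 - ‖x‖ ^ 2 with ha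
  set b := 1 - ‖y‖ ^ 2 with hb
  rw [hq2] at hdir ⊢
  have ha0 : 0 < a := one_sub_sq_pos hx
  have h5 : 1 - (z / q) ^ 2 = a * b / q ^ 2 := by
    field_simp
    linarith
  rw [h5]
  set W := inner ℝ (greenDir x y) v
  set I1 := inner ℝ (y - x) v
  set I2 := inner ℝ y v
  obtain ⟨k, rfl⟩ : ∃ k, n = k + 1 := ⟨n - 1, by omega⟩
  rw [add_tsub_cancel_right]
  have h6 : z ^ 2 * (-((q ^ 2) ^ 2)⁻¹ * (2 * I1 + a * -(2 * I2))) + (q ^ 2)⁻¹ * (2 * I1) =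
      W * (2 * a) / q ^ 4 := by
    rw [hdir]
    field_simp
    ring
  have e : ((fun y => y⁻¹) ∘ ((fun z => ‖x - z‖ ^ 2) + fun y => a * (1 - ‖y‖ ^ 2))) y =
      (q ^ 2)⁻¹ := by
    rw [← hq2]
    rfl
  rw [e, h6]
  simp only [div_pow, mul_pow, inv_pow, pow_succ]
  field_simp
  rw [one_pow, mul_one]

/-! ### Bounds for the kernel away from the pole -/

lemma one_sub_sq_nonneg {x : E n} (hx : ‖x‖ ≤ 1) : 0 ≤ 1 - ‖x‖ ^ 2 := by
  nlinarith [norm_nonneg x]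

lemma abs_greenDir_coeff_le {x y : E n} (hx : ‖x‖ ≤ 1) (hy : ‖y‖ ≤ 1) :
    |1 - 2 * inner ℝ x y + ‖x‖ ^ 2| ≤ 4 := by
  have h1 := abs_le.1 (abs_real_inner_le_norm x y)
  have h2 : ‖x‖ * ‖y‖ ≤ 1 := mul_le_one₀ hx (norm_nonneg _) hy
  have h3 : ‖x‖ ^ 2 ≤ 1 := pow_le_one₀ (norm_nonneg _) hx
  rw [abs_le]
  constructor <;> nlinarith [sq_nonneg ‖x‖]

lemma norm_greenDir_le {x y : E n} (hx : ‖x‖ ≤ 1) (hy : ‖y‖ ≤ 1) : ‖greenDir x y‖ ≤ 5 := by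
  have h1 := abs_greenDir_coeff_le hx hy
  have h2 := one_sub_sq_nonneg hy
  rw [greenDir]
  refine (norm_sub_le _ _).trans ?_
  rw [norm_smul, norm_smul, Real.norm_eq_abs, Real.norm_of_nonneg h2]
  have h3 := mul_le_mul h1 hy (norm_nonneg _) (by norm_num)
  have h4 : (1 - ‖y‖ ^ 2) * ‖x‖ ≤ 1 * 1 :=
    mul_le_mul (by nlinarith [sq_nonneg ‖y‖]) hx (norm_nonneg _) (by norm_num)
  linarith

lemma norm_greenDirDeriv_le {x y : E n} (hx : ‖x‖ ≤ 1) (hy : ‖y‖ ≤ 1) :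
    ‖greenDirDeriv x y‖ ≤ 8 := by
  have h1 := abs_greenDir_coeff_le hx hy
  have h2 : ‖x‖ * ‖y‖ ≤ 1 := mul_le_one₀ hx (norm_nonneg _) hy
  rw [greenDirDeriv]
  refine (norm_add_le _ _).trans ?_
  have e1 := norm_add_le ((1 - 2 * inner ℝ x y + ‖x‖ ^ 2) • ContinuousLinearMap.id ℝ (E n))
    (((-2 : ℝ) • innerSL ℝ x).smulRight y)
  have e2 : ‖(1 - 2 * inner ℝ x y + ‖x‖ ^ 2) • ContinuousLinearMap.id ℝ (E n)‖ ≤ 4 * 1 := by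
    rw [norm_smul, Real.norm_eq_abs]
    exact mul_le_mul h1 ContinuousLinearMap.norm_id_le (norm_nonneg _) (by norm_num)
  have e3 : ‖((-2 : ℝ) • innerSL ℝ x).smulRight y‖ ≤ 2 := by
    rw [ContinuousLinearMap.norm_smulRight_apply, norm_smul, innerSL_apply_norm]
    norm_num
    linarith
  have e4 : ‖((2 : ℝ) • innerSL ℝ y).smulRight x‖ ≤ 2 := by
    rw [ContinuousLinearMap.norm_smulRight_apply, norm_smul, innerSL_apply_norm]
    norm_num
    linarith
  linarith

lemma norm_greenDenomDeriv_le {x y : E n} (hx : ‖x‖ ≤ 1) (hy : ‖y‖ ≤ 1) :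
    ‖greenDenomDeriv x y‖ ≤ 44 := by
  have ha := one_sub_sq_nonneg hx
  have hb := one_sub_sq_nonneg hy
  have ha1 : 1 - ‖x‖ ^ 2 ≤ 1 := by nlinarith [sq_nonneg ‖x‖]
  have hb1 : 1 - ‖y‖ ^ 2 ≤ 1 := by nlinarith [sq_nonneg ‖y‖]
  have hz : ‖x - y‖ ≤ 2 := (norm_sub_le _ _).trans (by linarith)
  have hZ : ‖x - y‖ ^ 2 ≤ 4 := by nlinarith [norm_nonneg (x - y)]
  have hab : (1 - ‖x‖ ^ 2) * (1 - ‖y‖ ^ 2) ≤ 1 := mul_le_one₀ ha1 hb hb1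
  have haZ : (1 - ‖x‖ ^ 2) * ‖x - y‖ ^ 2 ≤ 1 * 4 :=
    mul_le_mul ha1 hZ (sq_nonneg _) (by norm_num)
  rw [greenDenomDeriv]
  refine (norm_sub_le _ _).trans ?_
  rw [norm_smul, norm_smul, innerSL_apply_norm, innerSL_apply_norm,
    Real.norm_of_nonneg (by positivity), Real.norm_of_nonneg (by positivity), norm_sub_rev y x]
  have h1 : 2 * (2 * ‖x - y‖ ^ 2 + (1 - ‖x‖ ^ 2) * (1 - ‖y‖ ^ 2)) * ‖x - y‖ ≤ 18 * 2 :=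
    mul_le_mul (by linarith) hz (norm_nonneg _) (by norm_num)
  have h2 : 2 * (1 - ‖x‖ ^ 2) * ‖x - y‖ ^ 2 * ‖y‖ ≤ 8 * 1 :=
    mul_le_mul (by linarith) hy (norm_nonneg _) (by norm_num)
  linarith

lemma sq_le_sqrt_greenDenom {x y : E n} (hx : ‖x‖ ≤ 1) (hy : ‖y‖ ≤ 1) {δ : ℝ} (hδ : 0 < δ)
    (h : δ ≤ ‖x - y‖) : δ ^ 2 ≤ Real.sqrt (greenDenom x y) := by
  apply Real.le_sqrt_of_sq_le
  have h1 : δ ^ 2 ≤ ‖x - y‖ ^ 2 := pow_le_pow_left₀ hδ.le h 2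
  have h2 : 0 ≤ (1 - ‖x‖ ^ 2) * (1 - ‖y‖ ^ 2) :=
    mul_nonneg (one_sub_sq_nonneg hx) (one_sub_sq_nonneg hy)
  have h3 : 0 ≤ δ ^ 2 := by positivity
  rw [greenDenom]
  nlinarith

/-- Bounds for the kernel and its differential, uniform in the pole. -/
lemma exists_greenField_bound (n : ℕ) {δ : ℝ} (hδ : 0 < δ) :
    ∃ C : ℝ, 0 ≤ C ∧ ∀ x y : E n, ‖x‖ ≤ 1 → ‖y‖ ≤ 1 → δ ≤ ‖x - y‖ →
      ‖greenField x y‖ ≤ C * (1 - ‖x‖ ^ 2) ^ n ∧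
        ‖greenFieldDeriv x y‖ ≤ C * (1 - ‖x‖ ^ 2) ^ n := by
  set ρ : ℝ := (δ ^ 2)⁻¹ with hρ
  have hρ0 : 0 < ρ := by positivity
  refine ⟨2 ^ (n - 1) * (ρ ^ (n + 1) * 8 + ((n : ℝ) + 1) / 2 * ρ ^ (n + 1) * ρ ^ 2 * 44 * 5),
    by positivity, fun x y hx hy h => ?_⟩
  have ha := one_sub_sq_nonneg hx
  have hsq := sq_le_sqrt_greenDenom hx hy hδ h
  have hs0 : 0 < Real.sqrt (greenDenom x y) := lt_of_lt_of_le (by positivity) hsq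
  have hR : (Real.sqrt (greenDenom x y))⁻¹ ≤ ρ := inv_anti₀ (by positivity) hsq
  have hRn : (Real.sqrt (greenDenom x y))⁻¹ ^ (n + 1) ≤ ρ ^ (n + 1) :=
    pow_le_pow_left₀ (by positivity) hR _
  have hg0 : 0 < greenDenom x y := Real.sqrt_pos.1 hs0
  have hR2 : (greenDenom x y)⁻¹ ≤ ρ ^ 2 := by
    have : (greenDenom x y)⁻¹ = (Real.sqrt (greenDenom x y))⁻¹ ^ 2 := by
      rw [inv_pow, Real.sq_sqrt hg0.le]
    rw [this]
    exact pow_le_pow_left₀ (by positivity) hR _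
  have hc : ‖(-(2 ^ (n - 1) * (1 - ‖x‖ ^ 2) ^ n) : ℝ)‖ = 2 ^ (n - 1) * (1 - ‖x‖ ^ 2) ^ n := by
    rw [norm_neg, Real.norm_of_nonneg (by positivity)]
  have h1 := norm_greenDir_le hx hy
  have h2 := norm_greenDirDeriv_le hx hy
  have h3 := norm_greenDenomDeriv_le hx hy
  constructor
  · rw [greenField, norm_smul, hc, norm_smul, Real.norm_of_nonneg (by positivity)]
    have h4 : (Real.sqrt (greenDenom x y))⁻¹ ^ (n + 1) * ‖greenDir x y‖ ≤ ρ ^ (n + 1) * 5 :=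
      mul_le_mul hRn h1 (norm_nonneg _) (by positivity)
    have h5 : ρ ^ (n + 1) * 5 ≤
        ρ ^ (n + 1) * 8 + ((n : ℝ) + 1) / 2 * ρ ^ (n + 1) * ρ ^ 2 * 44 * 5 := by
      have : 0 ≤ ((n : ℝ) + 1) / 2 * ρ ^ (n + 1) * ρ ^ 2 * 44 * 5 := by positivity
      have : 0 < ρ ^ (n + 1) := by positivity
      linarith
    calc _ ≤ 2 ^ (n - 1) * (1 - ‖x‖ ^ 2) ^ n *
          (ρ ^ (n + 1) * 8 + ((n : ℝ) + 1) / 2 * ρ ^ (n + 1) * ρ ^ 2 * 44 * 5) := by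
          gcongr
          exact h4.trans h5
      _ = _ := by ring
  · rw [greenFieldDeriv, norm_smul, hc]
    calc _ ≤ 2 ^ (n - 1) * (1 - ‖x‖ ^ 2) ^ n *
          (ρ ^ (n + 1) * 8 + ((n : ℝ) + 1) / 2 * ρ ^ (n + 1) * ρ ^ 2 * 44 * 5) := by
          gcongr
          refine (norm_add_le _ _).trans (add_le_add ?_ ?_)
          · rw [norm_smul, Real.norm_of_nonneg (by positivity)]
            exact mul_le_mul hRn h2 (norm_nonneg _) (by positivity)
          · have e : |-((n : ℝ) + 1) / 2| = ((n : ℝ) + 1) / 2 := by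
              rw [neg_div, abs_neg, abs_of_nonneg (by positivity)]
            rw [ContinuousLinearMap.norm_smulRight_apply, norm_smul, norm_mul, norm_mul,
              Real.norm_eq_abs, e, Real.norm_of_nonneg (by positivity),
              Real.norm_of_nonneg (by positivity)]
            gcongr
      _ = _ := by ring

/-- Off the pole `moebiusNorm ≥ δ / 3`, since its denominator is at most 3. The factor in `x` gives
summability over an orbit, the factor in `y` vanishing at the sphere. -/
lemma ballGreen_le (hn : 1 ≤ n) {x y : E n} (hx : ‖x‖ < 1) (hy : ‖y‖ < 1) {δ : ℝ} (hδ : 0 < δ)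
    (h : δ ≤ ‖x - y‖) :
    ballGreen x y ≤ (3 * (1 - ‖x‖ ^ 2) * (1 - ‖y‖ ^ 2) / δ ^ 3) ^ n := by
  have hxy : x ≠ y := by
    rintro rfl
    rw [sub_self, norm_zero] at h
    linarith
  have hm := moebiusNorm_pos hx hy hxy
  have hm1 := moebiusNorm_lt_one hx hy
  have ha := one_sub_sq_pos hx
  have hb := one_sub_sq_pos hy
  refine (greenIntegral_le n hn hm hm1).trans ?_
  rw [← div_pow]
  have hQ := quad_pos hx hy
  refine pow_le_pow_left₀ (div_nonneg (by nlinarith) hm.le) ?_ n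
  rw [one_sub_moebiusNorm_sq hx hy]
  have hz : ‖x - y‖ ≤ 2 := (norm_sub_le _ _).trans (by linarith)
  have h1 : δ / 3 ≤ moebiusNorm x y := by
    rw [moebiusNorm]
    have : Real.sqrt (‖x - y‖ ^ 2 + (1 - ‖x‖ ^ 2) * (1 - ‖y‖ ^ 2)) ≤ 3 := by
      rw [Real.sqrt_le_iff]
      refine ⟨by norm_num, ?_⟩
      have : (1 - ‖x‖ ^ 2) * (1 - ‖y‖ ^ 2) ≤ 1 :=
        mul_le_one₀ (by nlinarith [sq_nonneg ‖x‖]) hb.le (by nlinarith [sq_nonneg ‖y‖])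
      nlinarith [norm_nonneg (x - y)]
    exact div_le_div₀ (norm_nonneg _) h (Real.sqrt_pos.2 hQ) this
  have h2 : δ ^ 2 ≤ ‖x - y‖ ^ 2 + (1 - ‖x‖ ^ 2) * (1 - ‖y‖ ^ 2) := by
    have := pow_le_pow_left₀ hδ.le h 2
    nlinarith [mul_pos ha hb]
  calc _ ≤ (1 - ‖x‖ ^ 2) * (1 - ‖y‖ ^ 2) / δ ^ 2 / (δ / 3) := by gcongr
    _ = _ := by
      field_simp

/-- The Green's function blows up at its pole. -/
lemma tendsto_greenIntegral (hn : 1 ≤ n) :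
    Filter.Tendsto (fun m => ∫ t in m..1, greenIntegrand n t) (nhdsWithin 0 (Set.Ioi 0))
      Filter.atTop := by
  -- On `(0, 1 / 2]` one has `1 - t^2 ≥ 3 / 4` and `t^n ≤ t`, so the integrand dominates a multiple
  -- of `1 / t` for every `n ≥ 1`.
  have h1 : Filter.Tendsto (fun m : ℝ => (3 / 4 : ℝ) ^ (n - 1) * (Real.log (1 / 2) - Real.log m))
      (nhdsWithin 0 (Set.Ioi 0)) Filter.atTop := by
    refine Filter.Tendsto.const_mul_atTop (by positivity) ?_
    simp only [sub_eq_add_neg]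
    exact Filter.tendsto_atTop_add_const_left _ _
      (Filter.tendsto_neg_atBot_atTop.comp Real.tendsto_log_nhdsGT_zero)
  refine Filter.tendsto_atTop_mono' _ ?_ h1
  filter_upwards [Ioo_mem_nhdsGT (show (0 : ℝ) < 1 / 2 by norm_num)] with m hm
  have hm0 := hm.1
  rw [← intervalIntegral.integral_add_adjacent_intervals
    (intervalIntegrable_greenIntegrand n hm0 (show (0 : ℝ) < 1 / 2 by norm_num))
    (intervalIntegrable_greenIntegrand n (show (0 : ℝ) < 1 / 2 by norm_num) one_pos)]
  have h2 : 0 ≤ ∫ t in (1 / 2 : ℝ)..1, greenIntegrand n t :=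
    intervalIntegral.integral_nonneg (by norm_num) fun t ht =>
      greenIntegrand_nonneg n (by linarith [ht.1]) ht.2
  have h3 : ∫ t in m..(1 / 2), (3 / 4 : ℝ) ^ (n - 1) * t⁻¹ ≤
      ∫ t in m..(1 / 2), greenIntegrand n t := by
    refine intervalIntegral.integral_mono_on hm.2.le ?_
      (intervalIntegrable_greenIntegrand n hm0 (by norm_num)) fun t ht => ?_
    · apply ContinuousOn.intervalIntegrable
      refine ContinuousOn.mul continuousOn_const (continuousOn_inv₀.mono fun t ht => ?_)
      rw [Set.uIcc_of_le hm.2.le] at ht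
      exact (hm0.trans_le ht.1).ne'
    · have ht0 : 0 < t := hm0.trans_le ht.1
      rw [greenIntegrand, ← div_eq_mul_inv]
      refine div_le_div₀ (pow_nonneg (by nlinarith [ht.2]) _)
        (pow_le_pow_left₀ (by norm_num) (by nlinarith [ht.2]) _) (by positivity) ?_
      exact pow_le_of_le_one ht0.le (by linarith [ht.2]) (by omega)
  rw [intervalIntegral.integral_const_mul, integral_inv_of_pos hm0 (by norm_num),
    Real.log_div (by norm_num) hm0.ne'] at h3
  linarith

lemma tendsto_ballGreen (hn : 1 ≤ n) {x : E n} (hx : ‖x‖ < 1) :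
    Filter.Tendsto (ballGreen x) (nhdsWithin x {x}ᶜ) Filter.atTop := by
  refine (tendsto_greenIntegral hn).comp (tendsto_nhdsWithin_iff.2 ⟨?_, ?_⟩)
  · have h1 : ContinuousAt (moebiusNorm x) x := by
      unfold moebiusNorm
      refine ContinuousAt.div (by fun_prop) (by fun_prop) (Real.sqrt_pos.2 (quad_pos hx hx)).ne'
    have h2 : moebiusNorm x x = 0 := by simp [moebiusNorm]
    have := h1.tendsto
    rw [h2] at this
    exact this.mono_left nhdsWithin_le_nhds
  · have : ∀ᶠ y in nhdsWithin x {x}ᶜ, ‖y‖ < 1 :=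
      nhdsWithin_le_nhds ((isOpen_lt continuous_norm continuous_const).mem_nhds hx)
    filter_upwards [this, self_mem_nhdsWithin] with y hy hyx
    exact moebiusNorm_pos hx hy fun h => hyx h.symm

/-! ### Harmonicity of superpositions of Green's functions -/

lemma laplacian_eq_sum (u : E n → ℝ) (y : E n) : Laplacian.laplacian u y =
    ∑ i, fderiv ℝ (fderiv ℝ u) y (EuclideanSpace.single i 1) (EuclideanSpace.single i 1) := by
  rw [InnerProductSpace.laplacian_eq_iteratedFDeriv_orthonormalBasis u
    (EuclideanSpace.basisFun (Fin (n + 1)) ℝ)]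
  simp [iteratedFDeriv_two_apply]

/-- A function whose gradient is the hyperbolic weight times a divergence free field is harmonic. -/
lemma hypHarmonicOn_of_field (hn : 1 ≤ n) {V : Set (E n)} (hV : IsOpen V) (hVb : V ⊆ Metric.ball 0 1)
    {u : E n → ℝ} {X : E n → E n} {X' : E n → E n →L[ℝ] E n}
    (hu : ∀ y ∈ V, HasFDerivAt u (innerSL ℝ (((1 - ‖y‖ ^ 2) / 2) ^ (n - 1) • X y)) y)
    (hX : ∀ y ∈ V, HasFDerivAt X (X' y) y) (hX' : ContinuousOn X' V)
    (htr : ∀ y ∈ V, coordTrace (X' y) = 0) : HypHarmonicOn u V := by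
  have hXd : ContDiffOn ℝ 1 X V := by
    have h := contDiffOn_succ_iff_fderiv_of_isOpen (𝕜 := ℝ) (n := 0) (f := X) hV
    rw [zero_add] at h
    refine h.2 ⟨fun y hy => (hX y hy).differentiableAt.differentiableWithinAt, by simp, ?_⟩
    rw [contDiffOn_zero]
    exact hX'.congr fun y hy => (hX y hy).fderiv
  have hfd : ∀ y ∈ V, fderiv ℝ u y = innerSL ℝ (((1 - ‖y‖ ^ 2) / 2) ^ (n - 1) • X y) :=
    fun y hy => (hu y hy).fderiv
  have hw : ContDiff ℝ 1 (fun y : E n => ((1 - ‖y‖ ^ 2) / 2) ^ (n - 1)) := by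
    have : ContDiff ℝ 1 (fun z : E n => ‖z‖ ^ 2) := contDiff_id.norm_sq ℝ
    fun_prop
  refine ⟨?_, fun y hy => ?_⟩
  · have h := contDiffOn_succ_iff_fderiv_of_isOpen (𝕜 := ℝ) (n := 1) (f := u) hV
    rw [one_add_one_eq_two] at h
    refine h.2 ⟨fun y hy => (hu y hy).differentiableAt.differentiableWithinAt, by simp, ?_⟩
    refine ContDiffOn.congr ?_ hfd
    exact (innerSL ℝ : E n →L[ℝ] E n →L[ℝ] ℝ).contDiff.comp_contDiffOn (hw.contDiffOn.smul hXd)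
  · have hyb : ‖y‖ < 1 := by simpa using hVb hy
    have hs := one_sub_sq_pos hyb
    have h1 : HasFDerivAt (fun y : E n => (1 - ‖y‖ ^ 2) / 2)
        ((2 : ℝ)⁻¹ • -((2 : ℝ) • innerSL ℝ y)) y := by
      refine HasFDerivAt.congr_of_eventuallyEq (((hasFDerivAt_norm_sq' y).const_sub 1).const_mul
        (2 : ℝ)⁻¹) (Filter.Eventually.of_forall fun z => ?_)
      beta_reduce
      rw [div_eq_inv_mul]
    have h2 := (h1.pow (n - 1)).smul (hX y hy)
    have h3 := (innerSL ℝ : E n →L[ℝ] E n →L[ℝ] ℝ).hasFDerivAt.comp y h2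
    set M := (((1 - ‖y‖ ^ 2) / 2) ^ (n - 1) • X' y +
        (((n - 1) • ((1 - ‖y‖ ^ 2) / 2) ^ (n - 1 - 1)) •
          ((2 : ℝ)⁻¹ • -((2 : ℝ) • innerSL ℝ y))).smulRight (X y)) with hM
    have h4 : fderiv ℝ (fderiv ℝ u) y = (innerSL ℝ : E n →L[ℝ] E n →L[ℝ] ℝ) ∘SL M := by
      refine HasFDerivAt.fderiv (HasFDerivAt.congr_of_eventuallyEq h3 ?_)
      filter_upwards [hV.mem_nhds hy] with z hz
      exact hfd z hz
    have h5 : Laplacian.laplacian u y = coordTrace M := by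
      rw [laplacian_eq_sum, h4, coordTrace]
      refine Finset.sum_congr rfl fun i _ => ?_
      rw [ContinuousLinearMap.comp_apply, innerSL_apply_apply]
      simp [EuclideanSpace.inner_single_right]
    -- For `w = ((1 - |y|^2) / 2)^(n - 1)`, `div (w X) = w div X + ∇w · X`. The first term vanishes,
    -- and since `∇w = -2 (n - 1) / (1 - |y|^2) w y`, the second cancels the drift term of the
    -- hyperbolic Laplacian.
    rw [h5, hM, coordTrace_add, coordTrace_smul, htr y hy, coordTrace_smulRight, hfd y hy]
    simp only [smul_apply, neg_apply, innerSL_apply_apply, smul_eq_mul, inner_smul_left,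
      conj_trivial, real_inner_comm, nsmul_eq_mul]
    obtain ⟨k, rfl⟩ : ∃ k, n = k + 1 := ⟨n - 1, by omega⟩
    rcases k with _ | j
    · simp
    · simp only [add_tsub_cancel_right]
      push_cast
      rw [pow_succ]
      field_simp
      ring

/-- Superpositions of Green's functions with poles away from an open set. -/
theorem greenSum_of_summable (hn : 1 ≤ n) {ι : Type*} {p : ι → E n} (hp : ∀ i, ‖p i‖ < 1)
    (hs : Summable fun i => (1 - ‖p i‖ ^ 2) ^ n) {V : Set (E n)} (hV : IsOpen V)
    (hVb : V ⊆ Metric.ball 0 1) (hpV : ∀ y ∈ V, ∃ ρ > 0, ∀ i, ρ ≤ ‖p i - y‖) :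
    (∀ y ∈ V, Summable fun i => ballGreen (p i) y) ∧
    (∀ y ∈ V, Summable fun i => greenField (p i) y) ∧
    (∀ y ∈ V, HasFDerivAt (fun z => ∑' i, ballGreen (p i) z)
      (innerSL ℝ (((1 - ‖y‖ ^ 2) / 2) ^ (n - 1) • ∑' i, greenField (p i) y)) y) ∧
    HypHarmonicOn (fun z => ∑' i, ballGreen (p i) z) V := by
  have hball : ∀ y ∈ V, ‖y‖ < 1 := fun y hy => by simpa using hVb hy
  have hsum : ∀ y ∈ V, Summable fun i => ballGreen (p i) y := by
    intro y hy
    obtain ⟨ρ, hρ, h⟩ := hpV y hy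
    refine Summable.of_nonneg_of_le (fun i => (ballGreen_pos (hp i) (hball y hy) ?_).le)
      (fun i => ballGreen_le hn (hp i) (hball y hy) hρ (h i)) ?_
    · intro hi
      have := h i
      rw [hi, sub_self, norm_zero] at this
      linarith
    · refine (hs.mul_left ((3 * (1 - ‖y‖ ^ 2) / ρ ^ 3) ^ n)).congr fun i => ?_
      rw [← mul_pow]
      congr 1
      ring
  -- Bounds for fields and differentials that are uniform near `y` and summable in `i`: these permit
  -- differentiating the sums term by term.
  have hloc : ∀ y ∈ V, ∃ r > 0, ∃ C : ℝ, Metric.ball y r ⊆ V ∧ ∀ z ∈ Metric.ball y r, ∀ i,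
      ‖greenField (p i) z‖ ≤ C * (1 - ‖p i‖ ^ 2) ^ n ∧
      ‖greenFieldDeriv (p i) z‖ ≤ C * (1 - ‖p i‖ ^ 2) ^ n ∧ p i ≠ z := by
    intro y hy
    obtain ⟨ρ, hρ, h⟩ := hpV y hy
    obtain ⟨r, hr, hrV⟩ := Metric.isOpen_iff.1 hV y hy
    obtain ⟨C, -, hC⟩ := exists_greenField_bound n (half_pos hρ)
    refine ⟨min r (ρ / 2), lt_min hr (half_pos hρ), C,
      (Metric.ball_subset_ball (min_le_left _ _)).trans hrV, fun z hz i => ?_⟩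
    have hz1 : dist z y < ρ / 2 := lt_of_lt_of_le hz (min_le_right _ _)
    have hzV := hrV (Metric.ball_subset_ball (min_le_left _ _) hz)
    have hd : ρ / 2 ≤ ‖p i - z‖ := by
      have h1 := h i
      have h2 := norm_sub_le_norm_sub_add_norm_sub (p i) z y
      rw [dist_eq_norm] at hz1
      linarith
    have h3 := hC (p i) z (hp i).le (hball z hzV).le hd
    refine ⟨h3.1, h3.2, fun hcon => ?_⟩
    rw [hcon, sub_self, norm_zero] at hd
    linarith
  have hsumF : ∀ y ∈ V, Summable fun i => greenField (p i) y := by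
    intro y hy
    obtain ⟨r, hr, C, hrV, h⟩ := hloc y hy
    exact Summable.of_norm_bounded (hs.mul_left C) fun i => (h y (Metric.mem_ball_self hr) i).1
  have hder : ∀ y ∈ V, HasFDerivAt (fun z => ∑' i, ballGreen (p i) z)
      (innerSL ℝ (((1 - ‖y‖ ^ 2) / 2) ^ (n - 1) • ∑' i, greenField (p i) y)) y := by
    intro y hy
    obtain ⟨r, hr, C, hrV, h⟩ := hloc y hy
    have h1 := hasFDerivAt_tsum_of_isPreconnected (𝕜 := ℝ) (hs.mul_left C) Metric.isOpen_ball
      (convex_ball y r).isPreconnected (f := fun i => ballGreen (p i))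
      (f' := fun i z => innerSL ℝ (((1 - ‖z‖ ^ 2) / 2) ^ (n - 1) • greenField (p i) z))
      (fun i z hz => hasFDerivAt_ballGreen hn (hp i) (hball z (hrV hz)) (h z hz i).2.2)
      (fun i z hz => ?_) (Metric.mem_ball_self hr) (hsum y hy) (Metric.mem_ball_self hr)
    · refine h1.congr_fderiv ?_
      have h2 := ((hsumF y hy).hasSum.const_smul (((1 - ‖y‖ ^ 2) / 2) ^ (n - 1))).mapL
        (innerSL ℝ : E n →L[ℝ] E n →L[ℝ] ℝ)
      exact h2.tsum_eq
    · have hz0 := one_sub_sq_pos (hball z (hrV hz))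
      rw [innerSL_apply_norm, norm_smul, Real.norm_of_nonneg (by positivity)]
      have h2 : ((1 - ‖z‖ ^ 2) / 2) ^ (n - 1) ≤ 1 :=
        pow_le_one₀ (by positivity) (by nlinarith [sq_nonneg ‖z‖])
      calc _ ≤ 1 * ‖greenField (p i) z‖ := by gcongr
        _ ≤ _ := by
          rw [one_mul]
          exact (h z hz i).1
  refine ⟨hsum, hsumF, hder, ?_⟩
  refine hypHarmonicOn_of_field hn hV hVb (X' := fun y => ∑' i, greenFieldDeriv (p i) y) hder
    ?_ ?_ ?_
  · intro y hy
    obtain ⟨r, hr, C, hrV, h⟩ := hloc y hy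
    exact hasFDerivAt_tsum_of_isPreconnected (𝕜 := ℝ) (hs.mul_left C) Metric.isOpen_ball
      (convex_ball y r).isPreconnected (f := fun i => greenField (p i))
      (f' := fun i z => greenFieldDeriv (p i) z)
      (fun i z hz => hasFDerivAt_greenField
        (greenDenom_pos (hp i) (hball z (hrV hz)) (h z hz i).2.2))
      (fun i z hz => (h z hz i).2.1) (Metric.mem_ball_self hr) (hsumF y hy)
      (Metric.mem_ball_self hr)
  · intro y hy
    obtain ⟨r, hr, C, hrV, h⟩ := hloc y hy
    refine ContinuousAt.continuousWithinAt ?_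
    refine ContinuousOn.continuousAt ?_ (Metric.ball_mem_nhds y hr)
    refine continuousOn_tsum (fun i => ?_) (hs.mul_left C) fun i z hz => (h z hz i).2.1
    have hpos : ∀ z ∈ Metric.ball y r, 0 < greenDenom (p i) z := fun z hz =>
      greenDenom_pos (hp i) (hball z (hrV hz)) (h z hz i).2.2
    have h1 : ContDiffOn ℝ 2 (greenField (p i)) (Metric.ball y r) := fun z hz =>
      (contDiffAt_greenField (hpos z hz)).contDiffWithinAt
    exact (h1.continuousOn_fderiv_of_isOpen Metric.isOpen_ball (by norm_num)).congr fun z hz =>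
      (hasFDerivAt_greenField (hpos z hz)).fderiv.symm
  · intro y hy
    obtain ⟨r, hr, C, hrV, h⟩ := hloc y hy
    have h1 : Summable fun i => greenFieldDeriv (p i) y :=
      Summable.of_norm_bounded (hs.mul_left C) fun i => (h y (Metric.mem_ball_self hr) i).2.1
    have h2 : ∀ j : Fin (n + 1), HasSum
        (fun i => (greenFieldDeriv (p i) y (EuclideanSpace.single j 1)) j)
        (((∑' i, greenFieldDeriv (p i) y) (EuclideanSpace.single j 1)) j) := fun j =>
      (h1.hasSum.mapL (ContinuousLinearMap.apply ℝ (E n) (EuclideanSpace.single j (1 : ℝ)))).mapL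
        (EuclideanSpace.proj j)
    have h3 := hasSum_sum fun j (_ : j ∈ Finset.univ) => h2 j
    refine h3.unique ?_
    refine (hasSum_zero (α := ℝ) (β := ι)).congr_fun fun i => ?_
    exact coordTrace_greenFieldDeriv (greenDenom_pos (hp i) (hball y hy)
      (h y (Metric.mem_ball_self hr) i).2.2)

/-! ### The minimum principle -/

/-- Restrict to the line through `y` in direction `e`. A negative second derivative would make the
minimum also a strict-type maximum, so the restriction would be locally constant, with second
derivative 0. -/
lemma second_fderiv_nonneg {f : E n → ℝ} {y : E n} (hf : ContDiffAt ℝ 2 f y)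
    (hmin : IsLocalMin f y) (e : E n) : 0 ≤ fderiv ℝ (fderiv ℝ f) y e e := by
  have hline : ∀ t : ℝ, HasDerivAt (fun t : ℝ => y + t • e) e t := fun t => by
    simpa using ((hasDerivAt_id t).smul_const e).const_add y
  have hcont : ContinuousAt (fun t : ℝ => y + t • e) 0 := (hline 0).continuousAt
  have h0 : y + (0 : ℝ) • e = y := by simp
  have hev : ∀ᶠ z in nhds y, DifferentiableAt ℝ f z := by
    have := hf.eventually (by simp)
    filter_upwards [this] with z hz
    exact hz.differentiableAt (by norm_num)
  have htend : Filter.Tendsto (fun t : ℝ => y + t • e) (nhds 0) (nhds y) := by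
    have := hcont.tendsto
    rwa [h0] at this
  have hd1 : deriv (fun t : ℝ => f (y + t • e)) =ᶠ[nhds 0] fun t => fderiv ℝ f (y + t • e) e := by
    filter_upwards [htend.eventually hev] with t ht
    exact (ht.hasFDerivAt.comp_hasDerivAt t (hline t)).deriv
  have hff : DifferentiableAt ℝ (fderiv ℝ f) y :=
    (hf.fderiv_right (m := 1) (by norm_num)).differentiableAt (by norm_num)
  have hd2 : deriv (deriv fun t : ℝ => f (y + t • e)) 0 = fderiv ℝ (fderiv ℝ f) y e e := by
    rw [hd1.deriv_eq]
    have h1 : HasFDerivAt (fderiv ℝ f) (fderiv ℝ (fderiv ℝ f) y) (y + (0 : ℝ) • e) := by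
      rw [h0]
      exact hff.hasFDerivAt
    have h2 : HasDerivAt (fun t : ℝ => fderiv ℝ f (y + t • e)) (fderiv ℝ (fderiv ℝ f) y e) 0 :=
      HasFDerivAt.comp_hasDerivAt (f := fun t : ℝ => y + t • e) 0 h1 (hline 0)
    have h3 : HasDerivAt (fun t : ℝ => fderiv ℝ f (y + t • e) e)
        (fderiv ℝ (fderiv ℝ f) y e e) 0 :=
      (ContinuousLinearMap.apply ℝ ℝ e).hasFDerivAt.comp_hasDerivAt 0 h2
    exact h3.deriv
  have hmin' : IsLocalMin (fun t : ℝ => f (y + t • e)) 0 := by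
    have := htend.eventually hmin
    filter_upwards [this] with t ht
    rw [h0]
    exact ht
  by_contra hcon
  push Not at hcon
  rw [← hd2] at hcon
  have hmax : IsLocalMax (fun t : ℝ => f (y + t • e)) 0 := by
    refine isLocalMax_of_deriv_deriv_neg hcon hmin'.deriv_eq_zero ?_
    refine ContinuousAt.comp (f := fun t : ℝ => y + t • e) (g := f) ?_ hcont
    rw [h0]
    exact hf.continuousAt
  have hconst : (fun t : ℝ => f (y + t • e)) =ᶠ[nhds 0] fun _ => f (y + (0 : ℝ) • e) := by
    filter_upwards [hmin', hmax] with t h1 h2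
    exact le_antisymm h2 h1
  have h3 := hconst.deriv.deriv_eq
  simp only [deriv_const'] at h3
  rw [h3] at hcon
  simp at hcon

lemma fderiv_fderiv_norm_sq (y e : E n) :
    fderiv ℝ (fderiv ℝ fun z : E n => ‖z‖ ^ 2) y e e = 2 * ‖e‖ ^ 2 := by
  have h1 : (fderiv ℝ fun z : E n => ‖z‖ ^ 2) = fun z => ((2 : ℝ) • innerSL ℝ : E n →L[ℝ] E n →L[ℝ] ℝ) z := by
    funext z
    rw [(hasFDerivAt_norm_sq' z).fderiv]
    rfl
  rw [h1, ContinuousLinearMap.fderiv, smul_apply, smul_apply, innerSL_apply_apply,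
    real_inner_self_eq_norm_sq, smul_eq_mul]

lemma laplacian_norm_sq (y : E n) :
    Laplacian.laplacian (fun z : E n => ‖z‖ ^ 2) y = 2 * (n + 1) := by
  rw [laplacian_eq_sum]
  simp only [fderiv_fderiv_norm_sq]
  simp
  ring

lemma HypHarmonicOn.contDiffAt {u : E n → ℝ} {V : Set (E n)} (h : HypHarmonicOn u V)
    (hV : IsOpen V) {y : E n} (hy : y ∈ V) : ContDiffAt ℝ 2 u y :=
  h.1.contDiffAt (hV.mem_nhds hy)

lemma HypHarmonicOn.equation {u : E n → ℝ} {V : Set (E n)} (h : HypHarmonicOn u V)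
    (hVb : V ⊆ Metric.ball 0 1) {y : E n} (hy : y ∈ V) :
    Laplacian.laplacian u y + 2 * ((n : ℝ) - 1) / (1 - ‖y‖ ^ 2) * fderiv ℝ u y y = 0 := by
  have h1 : ‖y‖ < 1 := by simpa using hVb hy
  have h2 := one_sub_sq_pos h1
  have h3 := h.2 y hy
  rcases mul_eq_zero.1 h3 with h4 | h4
  · exfalso
    have : 0 < ((1 - ‖y‖ ^ 2) / 2) ^ 2 := by positivity
    linarith
  · exact h4

lemma HypHarmonicOn.const_mul_sub {u w : E n → ℝ} {V : Set (E n)} (hu : HypHarmonicOn u V)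
    (hw : HypHarmonicOn w V) (hV : IsOpen V) (hVb : V ⊆ Metric.ball 0 1) (c : ℝ) :
    HypHarmonicOn (fun y => c * u y - w y) V := by
  refine ⟨(contDiffOn_const.mul hu.1).sub hw.1, fun y hy => ?_⟩
  have h1 := hu.contDiffAt hV hy
  have h2 := hw.contDiffAt hV hy
  have h3 : ContDiffAt ℝ 2 (c • u) y := h1.const_smul c
  have e1 : (fun y => c * u y - w y) = c • u - w := rfl
  have d1 : DifferentiableAt ℝ u y := h1.differentiableAt (by norm_num)
  have d2 : DifferentiableAt ℝ w y := h2.differentiableAt (by norm_num)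
  have e2 : fderiv ℝ (c • u - w) y y = c * fderiv ℝ u y y - fderiv ℝ w y y := by
    rw [fderiv_sub (d1.const_smul c) d2, fderiv_const_smul d1]
    simp
  have q1 := hu.equation hVb hy
  have q2 := hw.equation hVb hy
  rw [e1, h3.laplacian_sub h2, InnerProductSpace.laplacian_smul c h1, e2, smul_eq_mul]
  rw [mul_eq_zero]
  right
  linear_combination c * q1 - q2

/-- The minimum principle for harmonic functions in the ball with isolated singularities. -/
theorem HypHarmonicOn.nonneg (hn : 1 ≤ n) {v : E n → ℝ} {V : Set (E n)} (hv : HypHarmonicOn v V)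
    (hV : IsOpen V) (hVb : V ⊆ Metric.ball 0 1)
    (hsing : ∀ p : E n, ‖p‖ < 1 → p ∉ V → ∀ᶠ y in nhdsWithin p {p}ᶜ, 0 ≤ v y)
    (hbd : ∀ η > 0, ∃ r < 1, ∀ y ∈ V, r ≤ ‖y‖ → -η ≤ v y) {y : E n} (hy : y ∈ V) : 0 ≤ v y := by
  by_contra hcon
  push Not at hcon
  set c := v y with hc
  -- Subtracting `κ |z|^2` makes the minimum strict for the operator, at a cost of at most `κ` in
  -- the ball. Near the sphere `v ≥ -κ`, so there `v - κ |z|^2 ≥ -2 κ = c / 2 > c`.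
  set κ := -c / 4 with hκ
  have hκ0 : 0 < κ := by rw [hκ]; linarith
  set w : E n → ℝ := fun z => v z - κ * ‖z‖ ^ 2 with hw
  obtain ⟨r, hr1, hr⟩ := hbd κ hκ0
  have hball : ∀ z ∈ V, ‖z‖ < 1 := fun z hz => by simpa using hVb hz
  have hκsq : ∀ z : E n, ‖z‖ ≤ 1 → κ * ‖z‖ ^ 2 ≤ κ := fun z hz =>
    mul_le_of_le_one_right hκ0.le (pow_le_one₀ (norm_nonneg _) hz)
  have hfar : ∀ z ∈ V, r ≤ ‖z‖ → c < w z := by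
    intro z hz hrz
    have h1 := hr z hz hrz
    have h2 := hκsq z (hball z hz).le
    rw [hw]
    beta_reduce
    linarith
  have hvc : ∀ z ∈ V, ContinuousAt w z := fun z hz => by
    have := (hv.contDiffAt hV hz).continuousAt
    rw [hw]
    fun_prop
  set A : Set (E n) := {z | z ∈ V ∧ ‖z‖ ≤ r ∧ w z ≤ c} with hA
  have hyA : y ∈ A := by
    have h2 : w y ≤ c := by
      rw [hw]
      beta_reduce
      have : 0 ≤ κ * ‖y‖ ^ 2 := by positivity
      linarith
    refine ⟨hy, ?_, h2⟩
    by_contra h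
    have := hfar y hy (not_le.1 h).le
    linarith
  -- The set cannot accumulate at a missing point of `V`: near it `v ≥ 0`, so `w ≥ -κ > c`.
  have hAc : IsClosed A := by
    rw [← closure_subset_iff_isClosed]
    intro z hz
    have hzr : ‖z‖ ≤ r := by
      have : closure A ⊆ {z | ‖z‖ ≤ r} :=
        closure_minimal (fun z hz => hz.2.1) (isClosed_le continuous_norm continuous_const)
      exact this hz
    have hzV : z ∈ V := by
      by_contra hzV
      have h1 := hsing z (hzr.trans_lt hr1) hzV
      have h2 : ∃ᶠ z' in nhds z, z' ∈ A := mem_closure_iff_frequently.1 hz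
      rw [eventually_nhdsWithin_iff] at h1
      obtain ⟨z', h3, h4⟩ := (h2.and_eventually h1).exists
      have h5 : z' ≠ z := fun h => hzV (h ▸ h3.1)
      have h6 := h4 h5
      have h7 := h3.2.2
      have h8 := hκsq z' (hball z' h3.1).le
      rw [hw] at h7
      beta_reduce at h7
      linarith
    refine ⟨hzV, hzr, ?_⟩
    by_contra hcon'
    have h2 : ∃ᶠ z' in nhds z, z' ∈ A := mem_closure_iff_frequently.1 hz
    obtain ⟨z', h3, h4⟩ := (h2.and_eventually
      ((hvc z hzV).eventually (lt_mem_nhds (not_le.1 hcon')))).exists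
    have := h3.2.2
    linarith
  have hAk : IsCompact A := by
    refine (isCompact_closedBall (0 : E n) r).of_isClosed_subset hAc fun z hz => ?_
    simpa using hz.2.1
  obtain ⟨y₁, hy₁, hmin⟩ := hAk.exists_isMinOn ⟨y, hyA⟩
    (fun z hz => (hvc z hz.1).continuousWithinAt)
  have hy₁V := hy₁.1
  have hlt : ‖y₁‖ < r := by
    rcases hy₁.2.1.lt_or_eq with h | h
    · exact h
    · have := hfar y₁ hy₁V h.ge
      have := hy₁.2.2
      linarith
  have hloc : IsLocalMin w y₁ := by
    filter_upwards [hV.mem_nhds hy₁V,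
      (isOpen_lt continuous_norm continuous_const).mem_nhds hlt] with z hz hzr
    by_cases h : w z ≤ c
    · exact hmin (show z ∈ A from ⟨hz, le_of_lt hzr, h⟩)
    · exact hy₁.2.2.trans (not_le.1 h).le
  have hv2 := hv.contDiffAt hV hy₁V
  have hsq : ContDiff ℝ 2 (fun z : E n => ‖z‖ ^ 2) := contDiff_id.norm_sq ℝ
  have hsq' : ContDiffAt ℝ 2 (κ • fun z : E n => ‖z‖ ^ 2) y₁ := hsq.contDiffAt.const_smul κ
  have hw' : w = v - κ • fun z : E n => ‖z‖ ^ 2 := rfl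
  have hw2 : ContDiffAt ℝ 2 w y₁ := hv2.sub hsq'
  have hlap : 0 ≤ Laplacian.laplacian w y₁ := by
    rw [laplacian_eq_sum]
    exact Finset.sum_nonneg fun i _ => second_fderiv_nonneg hw2 hloc _
  rw [hw', hv2.laplacian_sub hsq', InnerProductSpace.laplacian_smul κ hsq.contDiffAt,
    laplacian_norm_sq, smul_eq_mul] at hlap
  have hfd := hloc.fderiv_eq_zero
  have hd1 : DifferentiableAt ℝ v y₁ := hv2.differentiableAt (by norm_num)
  have hd2 : DifferentiableAt ℝ (fun z : E n => ‖z‖ ^ 2) y₁ :=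
    (hasFDerivAt_norm_sq' y₁).differentiableAt
  rw [hw', fderiv_sub hd1 (hd2.const_smul κ), fderiv_const_smul hd2,
    (hasFDerivAt_norm_sq' y₁).fderiv] at hfd
  have hfd1 := DFunLike.congr_fun hfd y₁
  simp only [sub_apply, smul_apply, innerSL_apply_apply, zero_apply, smul_eq_mul,
    real_inner_self_eq_norm_sq] at hfd1
  have heq := hv.equation hVb hy₁V
  have hs := one_sub_sq_pos (hball y₁ hy₁V)
  have hn' : (0 : ℝ) ≤ (n : ℝ) - 1 := by
    have : (1 : ℝ) ≤ n := by exact_mod_cast hn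
    linarith
  -- At the minimum `∇v = 2 κ y₁` and `Δv ≥ 2 κ (n + 1) > 0`, so both terms of the harmonic equation
  -- are nonnegative and the first is positive.
  have h1 : fderiv ℝ v y₁ y₁ = κ * (2 * ‖y₁‖ ^ 2) := by linarith
  rw [h1] at heq
  have h2 : 0 ≤ 2 * ((n : ℝ) - 1) / (1 - ‖y₁‖ ^ 2) * (κ * (2 * ‖y₁‖ ^ 2)) := by positivity
  have h3 : 0 < κ * (2 * ((n : ℝ) + 1)) := by positivity
  linarith

/-! ### The minimal Green's function of the quotient -/

section Quotient

variable {Γ : Subgroup (Equiv.Perm (CBall n))} {x : CBall n}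

lemma IsBallIsometry.ballGreen_map {γ : Equiv.Perm (CBall n)} (h : IsBallIsometry γ) (x y : CBall n) :
    ballGreen (γ x : E n) (γ y) = ballGreen (x : E n) y := by
  have h1 : moebiusNorm (γ x : E n) (γ y) = moebiusNorm (x : E n) y := by
    rw [moebiusNorm_eq_sqrt, moebiusNorm_eq_sqrt, h.norm_sub_sq, h.one_sub_sq_map,
      h.one_sub_sq_map]
    have h2 := h.confFactor_pos (cball_norm_le x)
    have h3 := h.confFactor_pos (cball_norm_le y)
    set μ := confFactor γ (x : E n)
    set ν := confFactor γ (y : E n)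
    have e : μ * ν * ‖(x : E n) - y‖ ^ 2 +
        μ * (1 - ‖(x : E n)‖ ^ 2) * (ν * (1 - ‖(y : E n)‖ ^ 2)) =
        μ * ν * (‖(x : E n) - y‖ ^ 2 + (1 - ‖(x : E n)‖ ^ 2) * (1 - ‖(y : E n)‖ ^ 2)) := by ring
    rw [e, mul_inv]
    congr 1
    field_simp
  rw [ballGreen, ballGreen, h1]

/-- The points of an orbit are isolated. -/
lemma IsKleinian.exists_separation (hΓ : IsKleinian Γ) (hx : ‖(x : E n)‖ < 1) {y : E n}
    (hy : ‖y‖ < 1) : ∃ ρ > 0, ∀ γ : Γ, ((γ : Equiv.Perm (CBall n)) x : E n) = y ∨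
      ρ ≤ ‖((γ : Equiv.Perm (CBall n)) x : E n) - y‖ := by
  set R := max ‖(x : E n)‖ ((1 + ‖y‖) / 2) with hR
  have hR1 : R < 1 := max_lt hx (by linarith)
  have hfin := hΓ.finite_inter hR1
  set T := {γ : Γ | ∃ z : CBall n, ‖(z : E n)‖ ≤ R ∧ ‖((γ : Equiv.Perm (CBall n)) z : E n)‖ ≤ R}
  set P : Set (E n) := (fun γ : Γ => ((γ : Equiv.Perm (CBall n)) x : E n)) '' T \ {y} with hP
  have hPf : P.Finite := (hfin.image _).subset Set.sdiff_subset
  have hPo : IsOpen Pᶜ := hPf.isClosed.isOpen_compl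
  obtain ⟨r, hr, hrP⟩ := Metric.isOpen_iff.1 hPo y (fun h => h.2 rfl)
  refine ⟨min r ((1 - ‖y‖) / 2), lt_min hr (by linarith), fun γ => ?_⟩
  by_cases hγ : γ ∈ T
  · by_cases h : ((γ : Equiv.Perm (CBall n)) x : E n) = y
    · exact Or.inl h
    · right
      by_contra hcon
      push Not at hcon
      have h1 : ((γ : Equiv.Perm (CBall n)) x : E n) ∈ Metric.ball y r := by
        rw [Metric.mem_ball, dist_eq_norm]
        exact hcon.trans_le (min_le_left _ _)
      exact hrP h1 ⟨⟨γ, hγ, rfl⟩, h⟩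
  · right
    have h1 : R < ‖((γ : Equiv.Perm (CBall n)) x : E n)‖ := by
      by_contra hcon
      exact hγ ⟨x, le_max_left _ _, not_lt.1 hcon⟩
    have h2 : (1 + ‖y‖) / 2 ≤ R := le_max_right _ _
    have h3 := norm_sub_norm_le ((γ : Equiv.Perm (CBall n)) x : E n) y
    refine (min_le_right _ _).trans ?_
    linarith

lemma mem_orbitSet_iff {y : E n} :
    y ∈ orbitSet Γ x ↔ ∃ γ : Γ, ((γ : Equiv.Perm (CBall n)) x : E n) = y := by
  constructor
  · rintro ⟨γ, hγ, rfl⟩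
    exact ⟨⟨γ, hγ⟩, rfl⟩
  · rintro ⟨γ, rfl⟩
    exact ⟨γ, γ.2, rfl⟩

lemma IsKleinian.exists_separation_of_notMem (hΓ : IsKleinian Γ) (hx : ‖(x : E n)‖ < 1) {y : E n}
    (hy : y ∈ Metric.ball (0 : E n) 1 \ orbitSet Γ x) :
    ∃ ρ > 0, ∀ γ : Γ, ρ ≤ ‖((γ : Equiv.Perm (CBall n)) x : E n) - y‖ := by
  have hy1 : ‖y‖ < 1 := by simpa using hy.1
  obtain ⟨ρ, hρ, h⟩ := hΓ.exists_separation hx hy1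
  exact ⟨ρ, hρ, fun γ => (h γ).resolve_left fun h' => hy.2 (mem_orbitSet_iff.2 ⟨γ, h'⟩)⟩

lemma IsKleinian.isOpen_ball_diff_orbitSet (hΓ : IsKleinian Γ) (hx : ‖(x : E n)‖ < 1) :
    IsOpen (Metric.ball (0 : E n) 1 \ orbitSet Γ x) := by
  rw [Metric.isOpen_iff]
  intro y hy
  obtain ⟨ρ, hρ, h⟩ := hΓ.exists_separation_of_notMem hx hy
  obtain ⟨r, hr, hrb⟩ := Metric.isOpen_iff.1 Metric.isOpen_ball y hy.1
  refine ⟨min r ρ, lt_min hr hρ, fun z hz => ⟨hrb (Metric.ball_subset_ball (min_le_left _ _) hz), ?_⟩⟩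
  intro hz'
  obtain ⟨γ, rfl⟩ := mem_orbitSet_iff.1 hz'
  have h1 := h γ
  have h2 := Metric.ball_subset_ball (min_le_right _ _) hz
  rw [Metric.mem_ball, dist_eq_norm] at h2
  linarith

lemma IsKleinian.finite_stabilizer (hΓ : IsKleinian Γ) (hx : ‖(x : E n)‖ < 1) :
    Finite (MulAction.stabilizer Γ x) := by
  have h := hΓ.finite_inter hx
  refine (h.subset fun γ hγ => ?_).to_subtype
  have h1 : (γ : Equiv.Perm (CBall n)) x = x := hγ
  exact ⟨x, le_rfl, by rw [h1]⟩

/-- The sum of the Green's function of the ball over the orbit of the pole. -/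
def greenSum (Γ : Subgroup (Equiv.Perm (CBall n))) (x : CBall n) (y : E n) : ℝ :=
  ∑' γ : Γ, ballGreen ((γ : Equiv.Perm (CBall n)) x : E n) y

lemma greenSum_invariant (hΓ : IsKleinian Γ) {γ : Equiv.Perm (CBall n)} (hγ : γ ∈ Γ)
    (y : CBall n) : greenSum Γ x (γ y) = greenSum Γ x y := by
  rw [greenSum, greenSum, ← (Equiv.mulLeft (⟨γ, hγ⟩ : Γ)).tsum_eq
    (fun γ' : Γ => ballGreen ((γ' : Equiv.Perm (CBall n)) x : E n) (γ y))]
  refine tsum_congr fun γ' => ?_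
  exact (hΓ.isBallIsometry hγ).ballGreen_map ((γ' : Equiv.Perm (CBall n)) x) y

lemma IsKleinian.norm_orbit_lt (hΓ : IsKleinian Γ) (hx : ‖(x : E n)‖ < 1) (γ : Γ) :
    ‖((γ : Equiv.Perm (CBall n)) x : E n)‖ < 1 := hΓ.maps_ball γ γ.2 x hx

/-- At the pole the sum is split over the stabilizer of `x` and its complement: the stabilizer
contributes equal terms, which produce the factor in the singularity, and the other poles stay away
from `x`, so their sum is harmonic near it. -/
theorem isGreenFunction_greenSum (hn : 1 ≤ n) (hΓ : IsKleinian Γ) (hx : ‖(x : E n)‖ < 1)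
    (hs : Summable fun γ : Γ => (1 - ‖((γ : Equiv.Perm (CBall n)) x : E n)‖ ^ 2) ^ n) :
    IsGreenFunction Γ x (greenSum Γ x) := by
  have hp := hΓ.norm_orbit_lt hx
  obtain ⟨hsum, -, -, hharm⟩ := greenSum_of_summable hn hp hs (hΓ.isOpen_ball_diff_orbitSet hx)
    Set.sdiff_subset fun y hy => hΓ.exists_separation_of_notMem hx hy
  have hpos : ∀ y ∈ Metric.ball (0 : E n) 1 \ orbitSet Γ x, ∀ γ : Γ,
      0 < ballGreen ((γ : Equiv.Perm (CBall n)) x : E n) y := fun y hy γ =>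
    ballGreen_pos (hp γ) (by simpa using hy.1) fun h => hy.2 (mem_orbitSet_iff.2 ⟨γ, h⟩)
  refine ⟨fun γ hγ y _ => greenSum_invariant hΓ hγ y, fun y hy =>
    (hsum y hy).tsum_pos (fun γ => (hpos y hy γ).le) 1 (hpos y hy 1), hharm, ?_⟩
  obtain ⟨ρ, hρ, h⟩ := hΓ.exists_separation hx hx
  set r := min (ρ / 2) (1 - ‖(x : E n)‖) with hr
  have hr0 : 0 < r := lt_min (half_pos hρ) (by linarith)
  have hVb : Metric.ball (x : E n) r ⊆ Metric.ball 0 1 := by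
    intro y hy
    have h1 : dist y (x : E n) < 1 - ‖(x : E n)‖ := lt_of_lt_of_le hy (min_le_right _ _)
    rw [dist_eq_norm] at h1
    have h2 := norm_sub_norm_le y (x : E n)
    simp only [mem_ball_zero_iff]
    linarith
  set S : Set Γ := (MulAction.stabilizer Γ x : Set Γ) with hS
  have hmemS : ∀ γ : Γ, γ ∈ S ↔ ((γ : Equiv.Perm (CBall n)) x : E n) = x := by
    intro γ
    rw [Subtype.coe_inj]
    rfl
  have hfar : ∀ y ∈ Metric.ball (x : E n) r, ∀ γ : Γ, γ ∉ S →
      ρ / 2 ≤ ‖((γ : Equiv.Perm (CBall n)) x : E n) - y‖ := by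
    intro y hy γ hγ
    have h1 := (h γ).resolve_left fun h' => hγ ((hmemS γ).2 h')
    have h2 : dist y (x : E n) < ρ / 2 := lt_of_lt_of_le hy (min_le_left _ _)
    rw [dist_eq_norm] at h2
    have h3 := norm_sub_le_norm_sub_add_norm_sub ((γ : Equiv.Perm (CBall n)) x : E n) y x
    linarith
  refine ⟨Metric.ball (x : E n) r, Metric.isOpen_ball, Metric.mem_ball_self hr0, hVb,
    fun y => ∑' γ : ↥Sᶜ, ballGreen (((γ : Γ) : Equiv.Perm (CBall n)) x : E n) y, ?_, ?_⟩
  · exact (greenSum_of_summable hn (fun γ : ↥Sᶜ => hp γ) (hs.subtype Sᶜ) Metric.isOpen_ball hVb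
      fun y hy => ⟨ρ / 2, half_pos hρ, fun γ => hfar y hy γ γ.2⟩).2.2.2
  · intro y hy hyx
    have hyV : y ∈ Metric.ball (0 : E n) 1 \ orbitSet Γ x := by
      refine ⟨hVb hy, fun hcon => ?_⟩
      obtain ⟨γ, hγ⟩ := mem_orbitSet_iff.1 hcon
      by_cases hγS : γ ∈ S
      · exact hyx (hγ.symm.trans ((hmemS γ).1 hγS))
      · have h1 := hfar y hy γ hγS
        rw [hγ, sub_self, norm_zero] at h1
        linarith
    have h1 := (hsum y hyV).subtype S
    have h2 := (hsum y hyV).subtype Sᶜ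
    have h3 := h1.tsum_add_tsum_compl h2
    rw [greenSum, ← h3]
    congr 1
    have h4 : ∀ γ : S, ((fun γ : Γ => ballGreen ((γ : Equiv.Perm (CBall n)) x : E n) y) ∘
        (Subtype.val : S → Γ)) γ = ballGreen (x : E n) y := by
      intro γ
      simp only [Function.comp_apply]
      rw [(hmemS γ).1 γ.2]
    refine (tsum_congr h4).trans ?_
    exact (tsum_const (β := S) (ballGreen (x : E n) y)).trans (nsmul_eq_mul _ _)

lemma tendsto_ballGreen_sphere (hn : 1 ≤ n) {p : E n} (hp : ‖p‖ < 1) :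
    Filter.Tendsto (ballGreen p) (Filter.comap norm (nhdsWithin 1 (Set.Iio 1))) (nhds 0) := by
  have hl : Filter.Tendsto (norm : E n → ℝ) (Filter.comap norm (nhdsWithin 1 (Set.Iio 1)))
      (nhdsWithin 1 (Set.Iio 1)) := Filter.tendsto_comap
  have hl1 := hl.mono_right nhdsWithin_le_nhds
  set δ := (1 - ‖p‖) / 2 with hδ
  have hδ0 : 0 < δ := by rw [hδ]; linarith
  have hup : Filter.Tendsto (fun y : E n => (3 * (1 - ‖p‖ ^ 2) * (1 - ‖y‖ ^ 2) / δ ^ 3) ^ n)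
      (Filter.comap norm (nhdsWithin 1 (Set.Iio 1))) (nhds 0) := by
    have h1 : Filter.Tendsto (fun t : ℝ => (3 * (1 - ‖p‖ ^ 2) * (1 - t ^ 2) / δ ^ 3) ^ n)
        (nhds 1) (nhds ((3 * (1 - ‖p‖ ^ 2) * (1 - 1 ^ 2) / δ ^ 3) ^ n)) := by
      apply Continuous.tendsto
      fun_prop
    have h2 : (3 * (1 - ‖p‖ ^ 2) * (1 - 1 ^ 2) / δ ^ 3) ^ n = 0 := by
      rw [show (3 * (1 - ‖p‖ ^ 2) * (1 - 1 ^ 2) / δ ^ 3) = 0 by ring, zero_pow (by omega)]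
    rw [h2] at h1
    exact h1.comp hl1
  have hev1 := hl.eventually (self_mem_nhdsWithin)
  have hev2 := hl1.eventually (lt_mem_nhds (show (1 + ‖p‖) / 2 < 1 by linarith))
  have hev : ∀ᶠ y in Filter.comap norm (nhdsWithin 1 (Set.Iio 1)), ‖y‖ < 1 ∧ δ ≤ ‖p - y‖ := by
    filter_upwards [hev1, hev2] with y h1 h2
    refine ⟨h1, ?_⟩
    have := norm_sub_norm_le y p
    rw [norm_sub_rev] at this
    rw [hδ]
    linarith
  refine tendsto_of_tendsto_of_tendsto_of_le_of_le' tendsto_const_nhds hup ?_ ?_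
  · filter_upwards [hev] with y hy
    refine (ballGreen_pos hp hy.1 fun h => ?_).le
    have := hy.2
    rw [h, sub_self, norm_zero] at this
    linarith
  · filter_upwards [hev] with y hy
    exact ballGreen_le hn hp hy.1 hδ0 hy.2

lemma continuousAt_ballGreen (hn : 1 ≤ n) {p y : E n} (hp : ‖p‖ < 1) (hy : ‖y‖ < 1) (h : p ≠ y) :
    ContinuousAt (ballGreen p) y :=
  (hasFDerivAt_ballGreen hn hp hy h).continuousAt

/-- Near a point of the orbit, a Green's function dominates finite sums of Green's functions of the
ball. -/
lemma IsGreenFunction.eventually_nonneg (hn : 1 ≤ n) (hΓ : IsKleinian Γ) (hx : ‖(x : E n)‖ < 1)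
    {K : E n → ℝ} (hK : IsGreenFunction Γ x K) (S : Finset Γ) {δ : ℝ} (hδ : 0 < δ) (γ₀ : Γ) :
    ∀ᶠ y in nhdsWithin ((γ₀ : Equiv.Perm (CBall n)) x : E n)
      {((γ₀ : Equiv.Perm (CBall n)) x : E n)}ᶜ,
      0 ≤ (1 + δ) * K y - ∑ γ ∈ S, ballGreen ((γ : Equiv.Perm (CBall n)) x : E n) y := by
  classical
  have hp := hΓ.norm_orbit_lt hx
  set p : E n := ((γ₀ : Equiv.Perm (CBall n)) x : E n) with hpdef
  have hp1 : ‖p‖ < 1 := hp γ₀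
  have hI := hΓ.isBallIsometry γ₀.2
  have hI' := hI.inv
  obtain ⟨V, hVo, hxV, hVb, h, hh, hKV⟩ := hK.singularity
  set s : ℝ := (Nat.card (MulAction.stabilizer Γ x) : ℝ) with hs
  have hfinst := hΓ.finite_stabilizer hx
  have hs1 : 1 ≤ s := by
    have : 0 < Nat.card (MulAction.stabilizer Γ x) := Nat.card_pos
    rw [hs]
    exact_mod_cast this
  set ψ : E n → E n := ballExt (γ₀ : Equiv.Perm (CBall n))⁻¹ with hψ
  have hψp : ψ p = x := by
    rw [hψ, hpdef, ballExt_coe]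
    congr 1
    exact (γ₀ : Equiv.Perm (CBall n)).symm_apply_apply x
  have hψc : ContinuousAt ψ p := (hI'.differentiableAt_ballExt hp1).continuousAt
  have hψV : ∀ᶠ y in nhds p, ψ y ∈ V := hψc (by rw [hψp]; exact hVo.mem_nhds hxV)
  have hhc : ContinuousAt h (ψ p) := by
    rw [hψp]
    exact (hh.contDiffAt hVo hxV).continuousAt
  have hhψ : ContinuousAt (fun y => h (ψ y)) p := hhc.comp hψc
  have hb : ∀ᶠ y in nhds p, ‖y‖ < 1 := (isOpen_lt continuous_norm continuous_const).mem_nhds hp1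
  set S₁ := S.filter fun γ : Γ => ((γ : Equiv.Perm (CBall n)) x : E n) = p with hS₁
  set S₂ := S.filter fun γ : Γ => ¬ ((γ : Equiv.Perm (CBall n)) x : E n) = p with hS₂
  -- The elements carrying `x` to `γ₀ x` form a coset of the stabilizer, so the finite sum has at
  -- most the singularity of `K` at this point.
  have hcard : (S₁.card : ℝ) ≤ s := by
    have : Nat.card S₁ ≤ Nat.card (MulAction.stabilizer Γ x) := by
      refine Nat.card_le_card_of_injective
        (fun γ : S₁ => (⟨γ₀⁻¹ * γ, ?_⟩ : MulAction.stabilizer Γ x)) ?_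
      · have h1 := (Finset.mem_filter.1 γ.2).2
        rw [MulAction.mem_stabilizer_iff, mul_smul, inv_smul_eq_iff]
        exact Subtype.ext h1
      · intro a b hab
        have := Subtype.ext_iff.1 hab
        exact Subtype.ext (mul_left_cancel this)
    rw [Nat.card_eq_fintype_card, Fintype.card_coe] at this
    rw [hs]
    exact_mod_cast this
  set F₂ : E n → ℝ := fun y => ∑ γ ∈ S₂, ballGreen ((γ : Equiv.Perm (CBall n)) x : E n) y with hF₂
  have hF₂c : ContinuousAt F₂ p := by
    refine tendsto_finsetSum _ fun γ hγ => ?_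
    exact continuousAt_ballGreen hn (hp γ) hp1 (Finset.mem_filter.1 hγ).2
  set B : E n → ℝ := fun y => (1 + δ) * h (ψ y) - F₂ y with hB
  have hBc : ContinuousAt B p := (hhψ.const_mul (1 + δ)).sub hF₂c
  have hBb : ∀ᶠ y in nhds p, B p - 1 < B y := hBc.eventually (lt_mem_nhds (by linarith))
  -- The singularities may cancel exactly; the extra `δ` of `K` then beats the continuous remainder
  -- `B`.
  have hbig := (tendsto_ballGreen hn hp1).eventually_ge_atTop ((1 - B p) / δ)
  filter_upwards [hbig, nhdsWithin_le_nhds hBb, nhdsWithin_le_nhds hb, nhdsWithin_le_nhds hψV,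
    self_mem_nhdsWithin] with y h1 h2 h3 h4 h5
  have h5 : y ≠ p := h5
  set Y : CBall n := ⟨y, by simpa using h3.le⟩ with hY
  have hψY : ψ y = ((γ₀ : Equiv.Perm (CBall n))⁻¹ Y : E n) := ballExt_coe _ Y
  have hne : ψ y ≠ x := by
    intro hcon
    apply h5
    rw [hψY] at hcon
    have := Subtype.ext hcon
    rw [Equiv.Perm.inv_eq_iff_eq] at this
    rw [hpdef, ← this]
  have hKy : K y = s * ballGreen p y + h (ψ y) := by
    have e1 := hK.invariant _ (Γ.inv_mem γ₀.2) Y h3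
    have e2 := hKV (ψ y) h4 hne
    rw [← hψY] at e1
    have e3 : ballGreen (x : E n) (ψ y) = ballGreen p y := by
      rw [← hψp, hψY, hψ, hpdef, ballExt_coe]
      exact hI'.ballGreen_map _ Y
    rw [e3] at e2
    exact e1.symm.trans e2
  have hg0 : 0 < ballGreen p y := ballGreen_pos hp1 h3 (Ne.symm h5)
  have hsplit : ∑ γ ∈ S, ballGreen ((γ : Equiv.Perm (CBall n)) x : E n) y =
      S₁.card * ballGreen p y + F₂ y := by
    rw [← Finset.sum_filter_add_sum_filter_not S
      (fun γ => ((γ : Equiv.Perm (CBall n)) x : E n) = p)]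
    congr 1
    rw [Finset.sum_congr rfl (g := fun _ => ballGreen p y) fun γ hγ => by
      rw [(Finset.mem_filter.1 hγ).2], Finset.sum_const, nsmul_eq_mul]
  rw [hKy, hsplit]
  have h6 : 1 - B p ≤ δ * ballGreen p y := by
    rw [div_le_iff₀ hδ] at h1
    linarith
  have h7 : (S₁.card : ℝ) * ballGreen p y ≤ s * ballGreen p y := by gcongr
  have h8 : δ * ballGreen p y ≤ δ * s * ballGreen p y := by
    have : δ * ballGreen p y * 1 ≤ δ * ballGreen p y * s := by gcongr
    linarith
  have h9 : B y = (1 + δ) * h (ψ y) - F₂ y := rfl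
  nlinarith

/-- The minimum principle is applied to `(1 + δ) K` minus a finite partial sum, which is nonnegative
near every pole; near the sphere `K > 0` and the finite sum tends to 0. Then `δ` tends to 0 and the
partial sums exhaust the series. -/
theorem greenSum_le (hn : 1 ≤ n) (hΓ : IsKleinian Γ) (hx : ‖(x : E n)‖ < 1)
    (hs : Summable fun γ : Γ => (1 - ‖((γ : Equiv.Perm (CBall n)) x : E n)‖ ^ 2) ^ n)
    {K : E n → ℝ} (hK : IsGreenFunction Γ x K) {y : E n}
    (hy : y ∈ Metric.ball (0 : E n) 1 \ orbitSet Γ x) : greenSum Γ x y ≤ K y := by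
  have hp := hΓ.norm_orbit_lt hx
  have hV := hΓ.isOpen_ball_diff_orbitSet hx
  have hVb : Metric.ball (0 : E n) 1 \ orbitSet Γ x ⊆ Metric.ball 0 1 := Set.sdiff_subset
  have hsum := (greenSum_of_summable hn hp hs hV
    hVb fun y hy => hΓ.exists_separation_of_notMem hx hy).1 y hy
  have hKpos := hK.pos y hy
  refine hsum.tsum_le_of_sum_le fun S => ?_
  have key : ∀ δ : ℝ, 0 < δ →
      ∑ γ ∈ S, ballGreen ((γ : Equiv.Perm (CBall n)) x : E n) y ≤ (1 + δ) * K y := by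
    intro δ hδ
    have hF : HypHarmonicOn
        (fun y => ∑ γ ∈ S, ballGreen ((γ : Equiv.Perm (CBall n)) x : E n) y)
        (Metric.ball (0 : E n) 1 \ orbitSet Γ x) := by
      have h1 := (greenSum_of_summable hn (fun γ : S => hp γ) (hs.subtype (S : Set Γ)) hV hVb
        fun y hy => by
          obtain ⟨ρ, hρ, h⟩ := hΓ.exists_separation_of_notMem hx hy
          exact ⟨ρ, hρ, fun γ => h γ⟩).2.2.2
      have e : (fun y => ∑ γ ∈ S, ballGreen ((γ : Equiv.Perm (CBall n)) x : E n) y) =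
          fun y => ∑' γ : S, ballGreen (((γ : Γ) : Equiv.Perm (CBall n)) x : E n) y := by
        funext y
        exact (Finset.tsum_subtype S fun γ : Γ =>
          ballGreen ((γ : Equiv.Perm (CBall n)) x : E n) y).symm
      rw [e]
      exact h1
    have hv := hK.harmonic.const_mul_sub hF hV hVb (1 + δ)
    have := hv.nonneg hn hV hVb ?_ ?_ hy
    · linarith
    · intro p hp1 hpV
      have : p ∈ orbitSet Γ x := by
        by_contra hcon
        exact hpV ⟨by simpa using hp1, hcon⟩
      obtain ⟨γ₀, rfl⟩ := mem_orbitSet_iff.1 this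
      exact hK.eventually_nonneg hn hΓ hx S hδ γ₀
    · intro η hη
      have h1 : Filter.Tendsto
          (fun y => ∑ γ ∈ S, ballGreen ((γ : Equiv.Perm (CBall n)) x : E n) y)
          (Filter.comap norm (nhdsWithin 1 (Set.Iio 1))) (nhds 0) := by
        have := tendsto_finsetSum S fun γ (_ : γ ∈ S) => tendsto_ballGreen_sphere hn (hp γ)
        simpa using this
      have h2 := h1.eventually (gt_mem_nhds hη)
      rw [Filter.eventually_comap] at h2
      obtain ⟨r, hr, hr'⟩ := (mem_nhdsLT_iff_exists_Ioo_subset.1 h2)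
      have hr : r < 1 := hr
      refine ⟨(r + 1) / 2, by linarith, fun z hz hrz => ?_⟩
      have hz1 : ‖z‖ < 1 := by simpa using hz.1
      have h3 := hr' (show ‖z‖ ∈ Set.Ioo r 1 from ⟨by linarith, hz1⟩) z rfl
      have h4 := hK.pos z hz
      have h5 : 0 < (1 + δ) * K z := by positivity
      linarith
  by_contra hcon
  push Not at hcon
  set F := ∑ γ ∈ S, ballGreen ((γ : Equiv.Perm (CBall n)) x : E n) y with hFdef
  have h1 := key ((F - K y) / (2 * K y)) (div_pos (by linarith) (by linarith))
  have h2 : (1 + (F - K y) / (2 * K y)) * K y = K y + (F - K y) / 2 := by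
    field_simp
  linarith

theorem minimalGreen_eq (hn : 1 ≤ n) (hΓ : IsKleinian Γ) (hx : ‖(x : E n)‖ < 1)
    (hs : Summable fun γ : Γ => (1 - ‖((γ : Equiv.Perm (CBall n)) x : E n)‖ ^ 2) ^ n) {y : E n}
    (hy : y ∈ Metric.ball (0 : E n) 1 \ orbitSet Γ x) : minimalGreen Γ x y = greenSum Γ x y := by
  refine IsLeast.csInf_eq ⟨⟨greenSum Γ x, isGreenFunction_greenSum hn hΓ hx hs, rfl⟩, ?_⟩
  rintro t ⟨K, hK, rfl⟩
  exact greenSum_le hn hΓ hx hs hK hy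

end Quotient

/-! ### The flux of the Green's function through the graph -/

/-- The second factor is at least `(1 - |x| |y|)^2`. So the field stays smooth beyond the unit
sphere, up to radius `1 / |x|`, and can be cut off there. -/
lemma greenDenom_pos_of_mul_lt {x y : E n} (hxy : x ≠ y) (h : ‖x‖ * ‖y‖ < 1) :
    0 < greenDenom x y := by
  have h1 : ‖x - y‖ ^ 2 + (1 - ‖x‖ ^ 2) * (1 - ‖y‖ ^ 2) =
      1 - 2 * inner ℝ x y + ‖x‖ ^ 2 * ‖y‖ ^ 2 := by
    rw [norm_sub_sq_eq]
    ring
  have h2 := real_inner_le_norm x y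
  have h3 : 0 < (1 - ‖x‖ * ‖y‖) ^ 2 := by
    have : 0 < 1 - ‖x‖ * ‖y‖ := by linarith
    positivity
  have h4 := norm_pos_iff.2 (sub_ne_zero.2 hxy)
  rw [greenDenom, h1]
  have : 0 < 1 - 2 * inner ℝ x y + ‖x‖ ^ 2 * ‖y‖ ^ 2 := by nlinarith
  positivity

/-- The field `greenField x`, cut off near its pole and at infinity. -/
lemma exists_cutoff_greenField {x : E n} (hx : ‖x‖ < 1) {r : ℝ} (hr : 0 < r) :
    ∃ Y : E n → E n, ContDiff ℝ 1 Y ∧ HasCompactSupport Y ∧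
      ∀ y, ‖y‖ ≤ 1 → r ≤ ‖y - x‖ → Y y = greenField x y := by
  have hR1 : 1 < 2 / (1 + ‖x‖) := by
    rw [lt_div_iff₀ (by positivity)]
    linarith
  set R := 2 / (1 + ‖x‖) with hR
  have hRx : ‖x‖ * R < 1 := by
    rw [hR, mul_div_assoc', div_lt_one (by positivity)]
    linarith
  let f₁ : ContDiffBump x := ⟨r / 2, r, by positivity, by linarith⟩
  let f₂ : ContDiffBump (0 : E n) := ⟨1, R, one_pos, hR1⟩
  refine ⟨fun y => (f₂ y * (1 - f₁ y)) • greenField x y, ?_, ?_, ?_⟩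
  · rw [contDiff_iff_contDiffAt]
    intro y
    by_cases hyx : y = x
    · have h0 : (fun y => (f₂ y * (1 - f₁ y)) • greenField x y) =ᶠ[nhds y] fun _ => 0 := by
        rw [hyx]
        filter_upwards [f₁.eventuallyEq_one] with z hz
        rw [hz]
        simp
      exact contDiffAt_const.congr_of_eventuallyEq h0
    · by_cases hyR : y ∈ Metric.closedBall (0 : E n) R
      · have hy : ‖y‖ ≤ R := by simpa using hyR
        have hpos : 0 < greenDenom x y := by
          refine greenDenom_pos_of_mul_lt (Ne.symm hyx) (lt_of_le_of_lt ?_ hRx)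
          gcongr
        have h1 := (contDiffAt_greenField hpos).of_le (m := 1) (by norm_num)
        exact (f₂.contDiffAt.mul (contDiffAt_const.sub f₁.contDiffAt)).smul h1
      · have h0 : (fun y => (f₂ y * (1 - f₁ y)) • greenField x y) =ᶠ[nhds y] fun _ => 0 := by
          filter_upwards [Metric.isClosed_closedBall.isOpen_compl.mem_nhds hyR] with z hz
          have : f₂ z = 0 := by
            apply f₂.zero_of_le_dist
            have hz : ¬ z ∈ Metric.closedBall (0 : E n) R := hz
            rw [Metric.mem_closedBall, not_le] at hz
            exact hz.le
          rw [this]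
          simp
        exact contDiffAt_const.congr_of_eventuallyEq h0
  · exact (f₂.hasCompactSupport.mul_right).smul_right
  · intro y hy hyr
    have h1 : f₂ y = 1 := f₂.one_of_mem_closedBall (by simpa using hy)
    have h2 : f₁ y = 0 := f₁.zero_of_le_dist (by rw [dist_eq_norm]; exact hyr)
    simp only [h1, h2]
    simp

section Flux

variable {Γ : Subgroup (Equiv.Perm (CBall n))} {ε : ℝ} {N : E n → ℝ}

lemma integrable_fluxDensity (hN : IsGraphGauge Γ ε N) {Y : E n → E n} (hY : Continuous Y) {C : ℝ}
    (hC : ∀ y, ‖Y y‖ ≤ C) : Integrable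
      (fun θ : Metric.sphere (0 : E n) 1 => fluxDensity N Y 1 θ) (volume : Measure (E n)).toSphere := by
  obtain ⟨K, hK⟩ := hN.lipschitz
  refine Integrable.of_bound (C := K * C) ?_ (Filter.Eventually.of_forall fun θ => ?_)
  · exact ((measurable_fluxDensity hN.continuous hY).comp
      (measurable_subtype_coe.prodMk measurable_const)).aestronglyMeasurable
  · exact abs_fluxDensity_le hK hN.norm_le hC 1 (by simp)

lemma fluxDensity_norm {Y : E n → E n} {θ : E n} (hθ : ‖θ‖ = 1) :
    fluxDensity (fun y : E n => ‖y‖) Y 1 θ = inner ℝ (Y θ) θ := by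
  have h0 : θ ≠ 0 := by
    rintro rfl
    simp at hθ
  have h1 : HasFDerivAt (fun y : E n => ‖y‖) (innerSL ℝ θ) θ := by
    have h2 : HasFDerivAt (fun y : E n => Real.sqrt (‖y‖ ^ 2)) _ θ :=
      (Real.hasDerivAt_sqrt (x := ‖θ‖ ^ 2) (by rw [hθ]; norm_num)).comp_hasFDerivAt θ
        (hasFDerivAt_norm_sq' θ)
    simp only [Real.sqrt_sq (norm_nonneg _)] at h2
    refine h2.congr_fderiv ?_
    ext v
    simp [hθ]
  rw [fluxDensity, h1.fderiv, hθ, innerSL_apply_apply]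
  simp [real_inner_comm]

/-- The flux of the gradient of the Green's function through the graph is a Poisson integral. -/
theorem IsGraphGauge.integral_flux_greenField (hN : IsGraphGauge Γ ε N) {x : E n} (hx : ‖x‖ < 1)
    (hNx : N x < 1) :
    IntegrableOn (fun θ : Metric.sphere (0 : E n) 1 => fluxDensity N (greenField x) 1 θ)
      {θ | 1 < N θ} (volume : Measure (E n)).toSphere ∧
    ∫ θ in {θ : Metric.sphere (0 : E n) 1 | 1 < N θ}, fluxDensity N (greenField x) 1 θ
      ∂(volume : Measure (E n)).toSphere =
    ∫ θ in {θ : Metric.sphere (0 : E n) 1 | 1 < N θ},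
      -(2 ^ (n - 1)) * ((1 - ‖x‖ ^ 2) / ‖x - (θ : E n)‖ ^ 2) ^ n
      ∂(volume : Measure (E n)).toSphere := by
  obtain ⟨K, hK⟩ := hN.lipschitz
  set δ := (1 - N x) / 2 with hδ
  have hNx0 : 0 ≤ N x := (norm_nonneg x).trans (hN.norm_le x)
  have hδ0 : 0 < δ := by rw [hδ]; linarith
  have hδ1 : δ < 1 := by rw [hδ]; linarith
  have hxδ : N x < 1 - δ := by rw [hδ]; linarith
  obtain ⟨r, hr, hrN⟩ := Metric.isOpen_iff.1
    (isOpen_lt hN.continuous (continuous_const (y := 1 - δ))) x hxδ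
  obtain ⟨Y, hY, hYc, hYX⟩ := exists_cutoff_greenField hx hr
  have hYX' : ∀ y, ‖y‖ ≤ 1 → 1 - δ < N y → Y y = greenField x y := by
    intro y hy hyN
    refine hYX y hy ?_
    by_contra hcon
    have h1 : y ∈ Metric.ball x r := by
      rw [Metric.mem_ball, dist_eq_norm]
      exact not_le.1 hcon
    have h2 : N y < 1 - δ := hrN h1
    linarith
  have hdiv : ∀ y, 1 - δ < N y → ‖y‖ < 1 → divergence Y y = 0 := by
    intro y hyN hy
    have h1 : Y =ᶠ[nhds y] greenField x := by
      filter_upwards [(isOpen_lt continuous_const hN.continuous).mem_nhds hyN,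
        (isOpen_lt continuous_norm continuous_const).mem_nhds hy] with z hz hz1
      exact hYX' z (le_of_lt hz1) hz
    have hxy : x ≠ y := by
      rintro rfl
      linarith
    rw [divergence, h1.fderiv_eq]
    exact divergence_greenField (greenDenom_pos hx hy hxy)
  obtain ⟨C, hC⟩ := hY.continuous.bounded_above_of_compact_support hYc
  have hflux := integral_fluxDensity_eq hK hN.smul hN.norm_le hY hYc hδ0 hδ1 hdiv
  -- The norm is itself a gauge, whose level surface is the sphere; both fluxes equal the same
  -- integral of the divergence.
  have hflux' := integral_fluxDensity_eq (N := fun y : E n => ‖y‖) (K := 1) lipschitzWith_one_norm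
    (fun r hr y => by rw [norm_smul, Real.norm_of_nonneg hr]) (fun y => le_rfl) hY hYc hδ0 hδ1
    fun y hy hy1 => hdiv y (hy.trans_le (hN.norm_le y)) hy1
  rw [← hflux'] at hflux
  have hms : MeasurableSet {θ : Metric.sphere (0 : E n) 1 | 1 < N θ} :=
    measurableSet_lt measurable_const (hN.continuous.measurable.comp measurable_subtype_coe)
  have hi := integrable_fluxDensity hN hY.continuous hC
  have hi' : Integrable (fun θ : Metric.sphere (0 : E n) 1 =>
      fluxDensity (fun y : E n => ‖y‖) Y 1 θ) (volume : Measure (E n)).toSphere := by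
    refine Integrable.of_bound (C := (1 : NNReal) * C) ?_ (Filter.Eventually.of_forall fun θ => ?_)
    · exact ((measurable_fluxDensity continuous_norm hY.continuous).comp
        (measurable_subtype_coe.prodMk measurable_const)).aestronglyMeasurable
    · exact abs_fluxDensity_le lipschitzWith_one_norm (fun y => le_rfl) hC 1 (by simp)
  -- Over the limit set the two integrands agree: `N - |·|` is nonnegative and vanishes there, so
  -- wherever `N` is differentiable the differentials coincide. Subtracting this part leaves the
  -- flux over `Ω(Γ)`.
  have hcompl : ∫ θ in {θ : Metric.sphere (0 : E n) 1 | 1 < N θ}ᶜ, fluxDensity N Y 1 θ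
      ∂(volume : Measure (E n)).toSphere =
      ∫ θ in {θ : Metric.sphere (0 : E n) 1 | 1 < N θ}ᶜ, fluxDensity (fun y : E n => ‖y‖) Y 1 θ
      ∂(volume : Measure (E n)).toSphere := by
    refine integral_congr_ae ?_
    filter_upwards [ae_restrict_of_ae hN.ae_sphere_differentiableAt,
      ae_restrict_mem hms.compl] with θ hd hθN
    have hθ : ‖(θ : E n)‖ = 1 := by simp
    have hNθ : N θ = 1 := le_antisymm (not_lt.1 hθN) (by
      have := hN.norm_le (θ : E n)
      rwa [hθ] at this)
    have hne : (θ : E n) ≠ 0 := by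
      intro h
      rw [h] at hθ
      simp at hθ
    have hdn : DifferentiableAt ℝ (fun y : E n => ‖y‖) (θ : E n) :=
      differentiableAt_id.norm ℝ hne
    have hloc : IsLocalMin (fun y : E n => N y - ‖y‖) (θ : E n) := by
      refine Filter.Eventually.of_forall fun y => ?_
      change N θ - ‖(θ : E n)‖ ≤ N y - ‖y‖
      rw [hNθ, hθ, sub_self, sub_nonneg]
      exact hN.norm_le y
    have h1 := hloc.fderiv_eq_zero
    rw [fderiv_fun_sub hd hdn, sub_eq_zero] at h1
    rw [fluxDensity, fluxDensity, h1, hNθ, hθ]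
  have hmain : ∫ θ in {θ : Metric.sphere (0 : E n) 1 | 1 < N θ}, fluxDensity N Y 1 θ
      ∂(volume : Measure (E n)).toSphere =
      ∫ θ in {θ : Metric.sphere (0 : E n) 1 | 1 < N θ}, fluxDensity (fun y : E n => ‖y‖) Y 1 θ
      ∂(volume : Measure (E n)).toSphere := by
    rw [← integral_add_compl hms hi, ← integral_add_compl hms hi', hcompl] at hflux
    exact add_right_cancel hflux
  have heq : ∀ θ ∈ {θ : Metric.sphere (0 : E n) 1 | 1 < N θ},
      fluxDensity N Y 1 (θ : E n) = fluxDensity N (greenField x) 1 (θ : E n) := by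
    intro θ hθN
    have hθN : 1 < N θ := hθN
    have hθ : ‖(θ : E n)‖ = 1 := by simp
    have h0 : 0 < N θ := by linarith
    rw [fluxDensity, fluxDensity, hYX']
    · rw [one_mul, norm_smul, hθ, mul_one, norm_inv, Real.norm_of_nonneg h0.le]
      exact inv_le_one_of_one_le₀ hθN.le
    · rw [one_mul, hN.smul _ (by positivity), inv_mul_cancel₀ h0.ne']
      linarith
  refine ⟨hi.integrableOn.congr_fun heq hms, ?_⟩
  rw [← setIntegral_congr_fun hms heq, hmain]
  refine setIntegral_congr_fun hms fun θ hθN => ?_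
  have hθN : 1 < N θ := hθN
  have hθ : ‖(θ : E n)‖ = 1 := by simp
  beta_reduce
  rw [fluxDensity_norm hθ, hYX' θ hθ.le (by linarith), inner_greenField_of_norm_eq_one hx hθ]

/-- Integration against the area measure, in polar coordinates. -/
lemma IsGraphGauge.integral_area (hN : IsGraphGauge Γ ε N) (hΓ : IsKleinian Γ) {H : E n → ℝ}
    (hH : Measurable H) :
    (IntegrableOn (fun θ : Metric.sphere (0 : E n) 1 =>
        hypWeight n ((N θ)⁻¹ • (θ : E n)) * (N θ)⁻¹ ^ (n + 1) * ‖fderiv ℝ N θ‖ *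
          H ((N θ)⁻¹ • (θ : E n))) {θ | 1 < N θ} (volume : Measure (E n)).toSphere →
      Integrable (fun z : CBall n => H z) (area Γ ε)) ∧
    ∫ z : CBall n, H z ∂(area Γ ε) =
      ∫ θ in {θ : Metric.sphere (0 : E n) 1 | 1 < N θ},
        hypWeight n ((N θ)⁻¹ • (θ : E n)) * (N θ)⁻¹ ^ (n + 1) * ‖fderiv ℝ N θ‖ *
          H ((N θ)⁻¹ • (θ : E n)) ∂(volume : Measure (E n)).toSphere := by
  have hms : MeasurableSet {θ : Metric.sphere (0 : E n) 1 | 1 < N θ} :=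
    measurableSet_lt measurable_const (hN.continuous.measurable.comp measurable_subtype_coe)
  have hN' : Measurable (fun θ : Metric.sphere (0 : E n) 1 => N θ) :=
    hN.continuous.measurable.comp measurable_subtype_coe
  have hP : Measurable (fun θ : Metric.sphere (0 : E n) 1 => (N θ)⁻¹ • (θ : E n)) :=
    hN'.inv.smul measurable_subtype_coe
  have hw : Measurable (fun θ : Metric.sphere (0 : E n) 1 => ENNReal.ofReal
      (hypWeight n ((N θ)⁻¹ • (θ : E n)) * (N θ)⁻¹ ^ (n + 1) * ‖fderiv ℝ N θ‖)) := by
    have h3 := (measurable_hypWeight (n := n)).comp hP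
    have h4 := (measurable_fderiv ℝ N).comp
      (measurable_subtype_coe (p := (· ∈ Metric.sphere (0 : E n) 1)))
    simp only [Function.comp_def] at h3 h4
    exact ENNReal.measurable_ofReal.comp ((h3.mul (hN'.inv.pow_const _)).mul h4.norm)
  have hmeas : Measure.map (Subtype.val : CBall n → E n) (area Γ ε) =
      Measure.map (fun θ : Metric.sphere (0 : E n) 1 => (N θ)⁻¹ • (θ : E n))
        (((volume : Measure (E n)).toSphere.restrict {θ | 1 < N θ}).withDensity
          (fun θ => ENNReal.ofReal
            (hypWeight n ((N θ)⁻¹ • (θ : E n)) * (N θ)⁻¹ ^ (n + 1) * ‖fderiv ℝ N θ‖))) := by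
    refine Measure.ext_of_lintegral _ fun f hf => ?_
    rw [lintegral_map hf measurable_subtype_coe, lintegral_map hf hP, hN.lintegral_area hΓ hf,
      hN.lintegral_ambientArea hΓ hf, lintegral_withDensity_eq_lintegral_mul _ hw
      (show Measurable fun θ : Metric.sphere (0 : E n) 1 => f ((N θ)⁻¹ • (θ : E n)) from hf.comp hP)]
    rfl
  have heq : ∀ θ ∈ {θ : Metric.sphere (0 : E n) 1 | 1 < N θ},
      (ENNReal.ofReal (hypWeight n ((N θ)⁻¹ • (θ : E n)) * (N θ)⁻¹ ^ (n + 1) *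
        ‖fderiv ℝ N θ‖)).toReal • H ((N θ)⁻¹ • (θ : E n)) =
      hypWeight n ((N θ)⁻¹ • (θ : E n)) * (N θ)⁻¹ ^ (n + 1) * ‖fderiv ℝ N θ‖ *
        H ((N θ)⁻¹ • (θ : E n)) := by
    intro θ hθN
    have hθN : 1 < N θ := hθN
    have hlt : ‖(θ : E n)‖ < N θ := by rwa [show ‖(θ : E n)‖ = 1 by simp]
    have h1 := one_sub_sq_pos ((hN.mem_graphSet_iff hΓ).1 (hN.smul_mem_graphSet hΓ hlt)).1
    have h0 : 0 < N θ := by linarith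
    rw [ENNReal.toReal_ofReal (by unfold hypWeight; positivity), smul_eq_mul]
  constructor
  · intro hi
    change Integrable (H ∘ Subtype.val) (area Γ ε)
    rw [← integrable_map_measure hH.aestronglyMeasurable measurable_subtype_coe.aemeasurable,
      hmeas, integrable_map_measure hH.aestronglyMeasurable hP.aemeasurable,
      integrable_withDensity_iff_integrable_smul' hw
        (Filter.Eventually.of_forall fun _ => ENNReal.ofReal_lt_top)]
    exact hi.congr_fun (fun θ hθ => (heq θ hθ).symm) hms
  · rw [← integral_map measurable_subtype_coe.aemeasurable hH.aestronglyMeasurable, hmeas,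
      integral_map hP.aemeasurable hH.aestronglyMeasurable,
      integral_withDensity_eq_integral_toReal_smul hw
        (Filter.Eventually.of_forall fun _ => ENNReal.ofReal_lt_top)]
    exact setIntegral_congr_fun hms heq

lemma measurable_unitNormal (Γ : Subgroup (Equiv.Perm (CBall n))) (ε : ℝ) :
    Measurable (unitNormal Γ ε) := by
  have hg : Measurable (gradient (defFn Γ ε)) :=
    (LinearIsometryEquiv.continuous _).measurable.comp (measurable_fderiv ℝ _)
  unfold unitNormal
  fun_prop

lemma measurable_normalDeriv (Γ : Subgroup (Equiv.Perm (CBall n))) (ε : ℝ) (f : E n → ℝ) :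
    Measurable (normalDeriv Γ ε f) := by
  have h1 : Measurable (fun y => (fderiv ℝ f y, unitNormal Γ ε y)) :=
    (measurable_fderiv ℝ f).prodMk (measurable_unitNormal Γ ε)
  exact (ContinuousLinearMap.measurable_apply₂ (𝕜 := ℝ) (E := E n) (F := ℝ)).comp h1

lemma IsGraphGauge.unitNormal_eq (hN : IsGraphGauge Γ ε N) (hΓ : IsKleinian Γ) {y : E n}
    (hy : y ∈ graphSet Γ ε) (hd : DifferentiableAt ℝ N y) : unitNormal Γ ε y =
      ((1 - ‖y‖ ^ 2) / 2) • (‖gradient N y‖⁻¹ • gradient N y) := by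
  have hy0 : y ≠ 0 := hN.ne_zero_of_lt (by
    rw [((hN.mem_graphSet_iff hΓ).1 hy).2]; exact ((hN.mem_graphSet_iff hΓ).1 hy).1)
  rw [unitNormal, hN.gradient_defFn hΓ hy hd, norm_smul, norm_norm, mul_inv,
    smul_smul _ ‖y‖, mul_right_comm, inv_mul_cancel₀ (norm_ne_zero_iff.2 hy0), one_mul]

/-- The normal derivative of the Green's function of the ball on the graph. -/
lemma IsGraphGauge.normalDeriv_ballGreen (hn : 1 ≤ n) (hN : IsGraphGauge Γ ε N) (hΓ : IsKleinian Γ)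
    {x y : E n} (hx : ‖x‖ < 1) (hxy : x ≠ y) (hy : y ∈ graphSet Γ ε)
    (hd : DifferentiableAt ℝ N y) :
    hypWeight n y * ‖fderiv ℝ N y‖ * normalDeriv Γ ε (ballGreen x) y =
      fderiv ℝ N y (greenField x y) := by
  obtain ⟨hy1, hNy⟩ := (hN.mem_graphSet_iff hΓ).1 hy
  have hs := one_sub_sq_pos hy1
  have hg0 : 0 < ‖fderiv ℝ N y‖ := by
    rw [norm_pos_iff]
    refine hN.fderiv_ne_zero (hN.ne_zero_of_lt ?_) hd
    rw [hNy]
    exact hy1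
  rw [normalDeriv, hN.unitNormal_eq hΓ hy hd, (hasFDerivAt_ballGreen hn hx hy1 hxy).fderiv,
    innerSL_apply_apply, inner_smul_left, inner_smul_right, inner_smul_right, norm_gradient,
    real_inner_comm, gradient, InnerProductSpace.toDual_symm_apply, hypWeight]
  simp only [conj_trivial]
  obtain ⟨k, rfl⟩ : ∃ k, n = k + 1 := ⟨n - 1, by omega⟩
  -- The area weight `(2 / (1 - |y|^2))^n` cancels one factor `(1 - |y|^2) / 2` from the unit normal
  -- and `n - 1` from the gradient.
  rw [add_tsub_cancel_right, div_pow, div_pow, pow_succ, pow_succ]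
  field_simp

end Flux

/-! ### Unfolding the integral over a fundamental domain -/

section Unfolding

variable {Γ : Subgroup (Equiv.Perm (CBall n))} {ε : ℝ} {N : E n → ℝ} {x : CBall n}

/-- The flux of the Green's function of the ball through the whole graph. -/
theorem IsGraphGauge.integral_normalDeriv_ballGreen (hn : 1 ≤ n) (hN : IsGraphGauge Γ ε N)
    (hΓ : IsKleinian Γ) {x : E n} (hx : ‖x‖ < 1) (hNx : N x < 1) :
    Integrable (fun z : CBall n => -normalDeriv Γ ε (ballGreen x) z) (area Γ ε) ∧
    ∫ z : CBall n, -normalDeriv Γ ε (ballGreen x) z ∂(area Γ ε) =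
      2 ^ (n - 1) * ∫ θ in {θ : Metric.sphere (0 : E n) 1 | 1 < N θ},
        ((1 - ‖x‖ ^ 2) / ‖x - (θ : E n)‖ ^ 2) ^ n ∂(volume : Measure (E n)).toSphere := by
  have hms : MeasurableSet {θ : Metric.sphere (0 : E n) 1 | 1 < N θ} :=
    measurableSet_lt measurable_const (hN.continuous.measurable.comp measurable_subtype_coe)
  obtain ⟨hi, heq⟩ := hN.integral_flux_greenField hx hNx
  obtain ⟨h1, h2⟩ := hN.integral_area hΓ (measurable_normalDeriv Γ ε (ballGreen x)).neg
  have hae : (fun θ : Metric.sphere (0 : E n) 1 => -fluxDensity N (greenField x) 1 θ)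
      =ᵐ[(volume : Measure (E n)).toSphere.restrict {θ | 1 < N θ}]
      fun θ => hypWeight n ((N θ)⁻¹ • (θ : E n)) * (N θ)⁻¹ ^ (n + 1) * ‖fderiv ℝ N θ‖ *
          -normalDeriv Γ ε (ballGreen x) ((N θ)⁻¹ • (θ : E n)) := by
    filter_upwards [ae_restrict_of_ae hN.ae_sphere_differentiableAt, ae_restrict_mem hms]
      with θ hd hθN
    have hθN : 1 < N θ := hθN
    have h0 : 0 < N θ := by linarith
    have hg := hN.smul_mem_graphSet hΓ (y := (θ : E n)) (by rwa [show ‖(θ : E n)‖ = 1 by simp])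
    have hd' : DifferentiableAt ℝ N ((N θ)⁻¹ • (θ : E n)) := by
      apply differentiableAt_gauge_smul hN.smul h0
      rwa [smul_smul, mul_inv_cancel₀ h0.ne', one_smul]
    have hxy : x ≠ (N θ)⁻¹ • (θ : E n) := by
      intro h
      have := ((hN.mem_graphSet_iff hΓ).1 hg).2
      rw [← h] at this
      linarith
    have h3 := hN.normalDeriv_ballGreen hn hΓ hx hxy hg hd'
    rw [fderiv_gauge_smul hN.smul (by positivity)] at h3
    rw [fluxDensity, one_mul, ← h3]
    ring
  refine ⟨h1 (hi.neg.congr hae), ?_⟩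
  refine h2.trans ?_
  rw [← integral_const_mul]
  refine (integral_congr_ae hae).symm.trans ?_
  rw [integral_neg, heq, ← integral_neg]
  refine integral_congr_ae (Filter.Eventually.of_forall fun θ => ?_)
  beta_reduce
  ring

/-- Chain rule for the invariance of the Green's function, together with equivariance of the normal.
-/
lemma IsGraphGauge.normalDeriv_ballGreen_map (hn : 1 ≤ n) (hN : IsGraphGauge Γ ε N)
    (hΓ : IsKleinian Γ) (hx : ‖(x : E n)‖ < 1) {γ : Equiv.Perm (CBall n)} (hγ : γ ∈ Γ)
    {z : CBall n} (hxz : x ≠ z) (hz : (z : E n) ∈ graphSet Γ ε)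
    (hd : DifferentiableAt ℝ N (z : E n)) (hd' : DifferentiableAt ℝ N (γ z : E n)) :
    normalDeriv Γ ε (ballGreen (γ x : E n)) (γ z) = normalDeriv Γ ε (ballGreen (x : E n)) z := by
  have hI := hΓ.isBallIsometry hγ
  have hz1 : ‖(z : E n)‖ < 1 := ((hN.mem_graphSet_iff hΓ).1 hz).1
  have hne : (γ x : E n) ≠ ballExt γ z := by
    rw [ballExt_coe]
    exact fun h => hxz (γ.injective (Subtype.ext h))
  have hG := hasFDerivAt_ballGreen hn (hI.maps x hx) (y := ballExt γ z)
    (by rw [ballExt_coe]; exact hI.maps z hz1) hne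
  have he : ballGreen (x : E n) =ᶠ[nhds (z : E n)] ballGreen (γ x : E n) ∘ ballExt γ := by
    filter_upwards [(isOpen_lt continuous_norm continuous_const).mem_nhds hz1] with w hw
    have hw : ‖w‖ ≤ 1 := le_of_lt hw
    have := hI.ballGreen_map x ⟨w, by simpa using hw⟩
    rw [Function.comp_apply, ballExt, dif_pos hw, this]
  have hu := hN.unitNormal_map hΓ hγ hz hd (by rwa [ballExt_coe])
  rw [normalDeriv, normalDeriv, he.fderiv_eq,
    fderiv_comp _ hG.differentiableAt (hI.differentiableAt_ballExt hz1),
    ContinuousLinearMap.comp_apply, ← hu, ballExt_coe]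

/-- The normal derivative of the minimal Green's function of the quotient, as a sum over the
group. -/
lemma IsGraphGauge.ae_normalDeriv_minimalGreen (hn : 1 ≤ n) (hN : IsGraphGauge Γ ε N)
    (hΓ : IsKleinian Γ) (hsk : IsSecondKind Γ) (hx : ‖(x : E n)‖ < 1) (hNx : N x < 1) :
    ∀ᵐ z : CBall n ∂(area Γ ε), -normalDeriv Γ ε (minimalGreen Γ x) z =
      ∑' γ : Γ, -normalDeriv Γ ε (ballGreen (x : E n)) ((γ⁻¹ • z : CBall n) : E n) := by
  have := hΓ.countable
  have hs := hN.summable_orbit hΓ hsk hx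
  have hall : ∀ᵐ z : CBall n ∂(area Γ ε), ∀ γ : Γ,
      DifferentiableAt ℝ N (((γ⁻¹ : Γ) : Equiv.Perm (CBall n)) z : E n) :=
    ae_all_iff.2 fun γ => hN.ae_area_map hΓ (γ⁻¹).2 (hN.ae_area_differentiableAt hΓ)
  filter_upwards [hN.ae_area_mem_graphSet hΓ, hN.ae_area_differentiableAt hΓ, hall] with z hz hd hda
  obtain ⟨hz1, -⟩ := (hN.mem_graphSet_iff hΓ).1 hz
  have hzγ : ∀ γ : Γ, (((γ⁻¹ : Γ) : Equiv.Perm (CBall n)) z : E n) ∈ graphSet Γ ε :=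
    fun γ => hN.map_mem_graphSet hΓ (γ⁻¹).2 hz
  have hcancel : ∀ γ : Γ, (γ : Equiv.Perm (CBall n)) (((γ⁻¹ : Γ) : Equiv.Perm (CBall n)) z) = z :=
    fun γ => (γ : Equiv.Perm (CBall n)).apply_symm_apply z
  have hxz : ∀ γ : Γ, x ≠ ((γ⁻¹ : Γ) : Equiv.Perm (CBall n)) z := by
    intro γ h
    have := ((hN.mem_graphSet_iff hΓ).1 (hzγ γ)).2
    rw [← h] at this
    linarith
  have hzV : (z : E n) ∈ Metric.ball (0 : E n) 1 \ orbitSet Γ x := by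
    refine ⟨by simpa using hz1, fun h => ?_⟩
    obtain ⟨γ, hγ⟩ := mem_orbitSet_iff.1 h
    refine hxz γ ?_
    rw [← show (γ : Equiv.Perm (CBall n)) x = z from Subtype.ext hγ]
    exact ((γ : Equiv.Perm (CBall n)).symm_apply_apply x).symm
  have hV := hΓ.isOpen_ball_diff_orbitSet hx
  obtain ⟨-, hsum, hder, -⟩ := greenSum_of_summable hn (hΓ.norm_orbit_lt hx) hs hV
    Set.sdiff_subset fun y hy => hΓ.exists_separation_of_notMem hx hy
  have he : minimalGreen Γ x =ᶠ[nhds (z : E n)] fun y => ∑' γ : Γ,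
      ballGreen ((γ : Equiv.Perm (CBall n)) x : E n) y := by
    filter_upwards [hV.mem_nhds hzV] with y hy
    exact minimalGreen_eq hn hΓ hx hs hy
  -- Moving the group element from the point to the pole turns the terms into the normal derivatives
  -- at the single point `z` of the Green's functions with poles `γ x`, whose sum is known.
  have h1 : ∀ γ : Γ, normalDeriv Γ ε (ballGreen (x : E n)) ((γ⁻¹ • z : CBall n) : E n) =
      inner ℝ (((1 - ‖(z : E n)‖ ^ 2) / 2) ^ (n - 1) • unitNormal Γ ε z)
        (greenField ((γ : Equiv.Perm (CBall n)) x : E n) z) := by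
    intro γ
    have h2 := hN.normalDeriv_ballGreen_map hn hΓ hx γ.2 (hxz γ) (hzγ γ) (hda γ)
      (by rw [hcancel]; exact hd)
    rw [hcancel] at h2
    refine h2.symm.trans ?_
    rw [normalDeriv, (hasFDerivAt_ballGreen hn (hΓ.norm_orbit_lt hx γ) hz1 fun h =>
      hzV.2 (mem_orbitSet_iff.2 ⟨γ, h⟩)).fderiv, innerSL_apply_apply, inner_smul_left,
      inner_smul_left, real_inner_comm]
  have h3 := (innerSL ℝ (((1 - ‖(z : E n)‖ ^ 2) / 2) ^ (n - 1) • unitNormal Γ ε z)).map_tsum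
    (hsum z hzV)
  simp only [innerSL_apply_apply] at h3
  rw [tsum_neg, tsum_congr h1, ← h3, normalDeriv, he.fderiv_eq, (hder z hzV).fderiv,
    innerSL_apply_apply, inner_smul_left, inner_smul_left, real_inner_comm]

/-- Unfolding. Integrability of the single term over the whole graph bounds the sum of the integrals
of the absolute values over `D`, which gives integrability over `D` and justifies exchanging sum and
integral. -/
theorem IsGraphGauge.integral_normalDeriv_minimalGreen (hn : 1 ≤ n) (hN : IsGraphGauge Γ ε N)
    (hΓ : IsKleinian Γ) (hsk : IsSecondKind Γ) (hx : ‖(x : E n)‖ < 1) (hNx : N x < 1)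
    {D : Set (CBall n)} (hD : IsFundamentalDomain Γ D (area Γ ε)) :
    IntegrableOn (fun z : CBall n => -normalDeriv Γ ε (minimalGreen Γ x) (z : E n)) D (area Γ ε) ∧
    ∫ z in D, -normalDeriv Γ ε (minimalGreen Γ x) (z : E n) ∂(area Γ ε) =
      ∫ z : CBall n, -normalDeriv Γ ε (ballGreen (x : E n)) z ∂(area Γ ε) := by
  have := hΓ.countable
  have := hN.smulInvariantMeasure hΓ
  have : MeasurableConstSMul Γ (CBall n) :=
    ⟨fun γ => (hΓ.isBallIsometry γ.2).cont.measurable⟩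
  obtain ⟨hi, -⟩ := hN.integral_normalDeriv_ballGreen hn hΓ hx hNx
  set f : CBall n → ℝ := fun z => -normalDeriv Γ ε (ballGreen (x : E n)) z with hf
  have hfm : Measurable f :=
    (measurable_normalDeriv Γ ε (ballGreen (x : E n))).neg.comp measurable_subtype_coe
  have hfin : ∑' γ : Γ, ∫⁻ z in D, ‖f (γ⁻¹ • z)‖ₑ ∂(area Γ ε) ≠ ⊤ := by
    rw [← hD.lintegral_eq_tsum' fun z => ‖f z‖ₑ]
    exact hi.hasFiniteIntegral.ne
  have hm : ∀ γ : Γ, Measurable fun z : CBall n => f (γ⁻¹ • z) :=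
    fun γ => hfm.comp (measurable_const_smul γ⁻¹)
  have hae : (fun z : CBall n => -normalDeriv Γ ε (minimalGreen Γ x) (z : E n))
      =ᵐ[(area Γ ε).restrict D] fun z => ∑' γ : Γ, f (γ⁻¹ • z) :=
    ae_restrict_of_ae (hN.ae_normalDeriv_minimalGreen hn hΓ hsk hx hNx)
  constructor
  · refine ⟨((measurable_normalDeriv Γ ε _).neg.comp measurable_subtype_coe).aestronglyMeasurable,
      ?_⟩
    rw [hasFiniteIntegral_congr hae, hasFiniteIntegral_iff_enorm]
    calc ∫⁻ z in D, ‖∑' γ : Γ, f (γ⁻¹ • z)‖ₑ ∂(area Γ ε)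
        ≤ ∫⁻ z in D, ∑' γ : Γ, ‖f (γ⁻¹ • z)‖ₑ ∂(area Γ ε) :=
          lintegral_mono fun z => enorm_tsum_le_tsum_enorm
      _ = ∑' γ : Γ, ∫⁻ z in D, ‖f (γ⁻¹ • z)‖ₑ ∂(area Γ ε) :=
          lintegral_tsum fun γ => (hm γ).enorm.aemeasurable
      _ < ⊤ := hfin.lt_top
  · rw [integral_congr_ae hae, integral_tsum (fun γ => (hm γ).aestronglyMeasurable) hfin,
      hD.integral_eq_tsum' f hi]

lemma IsGraphGauge.harmonicMeasure_eq (hN : IsGraphGauge Γ ε N) (x : E n) :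
    harmonicMeasure Γ x = 1 / sphereVolume n *
      ∫ θ in {θ : Metric.sphere (0 : E n) 1 | 1 < N θ},
        ((1 - ‖x‖ ^ 2) / ‖x - (θ : E n)‖ ^ 2) ^ n ∂(volume : Measure (E n)).toSphere := by
  have hms : MeasurableSet {θ : Metric.sphere (0 : E n) 1 | 1 < N θ} :=
    measurableSet_lt measurable_const (hN.continuous.measurable.comp measurable_subtype_coe)
  classical
  rw [harmonicMeasure, ← integral_indicator hms]
  congr 2
  funext θ
  have h := hN.mem_domain_iff (θ := (θ : E n)) (by simp)
  by_cases hθ : 1 < N θ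
  · rw [Set.indicator_apply, Set.indicator_apply, if_pos (h.2 hθ), mul_one]
    exact (if_pos (show θ ∈ {θ : Metric.sphere (0 : E n) 1 | 1 < N θ} from hθ)).symm
  · rw [Set.indicator_apply, Set.indicator_apply, if_neg (mt h.1 hθ), mul_zero]
    exact (if_neg (show θ ∉ {θ : Metric.sphere (0 : E n) 1 | 1 < N θ} from hθ)).symm

end Unfolding

end KleinianGraph

end

open KleinianGraph in
theorem lemma4p2 (n : ℕ) (hn : 1 ≤ n) (Γ : Subgroup (Equiv.Perm (CBall n)))
    (hΓ : IsKleinian Γ) (hne : IsNonelementary Γ) (hsk : IsSecondKind Γ) :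
    ∃ ε₁ : ℝ, 0 < ε₁ ∧ ∀ ε : ℝ, 0 < ε → ε < ε₁ →
      ∀ D : Set (CBall n), IsFundamentalDomain Γ D (area Γ ε) →
        ∀ x : CBall n, ‖(x : E n)‖ < 1 → (x : E n) ∉ closure (domeUnion Γ ε) →
          IntegrableOn (fun y : CBall n => -normalDeriv Γ ε (minimalGreen Γ x) (y : E n)) D
            (area Γ ε) ∧
          harmonicMeasure Γ (x : E n) =
            1 / (2 ^ (n - 1) * sphereVolume n) *
              ∫ y in D, -normalDeriv Γ ε (minimalGreen Γ x) (y : E n) ∂(area Γ ε) := by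
  obtain ⟨m₁, hm₁, m₂, hm₂, hm⟩ : (limitSet Γ).Nontrivial := by
    rw [← Set.one_lt_encard_iff_nontrivial]
    exact lt_trans (by norm_num) hne
  -- Two distinct limit points fix the scale: `1 / 4` keeps each cap small against its distance to
  -- the limit set, and `|m₁ - m₂| / 50` is what `center_estimate` needs to control the images of
  -- caps.
  refine ⟨min (1 / 4) (‖m₁ - m₂‖ / 50), lt_min (by norm_num)
    (div_pos (norm_pos_iff.2 (sub_ne_zero.2 hm)) (by norm_num)), ?_⟩
  intro ε hε hε₁ D hD x hx hxU
  have h1 : ε ≤ 1 / 4 := hε₁.le.trans (min_le_left _ _)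
  have h2 : ε ≤ ‖m₁ - m₂‖ / 50 := hε₁.le.trans (min_le_right _ _)
  have hN := isGraphGauge_graphGauge hΓ hm₁ hm₂ hε h1 (by linarith)
  have hNx := hN.lt_one_of_notMem_closure hx hxU
  obtain ⟨hi, heq⟩ := hN.integral_normalDeriv_minimalGreen hn hΓ hsk hx hNx hD
  refine ⟨hi, ?_⟩
  rw [heq, (hN.integral_normalDeriv_ballGreen hn hΓ hx hNx).2, hN.harmonicMeasure_eq]
  field_simp
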